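/- **Setting.** Let $\Sigma$ be an alphabet (a finite non-empty set, given to an algorithm as $\{0,\dots,s-1\}$), let $\square\notin\Sigma$ be a padding symbol, let $w\ge 1$, and let $\tau=(R_1,\dots,R_r)$ be a relational vocabulary with arities $a_1,\dots,a_r\ge 1$. For a finite alphabet $A$ with padding symbol $\square\notin A$, an *$(A,w)$-layer* consists of sets $\ell,\rho\subseteq\{0,\dots,w-1\}$ of left and right states, a set of transitions $\theta\subseteq \ell\times(A\sqcup\{\square\})\times \rho$, a set of initial states $I\subseteq\ell$, a set of final states $F\subseteq \rho$, and two Boolean flags $\iota,\phi$ such that $I=\emptyset$ if $\iota$ is false and $F=\emptyset$ if $\phi$ is false. An *$(A,w)$-ODD* of length $k\ge 1$ is a sequence of $k$ layers such that the left states of each layer after the first are the right states of the preceding one, the first layer is the only one whose flag $\iota$ is true, and the last layer is the only one whose flag $\phi$ is true. It *accepts* a non-empty string $u$ over $A$ of length at most $k$ if, after $u$ is padded with $\square$ to length $k$, there is a sequence of consecutive transitions, one from each layer, labelled by the padded string, that starts in an initial state of the first layer and ends in a final state of the last layer; $L(D)$ is the set of strings accepted by $D$. The *tensor product* $u_1\otimes\cdots\otimes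 u_a$ of strings over $\Sigma$ is the string of length $\max_i|u_i|$ over $(\Sigma\sqcup\{\square\})^{a}$ whose $j$-th letter is the tuple of the $j$-th letters of the $u_i$, with $\square$ in the coordinates where $j>|u_i|$. A *$(\Sigma,w,\tau)$-structural tuple of length $k$* is a tuple $\mathfrak D=(D_0,D_1,\dots,D_r)$ in which $D_0$ is a $(\Sigma,w)$-ODD of length $k$ and each $D_i$, $1\le i\le r$, is an ODD of length $k$ and width at most $w$ over the tensor alphabet $(\Sigma\sqcup\{\square\})^{a_i}$ (in particular, ODDs over the subalphabet $\Sigma^{a_i}$ are allowed) with $L(D_i)\subseteq\{u_1\otimes\cdots\otimes u_{a_i} : u_1,\dots,u_{a_i}\in L(D_0)\}$. Its *derived structure* $\mathfrak s(\mathfrak D)$ is the $\tau$-structure with domain $L(D_0)$ and $R_i=\{(u_1,\dots,u_{a_i}) : u_1\otimes\cdots\otimes u_{a_i}\in L(D_i)\}$. **Theorem.** There are a multi-tape Turing machine and a computable function $f$ such that the following holds for every alphabet $\Sigma$, every $w\ge 1$, every relational vocabulary $\tau$, every $m\ge 0$ and every first-order formula $\varphi(x_1,\dots,x_m)$ over $\tau$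 whose free variables are among $x_1,\dots,x_m$. Given $\Sigma,w,\tau,m,\varphi$ and a $(\Sigma,w,\tau)$-structural tuple $\mathfrak D$ of length $k$, the machine outputs, in binary, the number of assignments $(u_1,\dots,u_m)\in L(D_0)^m$ with $\mathfrak s(\mathfrak D)\models\varphi[u_1,\dots,u_m]$, in time at most $f(\Sigma,w,\tau,\varphi,m)\cdot k^2$. -/

import Mathlib

/-! ### Ordered decision diagrams -/

/-- A layer of width at most `w` over the alphabet `A`: left and right states, transitions labelled
by a letter of `A` or by the padding symbol (`none`), initial and final states and the two flags. -/
structure Layer (A : Type) (w : ℕ) where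
  left : Finset (Fin w)
  right : Finset (Fin w)
  trans : Finset (Fin w × Option A × Fin w)
  initial : Finset (Fin w)
  final : Finset (Fin w)
  initialFlag : Bool
  finalFlag : Bool
  trans_sub : ∀ t ∈ trans, t.1 ∈ left ∧ t.2.2 ∈ right
  initial_sub : initial ⊆ left
  final_sub : final ⊆ right
  initial_eq_empty : initialFlag = false → initial = ∅
  final_eq_empty : finalFlag = false → final = ∅

/-- The sequence `D` of `k` layers is an ordered decision diagram (ODD) of length `k`. -/
structure IsODD {A : Type} {w k : ℕ} (D : Fin k → Layer A w) : Prop where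
  length_pos : 0 < k
  left_eq_right : ∀ i j : Fin k, j.val = i.val + 1 → (D j).left = (D i).right
  initialFlag_iff : ∀ i : Fin k, (D i).initialFlag = true ↔ i.val = 0
  finalFlag_iff : ∀ i : Fin k, (D i).finalFlag = true ↔ i.val + 1 = k

/-- The sequence `t` of transitions is accepting for the string `u` in `D`. The `i`-th label of the
padded string is `u[i]?`: a letter inside `u`, the padding symbol `none` after its end. -/
structure IsAccepting {A : Type} {w k : ℕ} (D : Fin k → Layer A w) (u : List A)
    (t : Fin k → Fin w × Option A × Fin w) : Prop where
  label_eq : ∀ i : Fin k, (t i).2.1 = u[i.val]?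
  mem_trans : ∀ i : Fin k, t i ∈ (D i).trans
  consecutive : ∀ i j : Fin k, j.val = i.val + 1 → (t j).1 = (t i).2.2
  mem_initial : ∀ i : Fin k, i.val = 0 → (t i).1 ∈ (D i).initial
  mem_final : ∀ i : Fin k, i.val + 1 = k → (t i).2.2 ∈ (D i).final

/-- The language of an ODD of length `k`: the accepted non-empty strings of length at most `k`. -/
def oddLang {A : Type} {w k : ℕ} (D : Fin k → Layer A w) : Set (List A) :=
  {u | u ≠ [] ∧ u.length ≤ k ∧ ∃ t, IsAccepting D u t}

/-- The tensor product (convolution) of `a` strings, padded by `none` to the maximal length. -/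
def tensor {A : Type} {a : ℕ} (u : Fin a → List A) : List (Fin a → Option A) :=
  List.ofFn (n := Finset.univ.sup fun i => (u i).length) fun j i => (u i)[j.val]?

/-- The `a`-fold tensor power of a language. -/
def tensorPow {A : Type} (L : Set (List A)) (a : ℕ) : Set (List (Fin a → Option A)) :=
  {x | ∃ u : Fin a → List A, (∀ i, u i ∈ L) ∧ tensor u = x}

/-! ### Structural tuples and the structures derived from them -/

/-- A relational vocabulary: finitely many relation symbols of positive arities. -/
structure RelVocab where
  numRel : ℕ
  arity : Fin numRel → ℕ
  arity_pos : ∀ i, 0 < arity i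

/-- The first-order language of a relational vocabulary. -/
def RelVocab.lang (V : RelVocab) : FirstOrder.Language where
  Functions _ := Empty
  Relations n := {i : Fin V.numRel // V.arity i = n}

/-- A tuple of sequences of `k` layers, one over the alphabet `A`, and one for each relation symbol.
The letters for a symbol of arity `a` are `a`-tuples over `A` in which the padding symbol may occur,
so that convolutions of strings of different lengths are strings over this alphabet. -/
structure LayerTuple (A : Type) (w : ℕ) (V : RelVocab) (k : ℕ) where
  dom : Fin k → Layer A w
  rel : (i : Fin V.numRel) → Fin k → Layer (Fin (V.arity i) → Option A) w

/-- The tuple is structural, of length `k`. -/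
structure LayerTuple.IsStructural {A : Type} {w : ℕ} {V : RelVocab} {k : ℕ}
    (T : LayerTuple A w V k) : Prop where
  isODD_dom : IsODD T.dom
  isODD_rel : ∀ i, IsODD (T.rel i)
  lang_subset : ∀ i, oddLang (T.rel i) ⊆ tensorPow (oddLang T.dom) (V.arity i)

/-- The domain of the derived structure. -/
def LayerTuple.Domain {A : Type} {w : ℕ} {V : RelVocab} {k : ℕ} (T : LayerTuple A w V k) : Type :=
  {u : List A // u ∈ oddLang T.dom}

/-- The derived structure: a tuple of strings is in a relation if and only if its tensor product is
accepted by the ODD of the relation. -/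
instance LayerTuple.derivedStructure {A : Type} {w : ℕ} {V : RelVocab} {k : ℕ}
    (T : LayerTuple A w V k) : V.lang.Structure T.Domain where
  funMap f _ := Empty.elim f
  RelMap R x := tensor (fun j : Fin (V.arity R.val) => (x (Fin.cast R.property j)).val) ∈
    oddLang (T.rel R.val)

/-- The number of assignments of domain elements to the variables `x₁, …, xₘ` that satisfy `φ` in
the derived structure. -/
noncomputable def LayerTuple.countSat {A : Type} {w : ℕ} {V : RelVocab} {k m : ℕ}
    (T : LayerTuple A w V k) (φ : V.lang.Formula (Fin m)) : ℕ :=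
  Nat.card {v : Fin m → T.Domain // φ.Realize v}

/-! ### Encoding of the parameters -/

/-- The number of a variable: free variables are numbered `0, …, m - 1`, bound ones from `m` on. -/
def termCode {V : RelVocab} {m n : ℕ} : V.lang.Term (Fin m ⊕ Fin n) → ℕ
  | .var (.inl i) => i.val
  | .var (.inr j) => m + j.val
  | .func f _ => Empty.elim f

/-- Formulas in prefix notation, as sequences of numbers. -/
def formulaCode {V : RelVocab} {m : ℕ} : {n : ℕ} → V.lang.BoundedFormula (Fin m) n → List ℕ
  | _, .falsum => [0]
  | _, .equal t₁ t₂ => [1, termCode t₁, termCode t₂]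
  | _, .rel R ts => 2 :: R.val.val :: List.ofFn fun j => termCode (ts j)
  | _, .imp φ ψ => 3 :: (formulaCode φ ++ formulaCode ψ)
  | _, .all φ => 4 :: formulaCode φ

/-- The parameters as a sequence of numbers: the size `s` of the alphabet, the width, the vocabulary
(number of symbols and list of arities), the number of variables, and the formula. -/
def paramCode (s w : ℕ) (V : RelVocab) (m : ℕ) (φ : V.lang.Formula (Fin m)) : List ℕ :=
  s :: w :: V.numRel :: (List.ofFn V.arity ++ m :: formulaCode φ)

/-! ### Encoding of the instances -/

/-- All `a`-tuples over the list `l`, in lexicographic order. -/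
def allTuples {B : Type} (l : List B) : (a : ℕ) → List (Fin a → B)
  | 0 => [Fin.elim0]
  | a + 1 => l.flatMap fun b => (allTuples l a).map fun t => (Fin.cons b t : Fin (a + 1) → B)

/-- The characteristic bit string of `S` with respect to the list `l` of all elements. -/
def bitTable {B : Type} [DecidableEq B] (l : List B) (S : Finset B) : List Bool :=
  l.map fun b => decide (b ∈ S)

/-- The bit string of a layer, where `l` lists the letters of the alphabet. -/
def Layer.code {A : Type} [DecidableEq A] {w : ℕ} (l : List A) (B : Layer A w) : List Bool :=
  B.initialFlag :: B.finalFlag ::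
    (bitTable (List.finRange w) B.left ++ bitTable (List.finRange w) B.right ++
      bitTable (List.finRange w) B.initial ++ bitTable (List.finRange w) B.final ++
      bitTable (List.finRange w ×ˢ ((none :: l.map some) ×ˢ List.finRange w)) B.trans)

/-- The bit string of the `j`-th layers of all components of a tuple. -/
def LayerTuple.code {s w : ℕ} {V : RelVocab} {k : ℕ} (T : LayerTuple (Fin s) w V k) (j : Fin k) :
    List Bool :=
  (T.dom j).code (List.finRange s) ++
    (List.finRange V.numRel).flatMap fun i =>
      (T.rel i j).code (allTuples (none :: (List.finRange s).map some) (V.arity i))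

/-- The unary notation of a number, with an end marker. -/
def unary (n : ℕ) : List Bool := List.replicate n true ++ [false]

/-- The input word, over bits (`some b`) and a separator (`none`): the parameters in unary, then
position by position the layers of the tuple. -/
def inputWord {s w : ℕ} {V : RelVocab} {k m : ℕ} (φ : V.lang.Formula (Fin m))
    (T : LayerTuple (Fin s) w V k) : List (Option Bool) :=
  ((paramCode s w V m φ).flatMap unary).map some ++
    none :: (List.finRange k).flatMap fun j => (T.code j).map some ++ [none]

/-! ### Running time -/

/-- On the input `x` the multi-stack Turing machine `M` halts with output `y` after at most `t`
steps. -/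
def OutputsWithin {B C : Type} (M : Turing.TM2ComputableAux B C) (x : List B) (y : List C) (t : ℕ) :
    Prop :=
  Nonempty (Turing.TM2OutputsInTime M.tm (x.map M.inputAlphabet.symm)
    (some (y.map M.outputAlphabet.symm)) t)

/-! The derived structure of a structural tuple is automatic: for every formula there is a finite
automaton that reads the layers one by one together with one letter (or padding symbol) for each
variable, and that accepts the words that encode a satisfying assignment. An atomic formula is
treated by the subset construction for the decision diagram of its relation, an implication by a
product, and a universal quantifier by a set of pairs of a state for the domain and a state for the
subformula, one pair for each choice of the letters of the bound variable (`accCode_iff`). Hence the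
number of satisfying assignments is the number of words of letters of the free variables that the
automaton accepts (`countP_stateList`), and it is found by computing, layer by layer, how many words
lead to each state.

After `j` layers these numbers have `O(j)` binary digits. They are kept on a stack whose `i`-th entry,
a *row*, is the set of the states whose number has the `i`-th digit one. A pass over the stack
replaces the states of each row by their successors and passes half of their multiplicities on to
the next row as a carry; it is linear in the number of rows, so that all `k` passes take `O(k ^ 2)`
steps (`steps_result`). The numbers are never computed explicitly: the `value` of the rows with
respect to every weight of the states is an invariant.

States, rows, carries and the bit string of the current layer are coded as natural numbers, and the
counting machine is a *number machine*: its control state and the entries of its two work stacks are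
natural numbers, and one primitive recursive function (`counter`), the same for all parameters, maps
the last response and the control state to the next instruction. Such a machine is simulated by a
Turing machine with several stacks, which evaluates the function by the stack machine that Mathlib
builds for a partial recursive function (`outputsWithin_of_run`).

For given parameters only finitely many control states and stack entries occur, whatever the layers
are (`exists_closed`), and so there is a bound on the time that one step of the number machine takes.
A computable function finds such a bound by unbounded search, because it is a primitive recursive
property of two finite lists and a bound that the lists are closed under the program and that all
evaluations on them respect the bound (`exists_computable_bounds`). -/

namespace OddCount

section NumberMachine

open Turing

/-! ### Bounded runs of transition systems -/

/-- The transition system `f` leads from `a` to `b` in at most `n` steps. -/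
def StepsWithin {α : Type*} (f : α → Option α) (n : ℕ) (a b : α) : Prop :=
  ∃ m ≤ n, (flip bind f)^[m] (some a) = some b

namespace StepsWithin

variable {α : Type*} {f : α → Option α}

theorem refl (a : α) : StepsWithin f 0 a a := ⟨0, le_rfl, rfl⟩

theorem mono {n n' : ℕ} {a b : α} (h : StepsWithin f n a b) (hn : n ≤ n') :
    StepsWithin f n' a b :=
  let ⟨m, hm, e⟩ := h
  ⟨m, hm.trans hn, e⟩

theorem trans {n n' : ℕ} {a b c : α} (h : StepsWithin f n a b) (h' : StepsWithin f n' b c) :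
    StepsWithin f (n + n') a c := by
  obtain ⟨m, hm, e⟩ := h
  obtain ⟨m', hm', e'⟩ := h'
  exact ⟨m' + m, by omega, by rw [Function.iterate_add_apply, e, e']⟩

theorem single {a b : α} (h : f a = some b) : StepsWithin f 1 a b :=
  ⟨1, le_rfl, h⟩

theorem head {n : ℕ} {a b c : α} (h : f a = some b) (h' : StepsWithin f n b c) :
    StepsWithin f (n + 1) a c :=
  ((single h).trans h').mono (by omega)

end StepsWithin

theorem exists_stepsWithin_of_reaches {α : Type*} {f : α → Option α} {a b : α}
    (h : StateTransition.Reaches f a b) : ∃ n, StepsWithin f n a b := by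
  induction h using Relation.ReflTransGen.head_induction_on with
  | refl => exact ⟨0, .refl b⟩
  | head h _ ih =>
    obtain ⟨n, hn⟩ := ih
    exact ⟨n + 1, .head h hn⟩

/-! ### Machines with a number as control state -/

/-- The discrete part of an instruction: whether to push the value on the first or on the second
work stack; whether to output a bit, and which one; and the source of the next response, where
`(false, false)` stands for halting, `(true, false)` and `(false, true)` for the first and the
second work stack, and `(true, true)` for the input. -/
abbrev Cmd := (Bool × Bool) × (Bool × Bool) × (Bool × Bool)

/-- The program of a number machine: it maps the last response and the control state to a
command, a value to be pushed, and the next control state. -/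
abbrev Program := ℕ → ℕ → Cmd × ℕ × ℕ

/-- A configuration of a number machine: the last response, the control state, the remaining
input, the two work stacks of numbers, and the output stack. -/
structure Conf where
  resp : ℕ
  ctrl : ℕ
  input : List (Option Bool)
  stackA : List ℕ
  stackB : List ℕ
  out : List Bool

/-- The response to a read from the input; `0` signals its end. -/
def symCode : Option (Option Bool) → ℕ
  | none => 0
  | some none => 1
  | some (some false) => 2
  | some (some true) => 3

/-- The pushing half of an instruction. -/
def Conf.push (c : Conf) (x : Cmd × ℕ × ℕ) : Conf where
  resp := c.resp
  ctrl := x.2.2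
  input := c.input
  stackA := if x.1.1.1 then x.2.1 :: c.stackA else c.stackA
  stackB := if !x.1.1.1 && x.1.1.2 then x.2.1 :: c.stackB else c.stackB
  out := if x.1.2.1.1 then x.1.2.1.2 :: c.out else c.out

/-- The reading half of an instruction. Reading from an empty stack gives the response `0`. -/
def Conf.pop (c : Conf) : Bool × Bool → Conf
  | (true, true) => { c with resp := symCode c.input.head?, input := c.input.tail }
  | (true, false) => { c with resp := c.stackA.headD 0, stackA := c.stackA.tail }
  | (false, true) => { c with resp := c.stackB.headD 0, stackB := c.stackB.tail }
  | (false, false) => c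

/-- One step of a number machine. -/
def Conf.next (F : Program) (c : Conf) : Conf :=
  (c.push (F c.resp c.ctrl)).pop (F c.resp c.ctrl).1.2.2

/-- The instruction to be executed is the halting instruction. -/
def Conf.Halting (F : Program) (c : Conf) : Prop :=
  (F c.resp c.ctrl).1.2.2 = (false, false)

/-! ### The stack machine that simulates a number machine -/

open PartrecToTM2 hiding halt
open ToPartrec

/-- The stacks of the simulating machine besides those of the evaluator. -/
inductive Port
  | inp | wA | wB | out
  deriving DecidableEq

instance : Fintype Port := ⟨{.inp, .wA, .wB, .out}, fun k => by cases k <;> simp⟩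

instance : Fintype K' := ⟨{.main, .rev, .aux, .stack}, fun k => by cases k <;> simp⟩

/-- The stack alphabets of the simulating machine. -/
@[reducible] def Sym : K' ⊕ Port → Type
  | .inl _ => Γ'
  | .inr .inp => Option Bool
  | .inr .wA => Γ'
  | .inr .wB => Γ'
  | .inr .out => Bool

/-- The control points of the simulating machine outside the evaluator. -/
inductive Point
  | start | dispatch | push | read | popA | popB | clear
  deriving DecidableEq

instance : Fintype Point :=
  ⟨{.start, .dispatch, .push, .read, .popA, .popB, .clear}, fun k => by cases k <;> simp⟩

/-- The variables of the simulating machine: the variable of the evaluator, the current command,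
and the last symbol read from the input. -/
abbrev Var := Option Γ' × Cmd × Option (Option Bool)

/-- The neutral command. -/
def Cmd.zero : Cmd := ((false, false), (false, false), (false, false))

section Machine

variable (S : Finset Λ')

/-- The labels of the simulating machine; `S` is the set of labels used by the evaluator. -/
abbrev Lab := S ⊕ Point

/-- The label of the simulating machine for a label of the evaluator. Labels outside of `S` do
not matter. -/
def lab (l : Λ') : Lab S := if h : l ∈ S then .inl ⟨l, h⟩ else .inr .start

open TM2.Stmt

/-- A statement of the evaluator as one of the simulating machine: where the evaluator halts,
control passes to `Point.dispatch`. -/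
def embed : TM2.Stmt (fun _ : K' => Γ') Λ' (Option Γ') → TM2.Stmt Sym (Lab S) Var
  | push k f q => push (.inl k) (fun v => f v.1) (embed q)
  | peek k f q => peek (.inl k) (fun v x => (f v.1 x, v.2)) (embed q)
  | pop k f q => pop (.inl k) (fun v x => (f v.1 x, v.2)) (embed q)
  | load f q => load (fun v => (f v.1, v.2)) (embed q)
  | branch f q q' => branch (fun v => f v.1) (embed q) (embed q')
  | goto f => goto fun v => lab S (f v.1)
  | halt => goto fun _ => .inr .dispatch

variable {S}

/-- Pop a flag, which is the number `0` or `1`, from the main stack. -/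
def readFlag (set : Cmd → Bool → Cmd) (q : TM2.Stmt Sym (Lab S) Var) :
    TM2.Stmt Sym (Lab S) Var :=
  pop (.inl .main) (fun v x => (x, v.2)) <|
    branch (fun v => natEnd (v.1.getD default))
      (load (fun v => (none, set v.2.1 false, v.2.2)) q)
      (pop (.inl .main) (fun v _ => (none, set v.2.1 true, v.2.2)) q)

/-- Read all flags of the command, then start the transfer of the value. -/
def dispatchStmt : TM2.Stmt Sym (Lab S) Var :=
  readFlag (fun c b => ((b, c.1.2), c.2)) <| readFlag (fun c b => ((c.1.1, b), c.2)) <|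
  readFlag (fun c b => (c.1, (b, c.2.1.2), c.2.2)) <|
  readFlag (fun c b => (c.1, (c.2.1.1, b), c.2.2)) <|
  readFlag (fun c b => (c.1, c.2.1, (b, c.2.2.2))) <|
  readFlag (fun c b => (c.1, c.2.1, (c.2.2.1, b))) <|
  branch (fun v => v.2.1.2.1.1)
    (push (.inr .out) (fun v => v.2.1.2.1.2) <| branch (fun v => v.2.1.1.1)
      (push (.inr .wA) (fun _ => Γ'.cons) (goto fun _ => .inr .push))
      (branch (fun v => v.2.1.1.2) (push (.inr .wB) (fun _ => Γ'.cons) (goto fun _ => .inr .push))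
        (goto fun _ => .inr .push)))
    (branch (fun v => v.2.1.1.1)
      (push (.inr .wA) (fun _ => Γ'.cons) (goto fun _ => .inr .push))
      (branch (fun v => v.2.1.1.2) (push (.inr .wB) (fun _ => Γ'.cons) (goto fun _ => .inr .push))
        (goto fun _ => .inr .push)))

/-- Move the digits of the value from the main stack to its destination. -/
def pushStmt : TM2.Stmt Sym (Lab S) Var :=
  pop (.inl .main) (fun v x => (x, v.2)) <|
    branch (fun v => natEnd (v.1.getD default)) (goto fun _ => .inr .read) <|
      branch (fun v => v.2.1.1.1)
        (push (.inr .wA) (fun v => v.1.getD default) (goto fun _ => .inr .push))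
        (branch (fun v => v.2.1.1.2)
          (push (.inr .wB) (fun v => v.1.getD default) (goto fun _ => .inr .push))
          (goto fun _ => .inr .push))

/-- Reset the variables and call the evaluator. -/
def callStmt (l₀ : Lab S) : TM2.Stmt Sym (Lab S) Var :=
  load (fun _ => (none, Cmd.zero, none)) (goto fun _ => l₀)

/-- Put the code of the input symbol on the main stack, or start reading from a work stack. -/
def readStmt (l₀ : Lab S) : TM2.Stmt Sym (Lab S) Var :=
  branch (fun v => v.2.1.2.2.1)
    (branch (fun v => v.2.1.2.2.2)
      (pop (.inr .inp) (fun v x => (v.1, v.2.1, x)) <| push (.inl .main) (fun _ => Γ'.cons) <|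
        branch (fun v => v.2.2.isSome)
          (push (.inl .main) (fun _ => Γ'.bit1) <| branch (fun v => v.2.2.join.isSome)
            (push (.inl .main) (fun v => if v.2.2.join.getD false then Γ'.bit1 else Γ'.bit0) <|
              callStmt l₀)
            (callStmt l₀))
          (callStmt l₀))
      (push (.inl .main) (fun _ => Γ'.cons) (goto fun _ => .inr .popA)))
    (branch (fun v => v.2.1.2.2.2)
      (push (.inl .main) (fun _ => Γ'.cons) (goto fun _ => .inr .popB))
      (goto fun _ => .inr .clear))

/-- Move the digits of a number from the first work stack to the main stack. -/
def popAStmt (l₀ : Lab S) : TM2.Stmt Sym (Lab S) Var :=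
  pop (.inr .wA) (fun v x => (x, v.2)) <|
    branch (fun v => natEnd (v.1.getD default)) (callStmt l₀) <|
      push (.inl .main) (fun v => v.1.getD default) (goto fun _ => .inr .popA)

/-- Move the digits of a number from the second work stack to the main stack. -/
def popBStmt (l₀ : Lab S) : TM2.Stmt Sym (Lab S) Var :=
  pop (.inr .wB) (fun v x => (x, v.2)) <|
    branch (fun v => natEnd (v.1.getD default)) (callStmt l₀) <|
      push (.inl .main) (fun v => v.1.getD default) (goto fun _ => .inr .popB)

/-- Empty the main stack and halt. -/
def clearStmt : TM2.Stmt Sym (Lab S) Var :=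
  pop (.inl .main) (fun v x => (x, v.2)) <|
    branch (fun v => v.1.isSome) (goto fun _ => .inr .clear) <|
      load (fun _ => (none, Cmd.zero, none)) halt

/-- The simulating machine for the program evaluated by the evaluator with start label `l₀`. -/
def simStmt (l₀ : Lab S) : Lab S → TM2.Stmt Sym (Lab S) Var
  | .inl l => embed S (tr l.1)
  | .inr .start =>
    push (.inl .main) (fun _ => Γ'.cons) <| push (.inl .main) (fun _ => Γ'.cons) <| callStmt l₀
  | .inr .dispatch => dispatchStmt
  | .inr .push => pushStmt
  | .inr .read => readStmt l₀
  | .inr .popA => popAStmt l₀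
  | .inr .popB => popBStmt l₀
  | .inr .clear => clearStmt

/-- The stacks of the simulating machine. -/
def stackMap (T : K' → List Γ') (i : List (Option Bool)) (a b : List Γ') (o : List Bool) :
    ∀ k, List (Sym k)
  | .inl k => T k
  | .inr .inp => i
  | .inr .wA => a
  | .inr .wB => b
  | .inr .out => o

variable {T : K' → List Γ'} {i : List (Option Bool)} {a b : List Γ'} {o : List Bool}

@[simp] theorem update_stackMap_inl (k : K') (x : List Γ') :
    Function.update (stackMap T i a b o) (.inl k) x =
      stackMap (Function.update T k x) i a b o := by
  funext j
  rcases j with j | j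
  · by_cases h : j = k
    · subst h; simp [stackMap]
    · simp [stackMap, h]
  · cases j <;> simp [stackMap, Function.update]

@[simp] theorem update_stackMap_inp (x : List (Option Bool)) :
    Function.update (stackMap T i a b o) (.inr .inp) x = stackMap T x a b o := by
  funext j; rcases j with j | j | _ | _ | _ <;> simp [stackMap, Function.update]

@[simp] theorem update_stackMap_wA (x : List Γ') :
    Function.update (stackMap T i a b o) (.inr .wA) x = stackMap T i x b o := by
  funext j; rcases j with j | j | _ | _ | _ <;> simp [stackMap, Function.update]

@[simp] theorem update_stackMap_wB (x : List Γ') :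
    Function.update (stackMap T i a b o) (.inr .wB) x = stackMap T i a x o := by
  funext j; rcases j with j | j | _ | _ | _ <;> simp [stackMap, Function.update]

@[simp] theorem update_stackMap_out (x : List Bool) :
    Function.update (stackMap T i a b o) (.inr .out) x = stackMap T i a b x := by
  funext j; rcases j with j | j | _ | _ | _ <;> simp [stackMap, Function.update]

@[simp] theorem stackMap_inl (k : K') : stackMap T i a b o (.inl k) = T k := rfl
@[simp] theorem stackMap_inp : stackMap T i a b o (.inr .inp) = i := rfl
@[simp] theorem stackMap_wA : stackMap T i a b o (.inr .wA) = a := rfl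
@[simp] theorem stackMap_wB : stackMap T i a b o (.inr .wB) = b := rfl
@[simp] theorem stackMap_out : stackMap T i a b o (.inr .out) = o := rfl

/-- The configuration of the simulating machine for one of the evaluator. -/
def embedCfg (c : TM2.Cfg (fun _ : K' => Γ') Λ' (Option Γ')) (w : Cmd × Option (Option Bool))
    (i : List (Option Bool)) (a b : List Γ') (o : List Bool) : TM2.Cfg Sym (Lab S) Var :=
  ⟨some (c.l.elim (.inr .dispatch) (lab S)), (c.var, w), stackMap c.stk i a b o⟩

theorem stepAux_embed (q : TM2.Stmt (fun _ : K' => Γ') Λ' (Option Γ')) (v : Option Γ')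
    (T : K' → List Γ') (w : Cmd × Option (Option Bool)) :
    TM2.stepAux (embed S q) (v, w) (stackMap T i a b o) =
      embedCfg (TM2.stepAux q v T) w i a b o := by
  induction q generalizing v T with
  | push k f q ih => simp [embed, ih]
  | peek k f q ih => simp [embed, ih]
  | pop k f q ih => simp [embed, ih]
  | load f q ih => simp [embed, ih]
  | branch f q q' ih ih' => simp [embed, ih, ih']; cases f v <;> simp
  | goto f => simp [embed, embedCfg]
  | halt => simp [embed, embedCfg]

variable (l₀ : Lab S)

/-- A halting run of the evaluator is also a run of the simulating machine. -/
theorem stepsWithin_embed (hS : ∀ l ∈ S, TM2.SupportsStmt S (tr l)) {n : ℕ}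
    {c c' : TM2.Cfg (fun _ : K' => Γ') Λ' (Option Γ')}
    (hc : ∀ l ∈ c.l, l ∈ S) (h : StepsWithin (TM2.step tr) n c c')
    (w : Cmd × Option (Option Bool)) :
    StepsWithin (TM2.step (simStmt l₀)) n (embedCfg c w i a b o) (embedCfg c' w i a b o) := by
  obtain ⟨m, hm, e⟩ := h
  refine StepsWithin.mono ?_ hm
  clear hm
  induction m generalizing c with
  | zero => cases e; exact .refl _
  | succ m ih =>
    obtain ⟨l, v, T⟩ := c
    rcases l with _ | l
    · exfalso
      rw [Function.iterate_succ_apply] at e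
      have : ∀ m, (flip bind (TM2.step tr))^[m] none = none := by
        intro m
        induction m with
        | zero => rfl
        | succ m ih => rw [Function.iterate_succ_apply]; exact ih
      exact absurd (e.symm.trans (this m)) (by simp)
    · have hl : l ∈ S := hc l rfl
      refine .head (b := embedCfg (TM2.stepAux (tr l) v T) w i a b o) ?_ (ih ?_ e)
      · simp only [embedCfg, Option.elim, lab, hl, dite_true, TM2.step, simStmt]
        exact congrArg some (stepAux_embed (S := S) (tr l) v T w)
      · intro l' hl'
        let _ : Inhabited Λ' := ⟨l⟩
        have := TM2.step_supports (Λ := Λ') (σ := Option Γ') tr (S := S) ⟨hl, hS⟩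
          (c := ⟨some l, v, T⟩) (c' := TM2.stepAux (tr l) v T) rfl
          (Finset.some_mem_insertNone.2 hl)
        rw [Option.mem_def.1 hl'] at this
        exact Finset.some_mem_insertNone.1 this

end Machine

/-! ### Simulation of a step of a number machine -/

/-- Numbers on a work stack: the digits of each are reversed and end with a separator, so that
moving them digit by digit to the main stack restores their order. -/
def cells : List ℕ → List Γ'
  | [] => []
  | n :: l => (trNat n).reverse ++ Γ'.cons :: cells l

/-- The output of the evaluator for an instruction: six flags, the value, and the next state. -/
def instrList (x : Cmd × ℕ × ℕ) : List ℕ :=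
  [x.1.1.1.toNat, x.1.1.2.toNat, x.1.2.1.1.toNat, x.1.2.1.2.toNat, x.1.2.2.1.toNat,
    x.1.2.2.2.toNat, x.2.1, x.2.2]

section Simulation

variable {S : Finset Λ'} (l₀ : Lab S)
variable {i : List (Option Bool)} {a b : List Γ'} {o : List Bool}

/-- The stacks of the evaluator with content `m` on the main stack. -/
abbrev mainStack (m : List Γ') : K' → List Γ' := K'.elim m [] [] []

theorem trNat_one : trNat 1 = [Γ'.bit1] := rfl

theorem stepAux_readFlag (set : Cmd → Bool → Cmd) (q : TM2.Stmt Sym (Lab S) Var)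
    (u : Option Γ') (w : Cmd × Option (Option Bool)) (x : Bool) (l : List ℕ) :
    TM2.stepAux (readFlag set q) (u, w) (stackMap (mainStack (trList (x.toNat :: l))) i a b o) =
      TM2.stepAux q (none, set w.1 x, w.2) (stackMap (mainStack (trList l)) i a b o) := by
  cases x <;> simp [readFlag, trNat_one]

theorem step_dispatch (x : Cmd × ℕ × ℕ) (u : Option Γ') (w : Cmd × Option (Option Bool)) :
    TM2.step (simStmt l₀) ⟨some (.inr .dispatch), (u, w),
        stackMap (mainStack (trList (instrList x))) i a b o⟩ =
      some ⟨some (.inr .push), (none, x.1, w.2), stackMap (mainStack (trList [x.2.1, x.2.2])) i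
        (if x.1.1.1 then Γ'.cons :: a else a)
        (if !x.1.1.1 && x.1.1.2 then Γ'.cons :: b else b)
        (if x.1.2.1.1 then x.1.2.1.2 :: o else o)⟩ := by
  obtain ⟨⟨⟨xA, xB⟩, ⟨xo, xb⟩, ⟨x1, x2⟩⟩, v, q⟩ := x
  simp only [TM2.step, simStmt, dispatchStmt, instrList, stepAux_readFlag]
  cases xo <;> cases xA <;> cases xB <;> simp

theorem stepsWithin_push (x : Cmd) (y : Option (Option Bool)) (r : List Γ') (d : List Γ')
    (hd : ∀ z ∈ d, natEnd z = false) (u : Option Γ') (a b : List Γ') :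
    StepsWithin (TM2.step (simStmt l₀)) (d.length + 1)
      ⟨some (.inr .push), (u, x, y), stackMap (mainStack (d ++ Γ'.cons :: r)) i a b o⟩
      ⟨some (.inr .read), (some Γ'.cons, x, y), stackMap (mainStack r) i
        (if x.1.1 then d.reverse ++ a else a)
        (if !x.1.1 && x.1.2 then d.reverse ++ b else b) o⟩ := by
  induction d generalizing u a b with
  | nil =>
    refine .single ?_
    simp [TM2.step, simStmt, pushStmt]
  | cons z d ih =>
    have hz : natEnd z = false := hd z (by simp)
    have h := StepsWithin.head (f := TM2.step (simStmt l₀))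
      (a := ⟨some (.inr .push), (u, x, y), stackMap (mainStack (z :: d ++ Γ'.cons :: r)) i a b o⟩)
      (by
        rcases x with ⟨⟨_ | _, _ | _⟩, x⟩ <;> cases z <;>
          simp [TM2.step, simStmt, pushStmt] at hz ⊢)
      (ih (fun z hz => hd z (by simp [hz])) (some z) (if x.1.1 then z :: a else a)
        (if !x.1.1 && x.1.2 then z :: b else b))
    have e (p : Bool) (l : List Γ') : (if p then (z :: d).reverse ++ l else l) =
        if p then d.reverse ++ (if p then z :: l else l) else if p then z :: l else l := by
      cases p <;> simp
    rw [e, e]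
    exact h

theorem stepsWithin_popA (x : Cmd) (y : Option (Option Bool)) (r : List Γ') (e a : List Γ')
    (he : ∀ z ∈ e, natEnd z = false) (u : Option Γ') :
    StepsWithin (TM2.step (simStmt l₀)) (e.length + 1)
      ⟨some (.inr .popA), (u, x, y), stackMap (mainStack r) i (e ++ Γ'.cons :: a) b o⟩
      ⟨some l₀, (none, Cmd.zero, none), stackMap (mainStack (e.reverse ++ r)) i a b o⟩ := by
  induction e generalizing u r with
  | nil => exact .single (by simp [TM2.step, simStmt, popAStmt, callStmt])
  | cons z e ih =>
    have hz : natEnd z = false := he z (by simp)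
    have := ih (z :: r) (fun z hz => he z (by simp [hz])) (some z)
    refine .head (b := _) ?_ (by simpa using this)
    cases z <;> simp [TM2.step, simStmt, popAStmt] at hz ⊢

theorem stepsWithin_popB (x : Cmd) (y : Option (Option Bool)) (r : List Γ') (e b : List Γ')
    (he : ∀ z ∈ e, natEnd z = false) (u : Option Γ') :
    StepsWithin (TM2.step (simStmt l₀)) (e.length + 1)
      ⟨some (.inr .popB), (u, x, y), stackMap (mainStack r) i a (e ++ Γ'.cons :: b) o⟩
      ⟨some l₀, (none, Cmd.zero, none), stackMap (mainStack (e.reverse ++ r)) i a b o⟩ := by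
  induction e generalizing u r with
  | nil => exact .single (by simp [TM2.step, simStmt, popBStmt, callStmt])
  | cons z e ih =>
    have hz : natEnd z = false := he z (by simp)
    have := ih (z :: r) (fun z hz => he z (by simp [hz])) (some z)
    refine .head (b := _) ?_ (by simpa using this)
    cases z <;> simp [TM2.step, simStmt, popBStmt] at hz ⊢

theorem stepsWithin_clear (x : Cmd) (y : Option (Option Bool)) (r : List Γ') (u : Option Γ') :
    StepsWithin (TM2.step (simStmt l₀)) (r.length + 1)
      ⟨some (.inr .clear), (u, x, y), stackMap (mainStack r) i a b o⟩
      ⟨none, (none, Cmd.zero, none), stackMap (mainStack []) i a b o⟩ := by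
  induction r generalizing u with
  | nil => exact .single (by simp [TM2.step, simStmt, clearStmt])
  | cons z r ih =>
    refine .head (b := _) ?_ (ih (some z))
    simp [TM2.step, simStmt, clearStmt]

/-- The configuration of the simulating machine for one of the number machine. -/
def encConf (c : Conf) : TM2.Cfg Sym (Lab S) Var :=
  ⟨some l₀, (none, Cmd.zero, none), stackMap (mainStack (trList [c.resp, c.ctrl])) c.input
    (cells c.stackA) (cells c.stackB) c.out⟩

/-- The halting configuration of the simulating machine for one of the number machine. -/
def haltConf (c : Conf) : TM2.Cfg Sym (Lab S) Var :=
  ⟨none, (none, Cmd.zero, none), stackMap (mainStack []) c.input (cells c.stackA)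
    (cells c.stackB) c.out⟩

theorem trNat_symCode (s : Option (Option Bool)) : trNat (symCode s) =
    match s with
    | none => []
    | some none => [Γ'.bit1]
    | some (some false) => [Γ'.bit0, Γ'.bit1]
    | some (some true) => [Γ'.bit1, Γ'.bit1] := by
  rcases s with _ | _ | _ | _ <;> rfl

theorem natEnd_of_mem_reverse_trNat (n : ℕ) : ∀ z ∈ (trNat n).reverse, natEnd z = false :=
  fun z hz => trNat_natEnd n z (List.mem_reverse.1 hz)

/-- The reading half of an instruction that does not halt. -/
theorem stepsWithin_read (c : Conf) (x : Cmd) (hx : x.2.2 ≠ (false, false)) (u : Option Γ') :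
    StepsWithin (TM2.step (simStmt l₀)) ((trNat (c.pop x.2.2).resp).length + 2)
      ⟨some (.inr .read), (u, x, none), stackMap (mainStack (trList [c.ctrl])) c.input
        (cells c.stackA) (cells c.stackB) c.out⟩
      (encConf l₀ (c.pop x.2.2)) := by
  obtain ⟨xp, xo, ⟨_ | _, _ | _⟩⟩ := x
  · exact absurd rfl hx
  · refine .head (b := ⟨some (.inr .popB), (u, (xp, xo, (false, true)), none),
      stackMap (mainStack (trList [0, c.ctrl])) c.input (cells c.stackA) (cells c.stackB) c.out⟩)
      (by simp [TM2.step, simStmt, readStmt]) ?_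
    rcases hb : c.stackB with _ | ⟨n, l⟩
    · refine (StepsWithin.single ?_).mono (by simp)
      simp [TM2.step, simStmt, popBStmt, callStmt, cells, encConf, Conf.pop, hb]
    · have := stepsWithin_popB l₀ (i := c.input) (a := cells c.stackA) (o := c.out)
        (xp, xo, (false, true)) none (trList [0, c.ctrl]) (trNat n).reverse (cells l)
        (natEnd_of_mem_reverse_trNat n) u
      simpa [cells, encConf, Conf.pop, hb] using this
  · refine .head (b := ⟨some (.inr .popA), (u, (xp, xo, (true, false)), none),
      stackMap (mainStack (trList [0, c.ctrl])) c.input (cells c.stackA) (cells c.stackB) c.out⟩)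
      (by simp [TM2.step, simStmt, readStmt]) ?_
    rcases hb : c.stackA with _ | ⟨n, l⟩
    · refine (StepsWithin.single ?_).mono (by simp)
      simp [TM2.step, simStmt, popAStmt, callStmt, cells, encConf, Conf.pop, hb]
    · have := stepsWithin_popA l₀ (i := c.input) (b := cells c.stackB) (o := c.out)
        (xp, xo, (true, false)) none (trList [0, c.ctrl]) (trNat n).reverse (cells l)
        (natEnd_of_mem_reverse_trNat n) u
      simpa [cells, encConf, Conf.pop, hb] using this
  · refine (StepsWithin.single ?_).mono (by simp)
    rcases hi : c.input with _ | ⟨s, l⟩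
    · simp [TM2.step, simStmt, readStmt, callStmt, encConf, Conf.pop, hi, trNat_symCode]
    · rcases s with _ | _ | _ <;>
      simp [TM2.step, simStmt, readStmt, callStmt, encConf, Conf.pop, hi, trNat_symCode]

/-- The evaluator computes the instruction for response `r` and control state `q` in at most `t`
steps. -/
def CallWithin (c : Code) (F : Program) (t r q : ℕ) : Prop :=
  StepsWithin (TM2.step tr) t (PartrecToTM2.init c [r, q]) (PartrecToTM2.halt (instrList (F r q)))

variable {c : Code} {F : Program} {t : ℕ} (cf : Conf)

/-- The label of the simulating machine where the evaluation of the code `c` begins. -/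
abbrev entry (c : Code) : Lab (codeSupp c Cont'.halt) :=
  lab (codeSupp c Cont'.halt) (trNormal c Cont'.halt)

theorem stepsWithin_call (h : CallWithin c F t cf.resp cf.ctrl) :
    StepsWithin (TM2.step (simStmt (entry c)))
      (t + (trNat (F cf.resp cf.ctrl).2.1).length + 2) (encConf (entry c) cf)
      ⟨some (.inr .read), (some Γ'.cons, (F cf.resp cf.ctrl).1, none),
        stackMap (mainStack (trList [(F cf.resp cf.ctrl).2.2]))
          cf.input (cells (cf.push (F cf.resp cf.ctrl)).stackA)
          (cells (cf.push (F cf.resp cf.ctrl)).stackB) (cf.push (F cf.resp cf.ctrl)).out⟩ := by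
  have hS : @TM2.Supports _ _ _ _ ⟨trNormal c Cont'.halt⟩ tr (codeSupp c Cont'.halt) :=
    tr_supports c Cont'.halt
  have h1 := stepsWithin_embed (i := cf.input) (a := cells cf.stackA) (b := cells cf.stackB)
    (o := cf.out) (entry c) hS.2 (c := PartrecToTM2.init c [cf.resp, cf.ctrl])
    (by rintro l ⟨⟩; exact hS.1) h (Cmd.zero, none)
  set x := F cf.resp cf.ctrl
  have h2 := StepsWithin.single (step_dispatch (i := cf.input) (a := cells cf.stackA)
    (b := cells cf.stackB) (o := cf.out) (entry c) x none (Cmd.zero, none))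
  have h3 := stepsWithin_push (i := cf.input) (o := if x.1.2.1.1 then x.1.2.1.2 :: cf.out
    else cf.out) (entry c) x.1 none (trList [x.2.2]) (trNat x.2.1) (trNat_natEnd _) none
    (if x.1.1.1 then Γ'.cons :: cells cf.stackA else cells cf.stackA)
    (if !x.1.1.1 && x.1.1.2 then Γ'.cons :: cells cf.stackB else cells cf.stackB)
  have h4 := (h1.trans (h2.trans h3)).mono
    (show _ ≤ t + (trNat x.2.1).length + 2 by omega)
  have e (p : Bool) (l : List ℕ) : cells (if p then x.2.1 :: l else l) =
      if p then (trNat x.2.1).reverse ++ (if p then Γ'.cons :: cells l else cells l)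
      else if p then Γ'.cons :: cells l else cells l := by
    cases p <;> simp [cells]
  simp only [Conf.push]
  rw [e, e]
  exact h4

/-- A step of a number machine takes the time for computing the instruction, plus the time for
moving the pushed and the popped number. -/
theorem stepsWithin_next (h : CallWithin c F t cf.resp cf.ctrl) (hh : ¬ cf.Halting F) :
    StepsWithin (TM2.step (simStmt (entry c)))
      (t + (trNat (F cf.resp cf.ctrl).2.1).length + (trNat (cf.next F).resp).length + 4)
      (encConf (entry c) cf) (encConf (entry c) (cf.next F)) := by
  refine ((stepsWithin_call cf h).trans
    (stepsWithin_read (entry c) (cf.push (F cf.resp cf.ctrl)) _ hh (some Γ'.cons))).mono ?_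
  simp only [Conf.next]
  omega

theorem stepsWithin_halting (h : CallWithin c F t cf.resp cf.ctrl) (hh : cf.Halting F) :
    StepsWithin (TM2.step (simStmt (entry c)))
      (t + (trNat (F cf.resp cf.ctrl).2.1).length + (trNat (F cf.resp cf.ctrl).2.2).length + 5)
      (encConf (entry c) cf) (haltConf (cf.push (F cf.resp cf.ctrl))) := by
  refine ((stepsWithin_call cf h).trans (.head ?_
    (stepsWithin_clear (entry c) (F cf.resp cf.ctrl).1 none (trList [(F cf.resp cf.ctrl).2.2])
      (some Γ'.cons)))).mono ?_
  · rw [Conf.Halting] at hh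
    simp only [TM2.step, simStmt, readStmt, TM2.stepAux, hh]
    simp [Conf.push]
  · simp
    omega

end Simulation

/-! ### Computability of the time bounds -/

/-- The total version of a transition system, which stays in a final state for ever. -/
def stepD {α : Type*} (f : α → Option α) (a : α) : α := (f a).getD a

theorem iterate_stepD_of_none {α : Type*} {f : α → Option α} {b : α} (hb : f b = none) (n : ℕ) :
    (stepD f)^[n] b = b := by
  induction n with
  | zero => rfl
  | succ n ih => rw [Function.iterate_succ_apply, stepD, hb]; exact ih

theorem iterate_bind_none {α : Type*} (f : α → Option α) (n : ℕ) :
    (flip bind f)^[n] none = none := by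
  induction n with
  | zero => rfl
  | succ n ih => rw [Function.iterate_succ_apply]; exact ih

theorem StepsWithin.iterate_stepD {α : Type*} {f : α → Option α} {n t : ℕ} {a b : α}
    (h : StepsWithin f n a b) (hb : f b = none) (ht : n ≤ t) : (stepD f)^[t] a = b := by
  obtain ⟨m, hm, e⟩ := h
  obtain ⟨k, rfl⟩ := Nat.exists_eq_add_of_le (hm.trans ht)
  clear hm ht
  induction m generalizing a with
  | zero => cases e; exact iterate_stepD_of_none hb _
  | succ m ih =>
    rw [Function.iterate_succ_apply] at e
    rw [show m + 1 + k = (m + k) + 1 by omega, Function.iterate_succ_apply]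
    rcases ha : f a with _ | a'
    · rw [show flip bind f (some a) = f a from rfl, ha, iterate_bind_none] at e
      cases e
    · rw [show flip bind f (some a) = f a from rfl, ha] at e
      rw [stepD, ha]
      exact ih e

theorem stepsWithin_iterate_stepD {α : Type*} (f : α → Option α) (t : ℕ) (a : α) :
    StepsWithin f t a ((stepD f)^[t] a) := by
  induction t generalizing a with
  | zero => exact .refl a
  | succ t ih =>
    rw [Function.iterate_succ_apply]
    rcases ha : f a with _ | a'
    · rw [stepD, ha]
      exact (ih a).mono (by omega)
    · refine .head ha ?_
      rw [stepD, ha]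
      exact ih a'

theorem primrec₂_of_finite {α β σ : Type} [Finite α] [Primcodable α] [Primcodable β]
    [Primcodable σ] {f : α → β → σ} (h : ∀ a, Primrec (f a)) : Primrec₂ f := by
  obtain ⟨n, ⟨e⟩⟩ := Finite.exists_equiv_fin α
  have h1 : Primrec₂ fun (i : Fin n) b => f (e.symm i) b :=
    Primrec.fin_curry₁.2 fun i => h (e.symm i)
  exact (h1.comp ((Primrec.dom_finite e).comp Primrec.fst) Primrec.snd).of_eq fun x => by simp

noncomputable instance : Primcodable Γ' :=
  Primcodable.ofEquiv (Fin (Fintype.card Γ')) (Fintype.truncEquivFin Γ').out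

/-- A finite set of labels of the evaluator is primitive codable. -/
noncomputable abbrev labelPrimcodable (S : Finset Λ') : Primcodable S :=
  Primcodable.ofEquiv (Fin S.card) S.equivFin

/-- Contents of the four stacks of the evaluator. -/
abbrev Quad := List Γ' × List Γ' × List Γ' × List Γ'

/-- The stacks of the evaluator as a function. -/
abbrev Quad.toFun (x : Quad) : K' → List Γ' := K'.elim x.1 x.2.1 x.2.2.1 x.2.2.2

/-- Configurations of the evaluator with labels in `S`, as elements of a primitive codable type. -/
abbrev CodedCfg (S : Finset Λ') := Option S × Option Γ' × Quad

/-- The configuration that corresponds to a coded configuration. -/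
def CodedCfg.toCfg {S : Finset Λ'} (x : CodedCfg S) :
    TM2.Cfg (fun _ : K' => Γ') Λ' (Option Γ') :=
  ⟨x.1.map Subtype.val, x.2.1, x.2.2.toFun⟩

section

variable {S : Finset Λ'}

theorem exists_update_quad (k : K') : ∃ g : Quad → List Γ' → Quad, Primrec₂ g ∧
    ∀ x l, (g x l).toFun = Function.update x.toFun k l := by
  have h1 : Primrec fun p : Quad × List Γ' => p.1.1 := Primrec.fst.comp Primrec.fst
  have h2 : Primrec fun p : Quad × List Γ' => p.1.2.1 :=
    Primrec.fst.comp (Primrec.snd.comp Primrec.fst)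
  have h3 : Primrec fun p : Quad × List Γ' => p.1.2.2.1 :=
    Primrec.fst.comp (Primrec.snd.comp (Primrec.snd.comp Primrec.fst))
  have h4 : Primrec fun p : Quad × List Γ' => p.1.2.2.2 :=
    Primrec.snd.comp (Primrec.snd.comp (Primrec.snd.comp Primrec.fst))
  have h5 : Primrec fun p : Quad × List Γ' => p.2 := Primrec.snd
  cases k
  · exact ⟨fun x l => (l, x.2), Primrec.pair h5 (.pair h2 (.pair h3 h4)), by simp⟩
  · exact ⟨fun x l => (x.1, l, x.2.2), Primrec.pair h1 (.pair h5 (.pair h3 h4)), by simp⟩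
  · exact ⟨fun x l => (x.1, x.2.1, l, x.2.2.2), Primrec.pair h1 (.pair h2 (.pair h5 h4)),
      by simp⟩
  · exact ⟨fun x l => (x.1, x.2.1, x.2.2.1, l), Primrec.pair h1 (.pair h2 (.pair h3 h5)),
      by simp⟩

theorem primrec_quad_apply (k : K') : Primrec fun x : Quad => x.toFun k := by
  cases k
  · exact Primrec.fst
  · exact Primrec.fst.comp Primrec.snd
  · exact Primrec.fst.comp (Primrec.snd.comp Primrec.snd)
  · exact Primrec.snd.comp (Primrec.snd.comp Primrec.snd)

attribute [local instance] labelPrimcodable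

/-- The execution of a statement of the evaluator is primitive recursive. -/
theorem exists_primrec_stepAux (q : TM2.Stmt (fun _ : K' => Γ') Λ' (Option Γ'))
    (hq : TM2.SupportsStmt S q) : ∃ g : Option Γ' × Quad → CodedCfg S, Primrec g ∧
      ∀ x, (g x).toCfg = TM2.stepAux q x.1 x.2.toFun := by
  induction q with
  | push k f q ih =>
    obtain ⟨g, hg, e⟩ := ih hq
    obtain ⟨u, hu, e'⟩ := exists_update_quad k
    refine ⟨fun x => g (x.1, u x.2 (f x.1 :: x.2.toFun k)), hg.comp (.pair .fst (hu.comp .snd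
      (Primrec.list_cons.comp ((Primrec.dom_finite f).comp .fst)
        ((primrec_quad_apply k).comp .snd)))), fun x => ?_⟩
    rw [e, e']; rfl
  | peek k f q ih =>
    obtain ⟨g, hg, e⟩ := ih hq
    refine ⟨fun x => g (f x.1 (x.2.toFun k).head?, x.2), hg.comp (.pair
      (Primrec₂.comp (f := f) (primrec₂_of_finite fun a => Primrec.dom_finite (f a)) .fst
        (Primrec.list_head?.comp ((primrec_quad_apply k).comp .snd))) .snd), fun x => ?_⟩
    rw [e]; rfl
  | pop k f q ih =>
    obtain ⟨g, hg, e⟩ := ih hq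
    obtain ⟨u, hu, e'⟩ := exists_update_quad k
    refine ⟨fun x => g (f x.1 (x.2.toFun k).head?, u x.2 (x.2.toFun k).tail), hg.comp (.pair
      (Primrec₂.comp (f := f) (primrec₂_of_finite fun a => Primrec.dom_finite (f a)) .fst
        (Primrec.list_head?.comp ((primrec_quad_apply k).comp .snd)))
      (hu.comp .snd (Primrec.list_tail.comp ((primrec_quad_apply k).comp .snd)))), fun x => ?_⟩
    rw [e, e']; rfl
  | load f q ih =>
    obtain ⟨g, hg, e⟩ := ih hq
    refine ⟨fun x => g (f x.1, x.2), hg.comp (.pair ((Primrec.dom_finite f).comp .fst) .snd),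
      fun x => ?_⟩
    rw [e]; rfl
  | branch f q q' ih ih' =>
    obtain ⟨g, hg, e⟩ := ih hq.1
    obtain ⟨g', hg', e'⟩ := ih' hq.2
    refine ⟨fun x => cond (f x.1) (g x) (g' x),
      Primrec.cond ((Primrec.dom_finite f).comp .fst) hg hg', fun x => ?_⟩
    simp only [TM2.stepAux]
    cases f x.1
    · exact e' x
    · exact e x
  | goto f =>
    refine ⟨fun x => (some ⟨f x.1, hq x.1⟩, x.1, x.2), .pair
      ((Primrec.dom_finite fun v => some (⟨f v, hq v⟩ : S)).comp .fst) .id, fun x => rfl⟩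
  | halt => exact ⟨fun x => (none, x.1, x.2), .pair (.const _) .id, fun x => rfl⟩

/-- The step function of the evaluator is primitive recursive. -/
theorem exists_primrec_step (hS : ∀ l ∈ S, TM2.SupportsStmt S (tr l)) :
    ∃ g : CodedCfg S → CodedCfg S, Primrec g ∧
      ∀ x, (g x).toCfg = stepD (TM2.step tr) x.toCfg := by
  choose g hg e using fun l : S => exists_primrec_stepAux (S := S) (tr l) (hS l l.2)
  refine ⟨fun x => x.1.casesOn x fun l => g l x.2,
    Primrec.option_casesOn (f := fun x : CodedCfg S => x) (g := fun x l => g l x.2) .fst .id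
      ((primrec₂_of_finite hg).comp .snd (Primrec.snd.comp .fst)).to₂, fun x => ?_⟩
  obtain ⟨_ | l, v, T⟩ := x
  · rfl
  · exact e l (v, T)

theorem trNat_of_pos {n : ℕ} (hn : n ≠ 0) :
    trNat n = (if n % 2 = 1 then Γ'.bit1 else Γ'.bit0) :: trNat (n / 2) := by
  unfold trNat
  rcases hp : (n : Num) with _ | p
  · have := congrArg (fun x : Num => (x : ℕ)) hp
    simp only [Num.to_of_nat] at this
    exact absurd this hn
  · have hnp : n = (p : ℕ) := by
      have := congrArg (fun x : Num => (x : ℕ)) hp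
      rwa [Num.to_of_nat] at this
    have key (p : PosNum) : (((p : ℕ) : ℕ) : Num) = Num.pos p := by
      exact Num.of_to_nat (Num.pos p)
    subst hnp
    cases p with
    | one => rfl
    | bit0 p =>
      have h1 : ((PosNum.bit0 p : PosNum) : ℕ) = 2 * (p : ℕ) := by
        rw [PosNum.cast_bit0]; ring
      rw [h1, Nat.mul_div_cancel_left _ (by norm_num), key]
      simp [trNum, trPosNum]
    | bit1 p =>
      have h1 : ((PosNum.bit1 p : PosNum) : ℕ) = 2 * (p : ℕ) + 1 := by
        rw [PosNum.cast_bit1]; ring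
      rw [h1, show (2 * (p : ℕ) + 1) / 2 = (p : ℕ) by omega, key]
      simp [trNum, trPosNum, Nat.add_mod]

theorem primrec_trNat : Primrec trNat := by
  refine Primrec.nat_omega_rec' trNat (m := id) (l := fun n => if n = 0 then [] else [n / 2])
    (g := fun n r => some (if n = 0 then [] else
      (if n % 2 = 1 then Γ'.bit1 else Γ'.bit0) :: r.headI)) .id ?_ ?_ ?_ ?_
  · exact Primrec.ite (Primrec.eq.comp .id (.const 0)) (.const [])
      (Primrec.list_cons.comp (Primrec.nat_div.comp .id (.const 2)) (.const []))
  · refine Primrec.option_some.comp (Primrec.ite (Primrec.eq.comp .fst (.const 0)) (.const [])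
      (Primrec.list_cons.comp (Primrec.ite (Primrec.eq.comp (Primrec.nat_mod.comp .fst (.const 2))
        (.const 1)) (.const _) (.const _)) (Primrec.list_headI.comp .snd)))
  · intro n n' h
    split_ifs at h with h0
    · simp at h
    · simp only [List.mem_singleton] at h
      subst h
      exact Nat.div_lt_self (Nat.pos_of_ne_zero h0) (by norm_num)
  · intro n
    by_cases h0 : n = 0
    · simp [h0]
    · simp [h0, trNat_of_pos h0]

end

attribute [local instance] labelPrimcodable in
/-- Whether the evaluator computes an instruction within a given time is a primitive recursive
predicate, since a run of given length can be simulated. -/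
theorem exists_primrecPred_callWithin {c : Code} {F : Program}
    (hc : ∀ r q, c.eval [r, q] = pure (instrList (F r q))) :
    ∃ p : ℕ × ℕ × ℕ → Bool, Primrec p ∧ ∀ t r q, p (t, r, q) = true ↔ CallWithin c F t r q := by
  have hS : @TM2.Supports _ _ _ _ ⟨trNormal c Cont'.halt⟩ tr (codeSupp c Cont'.halt) :=
    tr_supports c Cont'.halt
  obtain ⟨g, hg, e⟩ := exists_primrec_step hS.2
  let i (r q : ℕ) : CodedCfg (codeSupp c Cont'.halt) :=
    (some ⟨trNormal c Cont'.halt, hS.1⟩, none, trList [r, q], [], [], [])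
  have hi : Primrec₂ i := by
    refine Primrec.pair (.const _) (.pair (.const _) (.pair ?_ (.const _)))
    refine Primrec.list_append.comp (primrec_trNat.comp .fst) (Primrec.list_cons.comp (.const _)
      (Primrec.list_append.comp (primrec_trNat.comp .snd) (Primrec.list_cons.comp (.const _)
        (.const _))))
  have e' (t r q : ℕ) : (g^[t] (i r q)).toCfg =
      (stepD (TM2.step tr))^[t] (PartrecToTM2.init c [r, q]) := by
    induction t with
    | zero => rfl
    | succ t ih => 
      rw [Function.iterate_succ_apply', e, ih]
      exact (Function.iterate_succ_apply' (stepD (TM2.step tr)) t _).symm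
  refine ⟨fun x => (g^[x.1] (i x.2.1 x.2.2)).1.isNone, ?_, fun t r q => ?_⟩
  · have h1 : Primrec fun x : ℕ × ℕ × ℕ => g^[x.1] (i x.2.1 x.2.2) :=
      Primrec.nat_iterate .fst (hi.comp (Primrec.fst.comp .snd) (Primrec.snd.comp .snd))
        (hg.comp .snd)
    have h2 : Primrec fun x : ℕ × ℕ × ℕ => (g^[x.1] (i x.2.1 x.2.2)).1 := Primrec.fst.comp h1
    exact (Primrec.not.comp (Primrec.option_isSome.comp h2)).of_eq fun x => by simp
  · have hend : ∃ n, CallWithin c F n r q := by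
      refine exists_stepsWithin_of_reaches (StateTransition.mem_eval.1 ?_).1
      have := tr_eval c [r, q]
      rw [hc] at this
      rw [this]
      exact Part.mem_map _ (Part.mem_some _)
    obtain ⟨n, hn⟩ := hend
    have hnone : TM2.step tr (PartrecToTM2.halt (instrList (F r q))) = none := rfl
    have key : (g^[t] (i r q)).1 = none ↔
        TM2.step tr ((stepD (TM2.step tr))^[t] (PartrecToTM2.init c [r, q])) = none := by
      rw [← e']
      obtain ⟨_ | l, v, T⟩ := g^[t] (i r q)
      · exact ⟨fun _ => rfl, fun _ => rfl⟩
      · exact ⟨fun h => by simp at h, fun h => by cases h⟩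
    simp only [Option.isNone_iff_eq_none, key]
    constructor
    · intro h
      have h1 := stepsWithin_iterate_stepD (TM2.step tr) t (PartrecToTM2.init c [r, q])
      have h2 := h1.iterate_stepD h (le_max_left t n)
      rw [hn.iterate_stepD hnone (le_max_right t n)] at h2
      rw [← h2] at h1
      exact h1
    · intro h
      rw [StepsWithin.iterate_stepD h hnone le_rfl]
      exact hnone

theorem exists_code_list (gs : List (ℕ → ℕ → ℕ)) (h : ∀ g ∈ gs, Primrec₂ g) :
    ∃ c : Code, ∀ r q, c.eval [r, q] = pure (gs.map fun g => g r q) := by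
  induction gs with
  | nil => exact ⟨Code.nil, fun r q => by simp⟩
  | cons g gs ih =>
    obtain ⟨d, hd⟩ := ih fun g hg => h g (by simp [hg])
    have hg : Primrec fun v : List.Vector ℕ 2 => g v.head v.tail.head :=
      (h g (by simp)).comp Primrec.vector_head (Primrec.vector_head.comp Primrec.vector_tail)
    obtain ⟨c, hc⟩ := Code.exists_code (Nat.Partrec'.prim (Nat.Primrec'.of_prim hg))
    refine ⟨Code.cons c d, fun r q => ?_⟩
    have := hc ⟨[r, q], rfl⟩
    have h1 : c.eval [r, q] = pure [g r q] := by
      rw [show c.eval [r, q] = _ from this]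
      exact Part.map_some _ _
    simp [Code.eval, hd, h1]

/-- Every primitive recursive program has a code for the evaluator. -/
theorem exists_code_of_primrec {F : Program} (hF : Primrec₂ F) :
    ∃ c : Code, ∀ r q, c.eval [r, q] = pure (instrList (F r q)) := by
  have hb (f : Cmd → Bool) : Primrec₂ fun r q => (f (F r q).1).toNat :=
    (Primrec.dom_finite fun x : Cmd => (f x).toNat).comp (Primrec.fst.comp hF)
  exact exists_code_list [fun r q => (F r q).1.1.1.toNat, fun r q => (F r q).1.1.2.toNat,
    fun r q => (F r q).1.2.1.1.toNat, fun r q => (F r q).1.2.1.2.toNat,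
    fun r q => (F r q).1.2.2.1.toNat, fun r q => (F r q).1.2.2.2.toNat,
    fun r q => (F r q).2.1, fun r q => (F r q).2.2] (by
      simp only [List.forall_mem_cons, List.not_mem_nil, false_imp_iff, implies_true, and_true]
      exact ⟨hb fun x => x.1.1, hb fun x => x.1.2, hb fun x => x.2.1.1, hb fun x => x.2.1.2,
        hb fun x => x.2.2.1, hb fun x => x.2.2.2, Primrec.fst.comp (Primrec.snd.comp hF),
        Primrec.snd.comp (Primrec.snd.comp hF)⟩)

/-! ### Number machines are simulated by Turing machines -/

/-- `Run F P n c c'`: the number machine with program `F` leads from `c` to `c'` in `n` steps, where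
none of the executed instructions halts and all of them are computed from a response and a control
state that satisfy `P`. -/
inductive Run (F : Program) (P : ℕ → ℕ → Prop) : ℕ → Conf → Conf → Prop
  | refl (c : Conf) : Run F P 0 c c
  | head {n : ℕ} {c c' : Conf} : P c.resp c.ctrl → ¬ c.Halting F → Run F P n (c.next F) c' →
      Run F P (n + 1) c c'

theorem Run.trans {F : Program} {P : ℕ → ℕ → Prop} {n n' : ℕ} {c c' c'' : Conf}
    (h : Run F P n c c') (h' : Run F P n' c' c'') : Run F P (n + n') c c'' := by
  induction h with
  | refl c => simpa using h'
  | @head n c c' hP hh _ ih =>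
    rw [show n + 1 + n' = (n + n') + 1 by omega]
    exact .head hP hh (ih h')

theorem length_trNat_le (n : ℕ) : (trNat n).length ≤ n := by
  induction n using Nat.strong_induction_on with
  | _ n ih =>
    by_cases hn : n = 0
    · simp [hn]
    · rw [trNat_of_pos hn, List.length_cons]
      have := ih (n / 2) (Nat.div_lt_self (Nat.pos_of_ne_zero hn) (by norm_num))
      omega

/-- The number of steps of the simulating machine on a run of a number machine. -/
theorem Run.stepsWithin {F : Program} {P : ℕ → ℕ → Prop} {c : Code} {t K n : ℕ}
    {cf cf' : Conf}
    (hP : ∀ r q, P r q → CallWithin c F t r q ∧ r ≤ K ∧ (F r q).2.1 ≤ K)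
    (h : Run F P n cf cf') (h' : P cf'.resp cf'.ctrl) :
    StepsWithin (TM2.step (simStmt (entry c))) (n * (t + 2 * K + 4)) (encConf (entry c) cf)
      (encConf (entry c) cf') := by
  induction h with
  | refl c => exact (StepsWithin.refl _).mono (by simp)
  | @head n cf cf' h1 hh hr ih =>
    have h2 : (cf.next F).resp ≤ K := by
      cases hr with
      | refl => exact (hP _ _ h').2.1
      | head h3 _ _ => exact (hP _ _ h3).2.1
    refine ((stepsWithin_next cf (hP _ _ h1).1 hh).trans (ih h')).mono ?_
    have h3 := (length_trNat_le (F cf.resp cf.ctrl).2.1).trans (hP _ _ h1).2.2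
    have h4 := (length_trNat_le (cf.next F).resp).trans h2
    rw [Nat.add_mul n 1]
    omega

/-- The Turing machine that simulates the number machine whose program is evaluated by `c`. -/
def simMachine (c : Code) : FinTM2 where
  K := K' ⊕ Port
  k₀ := .inr .inp
  k₁ := .inr .out
  Γ := Sym
  Λ := Lab (codeSupp c Cont'.halt)
  main := .inr .start
  σ := Var
  initialState := (none, Cmd.zero, none)
  Γk₀Fin := inferInstanceAs (Fintype (Option Bool))
  m := simStmt (entry c)

/-- The simulating machine with its alphabets. -/
def simComputer (c : Code) : TM2ComputableAux (Option Bool) Bool where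
  tm := simMachine c
  inputAlphabet := Equiv.refl _
  outputAlphabet := Equiv.refl _

theorem finite_sym (κ : K' ⊕ Port) : Finite (Sym κ) := by
  rcases κ with _ | _ | _ | _ | _ <;> dsimp only [Sym] <;> infer_instance

theorem outputsWithin_of_run {F : Program} {P : ℕ → ℕ → Prop} {c : Code} {t K n : ℕ}
    (hP : ∀ r q, P r q → CallWithin c F t r q ∧ r ≤ K ∧ (F r q).2.1 ≤ K ∧ (F r q).2.2 ≤ K)
    {x : List (Option Bool)} {y : List Bool} {cf : Conf}
    (h : Run F P n ⟨0, 0, x, [], [], []⟩ cf) (h' : P cf.resp cf.ctrl) (hh : cf.Halting F)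
    (hi : cf.input = []) (hA : (cf.push (F cf.resp cf.ctrl)).stackA = [])
    (hB : (cf.push (F cf.resp cf.ctrl)).stackB = [])
    (ho : (cf.push (F cf.resp cf.ctrl)).out = y) :
    OutputsWithin (simComputer c) x y ((n + 2) * (t + 2 * K + 4)) := by
  have h0 : TM2.step (simStmt (entry c))
      ⟨some (.inr .start), (none, Cmd.zero, none), stackMap (mainStack []) x [] [] []⟩ =
      some (encConf (entry c) ⟨0, 0, x, [], [], []⟩) := by
    simp [TM2.step, simStmt, callStmt, encConf, cells]
  have h1 := Run.stepsWithin (fun r q hrq => ⟨(hP r q hrq).1, (hP r q hrq).2.1,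
    (hP r q hrq).2.2.1⟩) h h'
  have h2 := stepsWithin_halting cf (hP _ _ h').1 hh
  have h3 : StepsWithin (TM2.step (simStmt (entry c))) ((n + 2) * (t + 2 * K + 4))
      ⟨some (.inr .start), (none, Cmd.zero, none), stackMap (mainStack []) x [] [] []⟩
      (haltConf (cf.push (F cf.resp cf.ctrl))) := by
    refine (StepsWithin.head h0 (h1.trans h2)).mono ?_
    have h3 := (length_trNat_le (F cf.resp cf.ctrl).2.1).trans (hP _ _ h').2.2.1
    have h4 := (length_trNat_le (F cf.resp cf.ctrl).2.2).trans (hP _ _ h').2.2.2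
    rw [Nat.add_mul]
    omega
  obtain ⟨m, hm, e⟩ := h3
  refine ⟨⟨⟨m, ?_⟩, hm⟩⟩
  have e1 : initList (simMachine c) x =
      ⟨some (.inr .start), (none, Cmd.zero, none), stackMap (mainStack []) x [] [] []⟩ := by
    unfold initList
    congr 1
    funext k
    rcases k with k | _ | _ | _ | _
    · cases k <;> rfl
    all_goals rfl
  have e2 : haltList (simMachine c) y = haltConf (cf.push (F cf.resp cf.ctrl)) := by
    unfold haltList haltConf
    congr 1
    rw [hA, hB, ho, show (cf.push (F cf.resp cf.ctrl)).input = [] from hi]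
    funext k
    rcases k with k | _ | _ | _ | _
    · cases k <;> rfl
    all_goals rfl
  simp only [simComputer, Option.map_some]
  have mapx : x.map (Equiv.refl (Option Bool)).symm = x := by simp
  have mapy : y.map (Equiv.refl Bool).symm = y := by simp
  erw [mapx, mapy, e1, e2]
  exact e

end NumberMachine

open Encodable Denumerable

/-! ### Primitive recursive list functions -/

section Primrec

variable {α β γ σ : Type} [Primcodable α] [Primcodable β] [Primcodable γ] [Primcodable σ]

theorem primrec_filter {f : α → List β} {p : α → β → Bool} (hf : Primrec f) (hp : Primrec₂ p) :
    Primrec fun a => (f a).filter (p a) := by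
  have h : Primrec fun a => (f a).filterMap fun b => bif p a b then some b else none :=
    Primrec.listFilterMap hf
      (Primrec.cond hp (Primrec.option_some.comp .snd) (.const none) : Primrec _).to₂
  refine h.of_eq fun a => ?_
  induction f a with
  | nil => rfl
  | cons b l ih => cases hb : p a b <;> simp [hb, ih]

theorem primrec_any {f : α → List β} {p : α → β → Bool} (hf : Primrec f) (hp : Primrec₂ p) :
    Primrec fun a => (f a).any (p a) := by
  have h : Primrec fun a => decide (((f a).filter (p a)).length ≠ 0) :=
    PrimrecPred.decide (PrimrecPred.not
      (Primrec.eq.comp (Primrec.list_length.comp (primrec_filter hf hp)) (.const 0)))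
  refine h.of_eq fun a => ?_
  rw [Bool.eq_iff_iff]
  simp

theorem primrec_all {f : α → List β} {p : α → β → Bool} (hf : Primrec f) (hp : Primrec₂ p) :
    Primrec fun a => (f a).all (p a) :=
  (Primrec.not.comp (primrec_any hf (p := fun a b => !p a b) (Primrec.not.comp hp))).of_eq
    fun a => by simp [List.any_eq_not_all_not]

theorem primrec_mem [DecidableEq β] {f : α → β} {g : α → List β} (hf : Primrec f)
    (hg : Primrec g) : Primrec fun a => decide (f a ∈ g a) :=
  (primrec_any hg (p := fun a b => decide (f a = b))
    (PrimrecPred.decide (Primrec.eq.comp (hf.comp .fst) .snd) : Primrec _).to₂).of_eq fun a => by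
      rw [Bool.eq_iff_iff]
      simp

theorem primrec_zip {f : α → List β} {g : α → List γ} (hf : Primrec f) (hg : Primrec g) :
    Primrec fun a => (f a).zip (g a) := by
  have h : Primrec fun a => (List.range (f a).length).filterMap fun i =>
      (f a)[i]?.bind fun b => (g a)[i]?.map fun c => (b, c) := by
    refine Primrec.listFilterMap (Primrec.list_range.comp (Primrec.list_length.comp hf)) ?_
    refine Primrec.option_bind (Primrec.list_getElem?.comp (hf.comp .fst) .snd) ?_
    refine Primrec.option_map
      (Primrec.list_getElem?.comp (hg.comp (Primrec.fst.comp .fst)) (Primrec.snd.comp .fst)) ?_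
    exact (Primrec.pair (Primrec.snd.comp .fst) .snd).to₂
  refine h.of_eq fun a => ?_
  generalize f a = l
  generalize g a = l'
  induction l generalizing l' with
  | nil => rfl
  | cons b l ih =>
    rcases l' with _ | ⟨c, l'⟩
    · simp
    · rw [List.zip_cons_cons, ← ih l', List.length_cons, List.range_succ_eq_map]
      simp [List.filterMap_map]

theorem primrec_sum {f : α → List ℕ} (hf : Primrec f) : Primrec fun a => (f a).sum :=
  (Primrec.list_foldr (h := fun _ (x : ℕ × ℕ) => x.1 + x.2) hf (.const 0)
    (Primrec.nat_add.comp (Primrec.fst.comp .snd) (Primrec.snd.comp .snd)).to₂).of_eq fun a => by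
      rw [List.sum_eq_foldr]

theorem primrec_pow {f g : α → ℕ} (hf : Primrec f) (hg : Primrec g) :
    Primrec fun a => f a ^ g a :=
  (Primrec₂.unpaired'.1 Nat.Primrec.pow).comp hf hg

theorem primrec_getD {f : α → List β} {g : α → ℕ} (d : β) (hf : Primrec f) (hg : Primrec g) :
    Primrec fun a => (f a).getD (g a) d :=
  (Primrec.list_getD d).comp hf hg

theorem primrec_ite_eq {f g : α → ℕ} {h k : α → σ} (hf : Primrec f) (hg : Primrec g)
    (hh : Primrec h) (hk : Primrec k) : Primrec fun a => if f a = g a then h a else k a :=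
  Primrec.ite (Primrec.eq.comp hf hg) hh hk

theorem primrec_decide_eq {f g : α → ℕ} (hf : Primrec f) (hg : Primrec g) :
    Primrec fun a => decide (f a = g a) :=
  PrimrecPred.decide (Primrec.eq.comp hf hg)

/-- Recursion with changing parameters: the value at `a` is obtained by `H` from the values at the
elements of `calls a`. The recursion stops at depth `0`, with the value `z`. -/
def fuelRec (calls : α → List α) (H : α → List σ → σ) (z : σ) : ℕ → α → σ
  | 0, _ => z
  | d + 1, a => H a ((calls a).map (fuelRec calls H z d))

theorem primrec_fuelRec {calls : α → List α} {H : α → List σ → σ} {z : σ} (hc : Primrec calls)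
    (hH : Primrec₂ H) : Primrec₂ (fuelRec calls H z) := by
  refine Primrec.nat_omega_rec' (fun x : ℕ × α => fuelRec calls H z x.1 x.2) (m := Prod.fst)
    (l := fun x => x.1.casesOn [] fun d => (calls x.2).map fun a => (d, a))
    (g := fun x r => some (x.1.casesOn z fun _ => H x.2 r)) .fst ?_ ?_ ?_ ?_
  · exact Primrec.nat_casesOn .fst (.const [])
      (Primrec.list_map (hc.comp (Primrec.snd.comp .fst))
        (Primrec.pair (Primrec.snd.comp .fst) .snd).to₂).to₂
  · exact Primrec.option_some.comp (Primrec.nat_casesOn (Primrec.fst.comp .fst) (.const z)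
      (hH.comp (Primrec.snd.comp (Primrec.fst.comp .fst)) (Primrec.snd.comp .fst)).to₂)
  · rintro ⟨_ | d, a⟩ x hx
    · simp at hx
    · simp only [List.mem_map] at hx
      obtain ⟨b, _, rfl⟩ := hx
      simp
  · rintro ⟨_ | d, a⟩
    · rfl
    · simp [fuelRec, Function.comp_def]

end Primrec

/-- The list `l` without repetitions. -/
def nub (l : List ℕ) : List ℕ := l.foldr (fun x r => if x ∈ r then r else x :: r) []

@[simp] theorem mem_nub {x : ℕ} {l : List ℕ} : x ∈ nub l ↔ x ∈ l := by
  induction l with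
  | nil => rfl
  | cons y l ih =>
    have h : nub (y :: l) = if y ∈ nub l then nub l else y :: nub l := rfl
    rw [h]
    split_ifs with hy
    · simp only [List.mem_cons, ih]
      constructor
      · exact Or.inr
      · rintro (rfl | hx)
        · exact ih.1 hy
        · exact hx
    · simp [ih]

theorem nodup_nub (l : List ℕ) : (nub l).Nodup := by
  induction l with
  | nil => exact List.nodup_nil
  | cons y l ih =>
    have h : nub (y :: l) = if y ∈ nub l then nub l else y :: nub l := rfl
    rw [h]
    split_ifs with hy
    · exact ih
    · exact List.nodup_cons.2 ⟨hy, ih⟩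

theorem primrec_nub {α : Type} [Primcodable α] {f : α → List ℕ} (hf : Primrec f) :
    Primrec fun a => nub (f a) := by
  refine Primrec.list_foldr (h := fun _ (x : ℕ × List ℕ) => if x.1 ∈ x.2 then x.2 else x.1 :: x.2)
    hf (.const []) ?_
  refine Primrec.ite ?_ (Primrec.snd.comp .snd)
    (Primrec.list_cons.comp (Primrec.fst.comp .snd) (Primrec.snd.comp .snd))
  exact Primrec.primrecPred (primrec_mem (Primrec.fst.comp .snd) (Primrec.snd.comp .snd))

/-! ### The parameters of an instance -/

/-- The size of the alphabet. -/
def pSize (p : List ℕ) : ℕ := p.getD 0 0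
/-- The width. -/
def pWidth (p : List ℕ) : ℕ := p.getD 1 0
/-- The number of relation symbols. -/
def pNumRel (p : List ℕ) : ℕ := p.getD 2 0
/-- The list of arities. -/
def pArities (p : List ℕ) : List ℕ := (p.drop 3).take (pNumRel p)
/-- The number of free variables. -/
def pVars (p : List ℕ) : ℕ := p.getD (3 + pNumRel p) 0
/-- The code of the formula. -/
def pFormula (p : List ℕ) : List ℕ := p.drop (4 + pNumRel p)

theorem primrec_pSize : Primrec pSize := primrec_getD 0 .id (.const 0)
theorem primrec_pWidth : Primrec pWidth := primrec_getD 0 .id (.const 1)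
theorem primrec_pNumRel : Primrec pNumRel := primrec_getD 0 .id (.const 2)
theorem primrec_pArities : Primrec pArities :=
  Primrec.list_take.comp primrec_pNumRel (Primrec.list_drop.comp (.const 3) .id)
theorem primrec_pVars : Primrec pVars :=
  primrec_getD 0 .id (Primrec.nat_add.comp (.const 3) primrec_pNumRel)
theorem primrec_pFormula : Primrec pFormula :=
  Primrec.list_drop.comp (Primrec.nat_add.comp (.const 4) primrec_pNumRel) .id

/-- The length of the bit string of a layer of width `w` over an alphabet with `n` letters. -/
def compLen (w n : ℕ) : ℕ := 2 + (4 * w + w * ((1 + n) * w))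

/-- The position of the bit string of the `i`-th relation in that of a layer of all components. -/
def relOffset (p : List ℕ) (i : ℕ) : ℕ :=
  compLen (pWidth p) (pSize p) +
    (((pArities p).take i).map fun a => compLen (pWidth p) ((pSize p + 1) ^ a)).sum

theorem primrec_compLen {α : Type} [Primcodable α] {f g : α → ℕ} (hf : Primrec f)
    (hg : Primrec g) : Primrec fun a => compLen (f a) (g a) :=
  Primrec.nat_add.comp (.const 2) (Primrec.nat_add.comp (Primrec.nat_mul.comp (.const 4) hf)
    (Primrec.nat_mul.comp hf (Primrec.nat_mul.comp (Primrec.nat_add.comp (.const 1) hg) hf)))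

theorem primrec_relOffset : Primrec₂ relOffset := by
  have hw : Primrec fun x : List ℕ × ℕ => pWidth x.1 := primrec_pWidth.comp .fst
  have hs : Primrec fun x : List ℕ × ℕ => pSize x.1 := primrec_pSize.comp .fst
  refine Primrec.nat_add.comp (primrec_compLen hw hs) (primrec_sum (Primrec.list_map
    (Primrec.list_take.comp .snd (primrec_pArities.comp .fst)) ?_))
  exact primrec_compLen (hw.comp .fst) (primrec_pow (Primrec.succ.comp (hs.comp .fst)) .snd)

/-! ### Steps of the automata -/

/-- The set of states reached from `S` or from the initial states in the layer with bit string `b`,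
of width `w` and over an alphabet with `n` letters, by the letter with index `c`. In the last layer
it is intersected with the final states. -/
def post (b : List Bool) (w n c : ℕ) (S : List ℕ) : List ℕ :=
  (List.range w).filter fun q' =>
    ((List.range w).any fun q => (decide (q ∈ S) || b.getD (2 + (2 * w + q)) false) &&
      b.getD (2 + (4 * w + (q * ((1 + n) * w) + (c * w + q')))) false) &&
    (!b.getD 1 false || b.getD (2 + (3 * w + q')) false)

theorem primrec_post {α : Type} [Primcodable α] {b : α → List Bool} {w n c : α → ℕ}
    {S : α → List ℕ} (hb : Primrec b) (hw : Primrec w) (hn : Primrec n) (hc : Primrec c)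
    (hS : Primrec S) : Primrec fun a => post (b a) (w a) (n a) (c a) (S a) := by
  refine primrec_filter (Primrec.list_range.comp hw) (Primrec.and.comp (primrec_any
    (Primrec.list_range.comp (hw.comp .fst)) (Primrec.and.comp (Primrec.or.comp
      (primrec_mem .snd (hS.comp (Primrec.fst.comp .fst)))
      (primrec_getD _ (hb.comp (Primrec.fst.comp .fst)) ?_))
      (primrec_getD _ (hb.comp (Primrec.fst.comp .fst)) ?_)))
    (Primrec.or.comp (Primrec.not.comp (primrec_getD _ (hb.comp .fst) (.const 1)))
      (primrec_getD _ (hb.comp .fst) ?_)))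
  · exact Primrec.nat_add.comp (.const 2) (Primrec.nat_add.comp (Primrec.nat_mul.comp (.const 2)
      (hw.comp (Primrec.fst.comp .fst))) .snd)
  · have hw' : Primrec fun x : (α × ℕ) × ℕ => w x.1.1 := hw.comp (Primrec.fst.comp .fst)
    have hn' : Primrec fun x : (α × ℕ) × ℕ => n x.1.1 := hn.comp (Primrec.fst.comp .fst)
    have hc' : Primrec fun x : (α × ℕ) × ℕ => c x.1.1 := hc.comp (Primrec.fst.comp .fst)
    exact Primrec.nat_add.comp (.const 2) (Primrec.nat_add.comp
      (Primrec.nat_mul.comp (.const 4) hw') (Primrec.nat_add.comp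
        (Primrec.nat_mul.comp .snd (Primrec.nat_mul.comp (Primrec.nat_add.comp (.const 1) hn') hw'))
        (Primrec.nat_add.comp (Primrec.nat_mul.comp hc' hw') (Primrec.snd.comp .fst))))
  · exact Primrec.nat_add.comp (.const 2) (Primrec.nat_add.comp (Primrec.nat_mul.comp (.const 3)
      (hw.comp .fst)) .snd)

/-- The parameters together with the bit string of a layer. -/
abbrev LayerCtx := List ℕ × List Bool

/-- The step of the automaton for the domain. A state is a pair of a number that tells whether the
last letter was a proper one, and of a set of states of the ODD. Letters are digits, where `0` is
the padding symbol; the word must begin with a proper letter, and no proper letter may follow a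
padding symbol. -/
def domStep (x : LayerCtx) (d y : ℕ) : ℕ :=
  Nat.pair (if d = 0 then 0 else 1) (encode
    (if (bif x.2.getD 0 false then !decide (d = 0) else decide (d = 0) || !decide (y.unpair.1 = 0))
      then post x.2 (pWidth x.1) (pSize x.1) d (ofNat (List ℕ) y.unpair.2) else []))

/-- Acceptance of the automaton for the domain. -/
def domAcc (y : ℕ) : Bool := !decide (y.unpair.2 = 0)

theorem primrec_domStep {α : Type} [Primcodable α] {x : α → LayerCtx} {d y : α → ℕ}
    (hx : Primrec x) (hd : Primrec d) (hy : Primrec y) :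
    Primrec fun a => domStep (x a) (d a) (y a) := by
  have hb : Primrec fun a => (x a).2 := Primrec.snd.comp hx
  have hp : Primrec fun a => (x a).1 := Primrec.fst.comp hx
  have hu : Primrec fun a => (y a).unpair := Primrec.unpair.comp hy
  have h0 : Primrec fun a => decide (d a = 0) := primrec_decide_eq hd (.const 0)
  have hS : Primrec fun a => ofNat (List ℕ) (y a).unpair.2 :=
    (Primrec.ofNat _).comp (Primrec.snd.comp hu)
  unfold domStep
  refine Primrec₂.natPair.comp (primrec_ite_eq hd (.const 0) (.const 0) (.const 1))
    (Primrec.encode.comp (Primrec.ite (Primrec.primrecPred ?_)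
      (primrec_post hb (primrec_pWidth.comp hp) (primrec_pSize.comp hp) hd hS) (.const [])))
  exact (Primrec.cond (primrec_getD false hb (.const 0)) (Primrec.not.comp h0) (Primrec.or.comp h0
    (Primrec.not.comp (primrec_decide_eq (Primrec.fst.comp hu) (.const 0))))).of_eq fun x => by
      simp

theorem primrec_domAcc : Primrec domAcc :=
  Primrec.not.comp (primrec_decide_eq (Primrec.snd.comp .unpair) (.const 0))

/-- The number with the given digits to the base `s + 1`, the most significant one first. -/
def digitsVal (s : ℕ) (l : List ℕ) : ℕ := l.foldl (fun v d => v * (s + 1) + d) 0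

/-- The step of the automaton for the atomic formula of the `i`-th relation with the variables
`vs`, where `e` lists the letters of all variables. The tuple of padding symbols only stands for
the padding symbol of the tuple alphabet. -/
def relStep (x : LayerCtx) (i : ℕ) (vs e : List ℕ) (y : ℕ) : ℕ :=
  encode (post (x.2.drop (relOffset x.1 i)) (pWidth x.1)
    ((pSize x.1 + 1) ^ (pArities x.1).getD i 0)
    (if digitsVal (pSize x.1) (vs.map fun v => e.getD v 0) = 0 then 0
      else digitsVal (pSize x.1) (vs.map fun v => e.getD v 0) + 1)
    (ofNat (List ℕ) y))

theorem primrec_digitsVal {α : Type} [Primcodable α] {s : α → ℕ} {l : α → List ℕ}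
    (hs : Primrec s) (hl : Primrec l) : Primrec fun a => digitsVal (s a) (l a) := by
  refine Primrec.list_foldl (h := fun x (a : ℕ × ℕ) => a.1 * (s x + 1) + a.2) hl (.const 0) ?_
  exact Primrec.nat_add.comp (Primrec.nat_mul.comp (Primrec.fst.comp .snd)
    (Primrec.succ.comp (hs.comp .fst))) (Primrec.snd.comp .snd)

theorem primrec_relStep {α : Type} [Primcodable α] {x : α → LayerCtx} {i y : α → ℕ}
    {vs e : α → List ℕ} (hx : Primrec x) (hi : Primrec i) (hv : Primrec vs) (he : Primrec e)
    (hy : Primrec y) : Primrec fun a => relStep (x a) (i a) (vs a) (e a) (y a) := by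
  have hp : Primrec fun a => (x a).1 := Primrec.fst.comp hx
  have hs : Primrec fun a => pSize (x a).1 := primrec_pSize.comp hp
  have hd : Primrec fun a => digitsVal (pSize (x a).1) ((vs a).map fun v => (e a).getD v 0) :=
    primrec_digitsVal hs (Primrec.list_map hv (primrec_getD 0 (he.comp .fst) .snd).to₂)
  unfold relStep
  refine Primrec.encode.comp (primrec_post
    (Primrec.list_drop.comp (primrec_relOffset.comp hp hi) (Primrec.snd.comp hx))
    (primrec_pWidth.comp hp)
    (primrec_pow (Primrec.succ.comp hs) (primrec_getD 0 (primrec_pArities.comp hp) hi))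
    (primrec_ite_eq hd (.const 0) (.const 0) (Primrec.succ.comp hd)) ((Primrec.ofNat _).comp hy))

/-- The step of the automaton for equality: the state `0` means that no difference was found. -/
def eqStep (v v' : ℕ) (e : List ℕ) (y : ℕ) : ℕ :=
  if y = 0 then (if e.getD v 0 = e.getD v' 0 then 0 else 1) else 1

/-! ### Formulas in prefix notation -/

/-- For all suffixes of the list, the length of the formula in prefix notation at its beginning;
`ar` is the list of arities. -/
def skips (ar : List ℕ) : List ℕ → List ℕ
  | [] => []
  | t :: l => (if t = 0 then 1 else if t = 1 then 3 else if t = 2 then 2 + ar.getD l.headI 0 else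
      if t = 3 then 1 + ((skips ar l).headI + (skips ar l).getD (skips ar l).headI 0)
      else 1 + (skips ar l).headI) :: skips ar l

/-- The length of the formula in prefix notation at the beginning of the list. -/
def skip (ar l : List ℕ) : ℕ := (skips ar l).headI

theorem primrec_skip : Primrec₂ skip := by
  have h : Primrec fun x : List ℕ × List ℕ => skips x.1 x.2 := by
    have ht : Primrec fun y : (List ℕ × List ℕ) × ℕ × List ℕ × List ℕ => y.2.1 :=
      Primrec.fst.comp .snd
    have hl : Primrec fun y : (List ℕ × List ℕ) × ℕ × List ℕ × List ℕ => y.2.2.1 :=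
      Primrec.fst.comp (Primrec.snd.comp .snd)
    have hr : Primrec fun y : (List ℕ × List ℕ) × ℕ × List ℕ × List ℕ => y.2.2.2 :=
      Primrec.snd.comp (Primrec.snd.comp .snd)
    have ha : Primrec fun y : (List ℕ × List ℕ) × ℕ × List ℕ × List ℕ => y.1.1 :=
      Primrec.fst.comp .fst
    have hh := Primrec.list_headI.comp hr
    refine (Primrec.list_rec (f := fun x : List ℕ × List ℕ => x.2) (g := fun _ => ([] : List ℕ))
      (h := fun x y => (if y.1 = 0 then 1 else if y.1 = 1 then 3 else
        if y.1 = 2 then 2 + x.1.getD y.2.1.headI 0 else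
        if y.1 = 3 then 1 + (y.2.2.headI + y.2.2.getD y.2.2.headI 0)
        else 1 + y.2.2.headI) :: y.2.2) .snd (.const []) ?_).of_eq ?_
    · exact Primrec.list_cons.comp (primrec_ite_eq ht (.const 0) (.const 1)
        (primrec_ite_eq ht (.const 1) (.const 3) (primrec_ite_eq ht (.const 2)
          (Primrec.nat_add.comp (.const 2) (primrec_getD 0 ha (Primrec.list_headI.comp hl)))
          (primrec_ite_eq ht (.const 3) (Primrec.nat_add.comp (.const 1)
            (Primrec.nat_add.comp hh (primrec_getD 0 hr hh)))
            (Primrec.nat_add.comp (.const 1) hh))))) hr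
    · rintro ⟨ar, l⟩
      induction l with
      | nil => rfl
      | cons t l ih => simp only [skips] at ih ⊢; rw [← ih]
  exact Primrec.list_headI.comp h

/-- The rest of the list after the formula at its beginning. -/
def rest (ar l : List ℕ) : List ℕ := l.drop (skip ar l)

theorem primrec_rest {α : Type} [Primcodable α] {f g : α → List ℕ} (hf : Primrec f)
    (hg : Primrec g) : Primrec fun a => rest (f a) (g a) :=
  Primrec.list_drop.comp (primrec_skip.comp hf hg) hg

/-! ### The automaton of a formula in prefix notation -/

/-- The initial state of the automaton of a formula in prefix notation, where `a` consists of the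
list of arities and the formula. A state for an implication is a pair of states, and a state for a
universal formula is a list of pairs of a state of the domain automaton and a state for the
subformula. -/
def initCode : ℕ → List ℕ × List ℕ → ℕ :=
  fuelRec
    (fun a => if a.2.headI = 3 then [(a.1, a.2.tail), (a.1, rest a.1 a.2.tail)] else
      if a.2.headI = 4 then [(a.1, a.2.tail)] else [])
    (fun a r => if a.2.headI = 3 then Nat.pair r.headI (r.getD 1 0) else
      if a.2.headI = 4 then encode [Nat.pair 0 r.headI] else 0) 0

theorem primrec_initCode : Primrec₂ initCode := by
  have ht : Primrec fun a : List ℕ × List ℕ => a.2.headI := Primrec.list_headI.comp .snd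
  have hl : Primrec fun a : List ℕ × List ℕ => (a.1, a.2.tail) :=
    .pair .fst (Primrec.list_tail.comp .snd)
  refine primrec_fuelRec (primrec_ite_eq ht (.const 3) ?_ (primrec_ite_eq ht (.const 4) ?_
    (.const []))) (primrec_ite_eq (ht.comp .fst) (.const 3) ?_
    (primrec_ite_eq (ht.comp .fst) (.const 4) ?_ (.const 0)))
  · exact Primrec.list_cons.comp hl (Primrec.list_cons.comp (.pair .fst
      (primrec_rest .fst (Primrec.list_tail.comp .snd))) (.const []))
  · exact Primrec.list_cons.comp hl (.const [])
  · exact Primrec₂.natPair.comp (Primrec.list_headI.comp .snd) (primrec_getD 0 .snd (.const 1))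
  · exact Primrec.encode.comp (Primrec.list_cons.comp (Primrec₂.natPair.comp (.const 0)
      (Primrec.list_headI.comp .snd)) (.const []))

/-- The arguments of the step function: the parameters and the layer, the formula, the letters of
the variables, and the state. -/
abbrev StepArg := LayerCtx × List ℕ × List ℕ × ℕ

/-- The step of the automaton of a formula in prefix notation. -/
def stepCode : ℕ → StepArg → ℕ :=
  fuelRec
    (fun a => if a.2.1.headI = 3 then
        [(a.1, a.2.1.tail, a.2.2.1, a.2.2.2.unpair.1),
          (a.1, rest (pArities a.1.1) a.2.1.tail, a.2.2.1, a.2.2.2.unpair.2)]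
      else if a.2.1.headI = 4 then
        (ofNat (List ℕ) a.2.2.2).flatMap fun z => (List.range (pSize a.1.1 + 1)).map fun b =>
          (a.1, a.2.1.tail, a.2.2.1 ++ [b], z.unpair.2)
      else [])
    (fun a r => if a.2.1.headI = 3 then Nat.pair r.headI (r.getD 1 0) else
      if a.2.1.headI = 4 then encode (nub ((List.zip
        ((ofNat (List ℕ) a.2.2.2).flatMap fun z => (List.range (pSize a.1.1 + 1)).map fun b =>
          domStep a.1 b z.unpair.1) r).map fun y => Nat.pair y.1 y.2)) else
      if a.2.1.headI = 1 then eqStep (a.2.1.getD 1 0) (a.2.1.getD 2 0) a.2.2.1 a.2.2.2 else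
      if a.2.1.headI = 2 then relStep a.1 (a.2.1.getD 1 0)
        ((a.2.1.drop 2).take ((pArities a.1.1).getD (a.2.1.getD 1 0) 0)) a.2.2.1 a.2.2.2
      else 0) 0

theorem primrec_stepCode : Primrec₂ stepCode := by
  have hx : Primrec fun a : StepArg => a.1 := .fst
  have hp : Primrec fun a : StepArg => a.1.1 := Primrec.fst.comp .fst
  have hl : Primrec fun a : StepArg => a.2.1 := Primrec.fst.comp .snd
  have ht : Primrec fun a : StepArg => a.2.1.headI := Primrec.list_headI.comp hl
  have htl : Primrec fun a : StepArg => a.2.1.tail := Primrec.list_tail.comp hl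
  have he : Primrec fun a : StepArg => a.2.2.1 := Primrec.fst.comp (Primrec.snd.comp .snd)
  have hy : Primrec fun a : StepArg => a.2.2.2 := Primrec.snd.comp (Primrec.snd.comp .snd)
  have hyl : Primrec fun a : StepArg => ofNat (List ℕ) a.2.2.2 := (Primrec.ofNat _).comp hy
  have hr : Primrec fun a : StepArg => List.range (pSize a.1.1 + 1) :=
    Primrec.list_range.comp (Primrec.succ.comp (primrec_pSize.comp hp))
  have ha := primrec_pArities.comp hp
  have h1 : Primrec fun a : StepArg => a.2.1.getD 1 0 := primrec_getD 0 hl (.const 1)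
  have hrel : Primrec fun a : StepArg => relStep a.1 (a.2.1.getD 1 0)
      ((a.2.1.drop 2).take ((pArities a.1.1).getD (a.2.1.getD 1 0) 0)) a.2.2.1 a.2.2.2 :=
    primrec_relStep hx h1 (Primrec.list_take.comp (primrec_getD 0 ha h1)
      (Primrec.list_drop.comp (.const 2) hl)) he hy
  have f1 {β γ : Type} [Primcodable β] [Primcodable γ] {f : StepArg → β} (hf : Primrec f) :
      Primrec fun a : (StepArg × ℕ) × γ => f a.1.1 := hf.comp (Primrec.fst.comp .fst)
  refine primrec_fuelRec (primrec_ite_eq ht (.const 3) ?_ (primrec_ite_eq ht (.const 4) ?_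
    (.const []))) (primrec_ite_eq (ht.comp .fst) (.const 3) ?_
    (primrec_ite_eq (ht.comp .fst) (.const 4) ?_ (primrec_ite_eq (ht.comp .fst) (.const 1) ?_
    (primrec_ite_eq (ht.comp .fst) (.const 2) ?_ (.const 0)))))
  · refine Primrec.list_cons.comp (hx.pair (htl.pair (he.pair
      (Primrec.fst.comp (Primrec.unpair.comp hy))))) (Primrec.list_cons.comp (hx.pair
      ((primrec_rest ha htl).pair (he.pair (Primrec.snd.comp (Primrec.unpair.comp hy)))))
      (.const []))
  · refine Primrec.list_flatMap hyl (Primrec.list_map (hr.comp .fst) ?_)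
    exact (f1 hx).pair ((f1 htl).pair ((Primrec.list_append.comp (f1 he)
      (Primrec.list_cons.comp .snd (.const []))).pair
      (Primrec.snd.comp (Primrec.unpair.comp (Primrec.snd.comp .fst)))))
  · exact Primrec₂.natPair.comp (Primrec.list_headI.comp .snd) (primrec_getD 0 .snd (.const 1))
  · refine Primrec.encode.comp (primrec_nub (Primrec.list_map (primrec_zip
      (Primrec.list_flatMap (hyl.comp .fst) (Primrec.list_map (hr.comp (Primrec.fst.comp .fst)) ?_))
      .snd) (Primrec₂.natPair.comp (Primrec.fst.comp .snd) (Primrec.snd.comp .snd)).to₂))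
    exact primrec_domStep (hx.comp (Primrec.fst.comp (Primrec.fst.comp .fst)))
      .snd (Primrec.fst.comp (Primrec.unpair.comp (Primrec.snd.comp .fst)))
  · have hv : Primrec fun a : StepArg × List ℕ => a.1.2.2.1.getD (a.1.2.1.getD 1 0) 0 :=
      primrec_getD 0 (he.comp .fst) (h1.comp .fst)
    have hv' : Primrec fun a : StepArg × List ℕ => a.1.2.2.1.getD (a.1.2.1.getD 2 0) 0 :=
      primrec_getD 0 (he.comp .fst) (primrec_getD 0 (hl.comp .fst) (.const 2))
    exact primrec_ite_eq (hy.comp .fst) (.const 0) (primrec_ite_eq hv hv' (.const 0) (.const 1))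
      (.const 1)
  · exact hrel.comp .fst

/-- Acceptance of the automaton of a formula in prefix notation; `a` consists of the list of
arities, the formula, and the state. -/
def accCode : ℕ → List ℕ × List ℕ × ℕ → Bool :=
  fuelRec
    (fun a => if a.2.1.headI = 3 then
        [(a.1, a.2.1.tail, a.2.2.unpair.1), (a.1, rest a.1 a.2.1.tail, a.2.2.unpair.2)]
      else if a.2.1.headI = 4 then
        (ofNat (List ℕ) a.2.2).map fun z => (a.1, a.2.1.tail, z.unpair.2)
      else [])
    (fun a r => if a.2.1.headI = 3 then !r.headI || r.getD 1 false else
      if a.2.1.headI = 4 then ((ofNat (List ℕ) a.2.2).zip r).all fun y =>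
        !domAcc y.1.unpair.1 || y.2 else
      if a.2.1.headI = 1 then decide (a.2.2 = 0) else
      if a.2.1.headI = 2 then !decide (a.2.2 = 0) else false) false

theorem primrec_accCode : Primrec₂ accCode := by
  have hl : Primrec fun a : List ℕ × List ℕ × ℕ => a.2.1 := Primrec.fst.comp .snd
  have ht : Primrec fun a : List ℕ × List ℕ × ℕ => a.2.1.headI := Primrec.list_headI.comp hl
  have htl : Primrec fun a : List ℕ × List ℕ × ℕ => a.2.1.tail := Primrec.list_tail.comp hl
  have hy : Primrec fun a : List ℕ × List ℕ × ℕ => a.2.2 := Primrec.snd.comp .snd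
  have hyl : Primrec fun a : List ℕ × List ℕ × ℕ => ofNat (List ℕ) a.2.2 :=
    (Primrec.ofNat _).comp hy
  have h0 := primrec_decide_eq (hy.comp (Primrec.fst (β := List Bool))) (.const 0)
  refine primrec_fuelRec (primrec_ite_eq ht (.const 3) ?_ (primrec_ite_eq ht (.const 4) ?_
    (.const []))) (primrec_ite_eq (ht.comp .fst) (.const 3) ?_
    (primrec_ite_eq (ht.comp .fst) (.const 4) ?_ (primrec_ite_eq (ht.comp .fst) (.const 1) h0
    (primrec_ite_eq (ht.comp .fst) (.const 2) (Primrec.not.comp h0) (.const false)))))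
  · exact Primrec.list_cons.comp (Primrec.fst.pair (htl.pair
      (Primrec.fst.comp (Primrec.unpair.comp hy)))) (Primrec.list_cons.comp (Primrec.fst.pair
      ((primrec_rest .fst htl).pair (Primrec.snd.comp (Primrec.unpair.comp hy)))) (.const []))
  · exact Primrec.list_map hyl (Primrec.pair (Primrec.fst.comp .fst) ((htl.comp .fst).pair
      (Primrec.snd.comp (Primrec.unpair.comp .snd)))).to₂
  · exact Primrec.or.comp (Primrec.not.comp (Primrec.list_headI.comp .snd))
      (primrec_getD false .snd (.const 1))
  · refine primrec_all (primrec_zip (hyl.comp .fst) .snd) (Primrec.or.comp (Primrec.not.comp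
      (primrec_domAcc.comp (Primrec.fst.comp (Primrec.unpair.comp (Primrec.fst.comp .snd)))))
      (Primrec.snd.comp .snd))

/-! ### The automaton that is counted -/

/-- All lists of `m` numbers below `n`. -/
def allLists (n : ℕ) : ℕ → List (List ℕ)
  | 0 => [[]]
  | m + 1 => (List.range n).flatMap fun b => (allLists n m).map fun l => b :: l

theorem primrec_allLists : Primrec₂ allLists := by
  refine (Primrec.nat_rec (f := fun _ : ℕ => [([] : List ℕ)])
    (g := fun n x => (List.range n).flatMap fun b => x.2.map fun l => b :: l) (.const _)
    (Primrec.list_flatMap (Primrec.list_range.comp .fst) (Primrec.list_map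
      (Primrec.snd.comp (Primrec.snd.comp .fst))
      (Primrec.list_cons.comp (Primrec.snd.comp .fst) .snd).to₂))).of_eq fun n m => ?_
  induction m with
  | zero => rfl
  | succ m ih => simp only [allLists]; rw [← ih]

/-- The initial state: the states of the domain automaton for the free variables, and the state of
the automaton of the formula. -/
def topInit (p : List ℕ) : ℕ :=
  Nat.pair (encode (List.replicate (pVars p) 0))
    (initCode (pFormula p).length (pArities p, pFormula p))

/-- A step with the list `e` of letters of the free variables. -/
def topStep (x : LayerCtx) (e : List ℕ) (z : ℕ) : ℕ :=
  Nat.pair (encode ((List.range (pVars x.1)).map fun i =>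
      domStep x (e.getD i 0) ((ofNat (List ℕ) z.unpair.1).getD i 0)))
    (stepCode (pFormula x.1).length (x, pFormula x.1, e, z.unpair.2))

/-- Acceptance: all free variables have values in the domain, and the formula holds. -/
def topAcc (p : List ℕ) (z : ℕ) : Bool :=
  ((List.range (pVars p)).all fun i => domAcc ((ofNat (List ℕ) z.unpair.1).getD i 0)) &&
    accCode (pFormula p).length (pArities p, pFormula p, z.unpair.2)

/-- The states after one more layer, for all possible letters of the free variables. -/
def succs (x : LayerCtx) (z : ℕ) : List ℕ :=
  (allLists (pSize x.1 + 1) (pVars x.1)).map fun e => topStep x e z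

theorem primrec_topInit : Primrec topInit := by
  have hf : Primrec fun p => (pFormula p).length := Primrec.list_length.comp primrec_pFormula
  refine Primrec₂.natPair.comp (Primrec.encode.comp ?_)
    (primrec_initCode.comp hf (primrec_pArities.pair primrec_pFormula))
  refine (Primrec.list_map (Primrec.list_range.comp primrec_pVars)
    (Primrec.const 0).to₂).of_eq fun p => ?_
  simp [List.map_const']

theorem primrec_topStep :
    Primrec fun a : LayerCtx × List ℕ × ℕ => topStep a.1 a.2.1 a.2.2 := by
  have hx : Primrec fun a : LayerCtx × List ℕ × ℕ => a.1 := .fst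
  have hp : Primrec fun a : LayerCtx × List ℕ × ℕ => a.1.1 := Primrec.fst.comp .fst
  have he : Primrec fun a : LayerCtx × List ℕ × ℕ => a.2.1 := Primrec.fst.comp .snd
  have hz : Primrec fun a : LayerCtx × List ℕ × ℕ => a.2.2.unpair :=
    Primrec.unpair.comp (Primrec.snd.comp .snd)
  refine Primrec₂.natPair.comp (Primrec.encode.comp (Primrec.list_map
    (Primrec.list_range.comp (primrec_pVars.comp hp)) ?_)) ?_
  · exact primrec_domStep (hx.comp .fst) (primrec_getD 0 (he.comp .fst) .snd)
      (primrec_getD 0 ((Primrec.ofNat _).comp (Primrec.fst.comp (hz.comp .fst))) .snd)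
  · exact primrec_stepCode.comp (Primrec.list_length.comp (primrec_pFormula.comp hp))
      (hx.pair ((primrec_pFormula.comp hp).pair (he.pair (Primrec.snd.comp hz))))

theorem primrec_topAcc : Primrec₂ topAcc := by
  have hz : Primrec fun a : List ℕ × ℕ => a.2.unpair := Primrec.unpair.comp .snd
  have hf : Primrec fun a : List ℕ × ℕ => pFormula a.1 := primrec_pFormula.comp .fst
  refine Primrec.and.comp (primrec_all (Primrec.list_range.comp (primrec_pVars.comp .fst)) ?_) ?_
  · exact primrec_domAcc.comp
      (primrec_getD 0 ((Primrec.ofNat _).comp (Primrec.fst.comp (hz.comp .fst))) .snd)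
  · exact primrec_accCode.comp (Primrec.list_length.comp hf)
      ((primrec_pArities.comp .fst).pair (hf.pair (Primrec.snd.comp hz)))

theorem primrec_succs : Primrec₂ succs := by
  have hp : Primrec fun a : LayerCtx × ℕ => a.1.1 := Primrec.fst.comp .fst
  refine Primrec.list_map (primrec_allLists.comp (Primrec.succ.comp (primrec_pSize.comp hp))
    (primrec_pVars.comp hp)) ?_
  exact primrec_topStep.comp (.pair (Primrec.fst.comp .fst) (.pair .snd (Primrec.snd.comp .fst)))

/-! ### Bit strings of layers -/

section Bits

theorem getElem?_flatMap_of_length {α β : Type} {l : List α} {g : α → List β} {n : ℕ}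
    (hg : ∀ a, (g a).length = n) (i : ℕ) {j : ℕ} (hj : j < n) :
    (l.flatMap g)[i * n + j]? = l[i]?.bind fun a => (g a)[j]? := by
  induction l generalizing i with
  | nil => simp
  | cons a l ih =>
    rcases i with _ | i
    · simp [List.getElem?_append, hg, hj]
    · have h : ¬ (i + 1) * n + j < n := by rw [Nat.succ_mul]; omega
      have h' : (i + 1) * n + j - n = i * n + j := by rw [Nat.succ_mul]; omega
      simp [List.getElem?_append, hg, h, h', ih]

theorem getElem?_product {α β : Type} (l : List α) {l' : List β} {n : ℕ} (hn : l'.length = n)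
    (i : ℕ) {j : ℕ} (hj : j < n) :
    (l ×ˢ l')[i * n + j]? = l[i]?.bind fun a => l'[j]?.map fun b => (a, b) := by
  have h : l ×ˢ l' = l.flatMap fun a => l'.map (Prod.mk a) := rfl
  rw [h, getElem?_flatMap_of_length (n := n) (by simp [hn]) i hj]
  simp

theorem drop_flatMap {α β : Type} (l : List α) (g : α → List β) (i : ℕ) :
    (l.flatMap g).drop (((l.take i).map fun a => (g a).length).sum) = (l.drop i).flatMap g := by
  induction l generalizing i with
  | nil => simp
  | cons a l ih =>
    rcases i with _ | i
    · simp
    · simp [← List.drop_drop, ← ih i]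

variable {A : Type} [DecidableEq A] {w : ℕ} (l : List A) (B : Layer A w) (r : List Bool)

@[simp] theorem length_bitTable {C : Type} [DecidableEq C] (l : List C) (S : Finset C) :
    (bitTable l S).length = l.length := by simp [bitTable]

theorem bitTable_getElem? {C : Type} [DecidableEq C] (l : List C) (S : Finset C) (i : ℕ) :
    (bitTable l S)[i]? = l[i]?.map fun b => decide (b ∈ S) := by simp [bitTable]

theorem length_code : (B.code l).length = compLen w l.length := by
  simp [Layer.code, compLen, List.length_product]
  ring

theorem code_flags : ((B.code l ++ r).getD 0 false = B.initialFlag) ∧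
    ((B.code l ++ r).getD 1 false = B.finalFlag) := by
  simp [Layer.code]

theorem code_initial (q : Fin w) :
    (B.code l ++ r).getD (2 + (2 * w + q)) false = decide (q ∈ B.initial) := by
  have hq := q.2
  have e : 2 + (2 * w + q.val) = (2 * w + q.val) + 1 + 1 := by omega
  have h1 : ¬ 2 * w + q.val < w := by omega
  have h2 : ¬ 2 * w + q.val - w < w := by omega
  have h3 : 2 * w + q.val - w - w = q := by omega
  rw [e]
  simp [Layer.code, List.getElem?_append, h1, h2, h3]
  simp [bitTable]

theorem code_final (q : Fin w) :
    (B.code l ++ r).getD (2 + (3 * w + q)) false = decide (q ∈ B.final) := by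
  have hq := q.2
  have e : 2 + (3 * w + q.val) = (3 * w + q.val) + 1 + 1 := by omega
  have h1 : ¬ 3 * w + q.val < w := by omega
  have h2 : ¬ 3 * w + q.val - w < w := by omega
  have h3 : ¬ 3 * w + q.val - w - w < w := by omega
  have h4 : 3 * w + q.val - w - w - w = q := by omega
  rw [e]
  simp [Layer.code, List.getElem?_append, h1, h2, h3, h4]
  simp [bitTable]

theorem code_trans (q q' : Fin w) {c : ℕ} {a : Option A} (ha : (none :: l.map some)[c]? = some a) :
    (B.code l ++ r).getD (2 + (4 * w + (q * ((1 + l.length) * w) + (c * w + q')))) false =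
      decide ((q, a, q') ∈ B.trans) := by
  have hc : c < 1 + l.length := by
    have := (List.getElem?_eq_some_iff.1 ha).1
    simp at this; omega
  have h5 : c * w + q' < (1 + l.length) * w := by
    have h := Nat.mul_le_mul_right w (Nat.succ_le_of_lt hc)
    have := q'.2
    rw [Nat.succ_mul] at h
    omega
  have hi : (List.finRange w ×ˢ ((none :: l.map some) ×ˢ List.finRange w))[
      q.val * ((1 + l.length) * w) + (c * w + q'.val)]? = some (q, a, q') := by
    rw [getElem?_product _ (by simp [List.length_product]; ring) _ h5,
      getElem?_product _ (by simp) _ q'.2, ha]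
    simp
  generalize q.val * ((1 + l.length) * w) + (c * w + q'.val) = x at hi ⊢
  have e : 2 + (4 * w + x) = (4 * w + x) + 1 + 1 := by omega
  have h1 : ¬ 4 * w + x < w := by omega
  have h2 : ¬ 4 * w + x - w < w := by omega
  have h3 : ¬ 4 * w + x - w - w < w := by omega
  have h4 : ¬ 4 * w + x - w - w - w < w := by omega
  have h6 : 4 * w + x - w - w - w - w = x := by omega
  have h7 : (bitTable (List.finRange w ×ˢ ((none :: l.map some) ×ˢ List.finRange w)) B.trans)[x]? =
      some (decide ((q, a, q') ∈ B.trans)) := by rw [bitTable_getElem?, hi]; rfl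
  have h8 := (List.getElem?_eq_some_iff.1 h7).1
  rw [e]
  simp only [Layer.code, List.cons_append, List.append_assoc, List.getElem?_cons_succ,
    List.getD_eq_getElem?_getD, List.getElem?_append, length_bitTable, List.length_finRange, h1, h2,
    h3, h4, h6, if_false]
  rw [length_bitTable] at h8
  rw [if_pos h8, h7]
  rfl

/-- The meaning of `post` for the bit string of a layer. -/
theorem mem_post {c : ℕ} {a : Option A} (ha : (none :: l.map some)[c]? = some a) {S : List ℕ}
    (q' : Fin w) : q'.val ∈ post (B.code l ++ r) w l.length c S ↔
      (∃ q : Fin w, (q.val ∈ S ∨ q ∈ B.initial) ∧ (q, a, q') ∈ B.trans) ∧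
        (B.finalFlag = true → q' ∈ B.final) := by
  simp only [post, List.mem_filter, List.mem_range, q'.2, true_and, Bool.and_eq_true,
    List.any_eq_true, (code_flags l B r).2, code_final]
  refine and_congr ⟨?_, ?_⟩ ?_
  · rintro ⟨q, hq, h⟩
    have h1 := code_initial l B r ⟨q, hq⟩
    have h2 := code_trans l B r ⟨q, hq⟩ q' ha
    simp only at h1 h2
    rw [h1, h2] at h
    exact ⟨⟨q, hq⟩, by simpa using h⟩
  · rintro ⟨q, h⟩
    refine ⟨q, q.2, ?_⟩
    rw [code_initial, code_trans l B r q q' ha]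
    simpa using h
  · cases B.finalFlag <;> simp

theorem lt_of_mem_post {b : List Bool} {w n c q : ℕ} {S : List ℕ} (h : q ∈ post b w n c S) :
    q < w := by
  simp only [post, List.mem_filter, List.mem_range] at h
  exact h.1

end Bits

/-! ### Runs of ordered decision diagrams -/

section Reach

variable {A : Type} {w k : ℕ}

/-- The states in which a run on the first letters of the padded word `a` may end. -/
def reach (D : Fin k → Layer A w) (a : ℕ → Option A) : ℕ → Set (Fin w)
  | 0 => ∅
  | j + 1 => {q' | ∃ h : j < k, (∃ q, (q ∈ reach D a j ∨ q ∈ (D ⟨j, h⟩).initial) ∧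
      (q, a j, q') ∈ (D ⟨j, h⟩).trans) ∧ ((D ⟨j, h⟩).finalFlag = true → q' ∈ (D ⟨j, h⟩).final)}

theorem exists_of_mem_reach {D : Fin k → Layer A w} (hD : IsODD D) {a : ℕ → Option A} {j : ℕ}
    {q : Fin w} (hq : q ∈ reach D a j) :
    ∃ t : ℕ → Fin w × Option A × Fin w, (t (j - 1)).2.2 = q ∧ ∀ i (h : i < k), i < j →
      (t i).2.1 = a i ∧ t i ∈ (D ⟨i, h⟩).trans ∧ (i + 1 < j → (t (i + 1)).1 = (t i).2.2) ∧
      (i = 0 → (t i).1 ∈ (D ⟨i, h⟩).initial) ∧ (i + 1 = k → (t i).2.2 ∈ (D ⟨i, h⟩).final) := by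
  induction j generalizing q with
  | zero => exact hq.elim
  | succ j ih =>
    obtain ⟨hj, ⟨q', hq', ht⟩, hf⟩ := hq
    have hf' : j + 1 = k → q ∈ (D ⟨j, hj⟩).final := fun h => hf ((hD.finalFlag_iff ⟨j, hj⟩).2 h)
    rcases Nat.eq_zero_or_pos j with rfl | hpos
    · refine ⟨fun _ => (q', a 0, q), rfl, fun i h hi => ?_⟩
      obtain rfl : i = 0 := by omega
      refine ⟨rfl, ht, by omega, fun _ => ?_, hf'⟩
      exact hq'.resolve_left id
    · have hq'' : q' ∈ reach D a j := by
        refine hq'.resolve_right fun h => ?_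
        have h0 : (D ⟨j, hj⟩).initialFlag = false := by
          rw [← Bool.not_eq_true, hD.initialFlag_iff]
          exact hpos.ne'
        simp [(D ⟨j, hj⟩).initial_eq_empty h0] at h
      obtain ⟨t, rfl, h⟩ := ih hq''
      refine ⟨fun i => if i < j then t i else ((t (j - 1)).2.2, a j, q), by simp, fun i hik hi => ?_⟩
      rcases Nat.lt_succ_iff_lt_or_eq.1 hi with hi | rfl
      · obtain ⟨h1, h2, h3, h4, h5⟩ := h i hik hi
        refine ⟨by simp [hi, h1], by simp [hi, h2], fun _ => ?_, by simpa [hi] using h4,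
          by simpa [hi] using h5⟩
        by_cases h' : i + 1 < j
        · simp [hi, h', h3 h']
        · obtain rfl : j = i + 1 := by omega
          simp
      · refine ⟨by simp, by simpa using ht, by omega, by omega, by simpa using hf'⟩

theorem reach_nonempty_iff {D : Fin k → Layer A w} (hD : IsODD D) {u : List A} :
    (reach D (fun j => u[j]?) k).Nonempty ↔ ∃ t, IsAccepting D u t := by
  constructor
  · rintro ⟨q, hq⟩
    obtain ⟨t, -, h⟩ := exists_of_mem_reach hD hq
    refine ⟨fun i => t i, fun i => (h i i.2 i.2).1, fun i => (h i i.2 i.2).2.1, fun i j hij => ?_,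
      fun i => (h i i.2 i.2).2.2.2.1, fun i => (h i i.2 i.2).2.2.2.2⟩
    have := (h i i.2 i.2).2.2.1 (by omega)
    rwa [← hij] at this
  · rintro ⟨t, h⟩
    have key : ∀ i (hi : i < k), (t ⟨i, hi⟩).2.2 ∈ reach D (fun j => u[j]?) (i + 1) := by
      intro i
      induction i with
      | zero =>
        intro hi
        refine ⟨hi, ⟨(t ⟨0, hi⟩).1, Or.inr (h.mem_initial _ rfl), ?_⟩, fun hf => ?_⟩
        · have hl := h.label_eq ⟨0, hi⟩
          dsimp only at hl ⊢
          rw [← hl]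
          exact h.mem_trans _
        · exact h.mem_final _ ((hD.finalFlag_iff _).1 hf)
      | succ i ih =>
        intro hi
        refine ⟨hi, ⟨(t ⟨i + 1, hi⟩).1, Or.inl ?_, ?_⟩, fun hf => ?_⟩
        · rw [h.consecutive ⟨i, by omega⟩ ⟨i + 1, hi⟩ rfl]
          exact ih _
        · have hl := h.label_eq ⟨i + 1, hi⟩
          dsimp only at hl ⊢
          rw [← hl]
          exact h.mem_trans _
        · exact h.mem_final _ ((hD.finalFlag_iff _).1 hf)
    have hk := hD.length_pos
    have := key (k - 1) (by omega)
    rw [Nat.sub_add_cancel hk] at this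
    exact ⟨_, this⟩

end Reach

/-! ### The parameters and the bit strings of an instance -/

section Params

variable (s w : ℕ) (V : RelVocab) (m : ℕ) (φ : V.lang.Formula (Fin m))

@[simp] theorem pSize_paramCode : pSize (paramCode s w V m φ) = s := rfl

@[simp] theorem pWidth_paramCode : pWidth (paramCode s w V m φ) = w := rfl

@[simp] theorem pNumRel_paramCode : pNumRel (paramCode s w V m φ) = V.numRel := rfl

@[simp] theorem pArities_paramCode : pArities (paramCode s w V m φ) = List.ofFn V.arity := by
  rw [pArities, pNumRel_paramCode]
  simp [paramCode]

@[simp] theorem pVars_paramCode : pVars (paramCode s w V m φ) = m := by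
  have h : 3 + V.numRel = V.numRel + 1 + 1 + 1 := by omega
  rw [pVars, pNumRel_paramCode, h]
  simp [paramCode]

@[simp] theorem pFormula_paramCode : pFormula (paramCode s w V m φ) = formulaCode φ := by
  have h : 4 + V.numRel = (List.ofFn V.arity).length + 1 + 1 + 1 + 1 := by simp; omega
  rw [pFormula, pNumRel_paramCode, h]
  simp [paramCode, List.drop_append]

theorem length_allTuples {B : Type} (l : List B) (a : ℕ) :
    (allTuples l a).length = l.length ^ a := by
  induction a with
  | zero => rfl
  | succ a ih => simp [allTuples, ih, pow_succ']

variable {s w V m} {k : ℕ} (T : LayerTuple (Fin s) w V k) (j : Fin k)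

/-- The length of the bit string of a layer of all components. -/
def layerLen (p : List ℕ) : ℕ := relOffset p (pNumRel p)

theorem primrec_layerLen : Primrec layerLen := primrec_relOffset.comp .id primrec_pNumRel

theorem length_relCode (i : Fin V.numRel) :
    ((T.rel i j).code (allTuples (none :: (List.finRange s).map some) (V.arity i))).length =
      compLen w ((s + 1) ^ V.arity i) := by
  simp [length_code, length_allTuples]

theorem relOffset_eq (i : ℕ) : relOffset (paramCode s w V m φ) i =
    ((T.dom j).code (List.finRange s)).length + (((List.finRange V.numRel).take i).map fun i =>
      ((T.rel i j).code
        (allTuples (none :: (List.finRange s).map some) (V.arity i))).length).sum := by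
  simp only [relOffset, pWidth_paramCode, pSize_paramCode, pArities_paramCode, length_relCode]
  rw [List.ofFn_eq_map, ← List.map_take, List.map_map, length_code, List.length_finRange]
  rfl

theorem length_tupleCode : (T.code j).length = layerLen (paramCode s w V m φ) := by
  rw [layerLen, relOffset_eq φ T j, pNumRel_paramCode, List.take_of_length_le (by simp)]
  simp [LayerTuple.code, List.length_flatMap]

theorem drop_relOffset (i : Fin V.numRel) :
    ∃ r, (T.code j).drop (relOffset (paramCode s w V m φ) i) =
      (T.rel i j).code (allTuples (none :: (List.finRange s).map some) (V.arity i)) ++ r := by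
  rw [relOffset_eq φ T j, LayerTuple.code, ← List.drop_drop, List.drop_left, drop_flatMap,
    List.drop_eq_getElem_cons (by simp), List.flatMap_cons]
  have h : (List.finRange V.numRel)[i.val]'(by simp) = i := by simp
  rw [h]
  exact ⟨_, rfl⟩

end Params

/-! ### Letters as digits -/

section Digits

variable {s : ℕ}

/-- The digit of a letter or of the padding symbol. -/
def dig (o : Option (Fin s)) : ℕ := o.elim 0 fun a => a.val + 1

theorem dig_lt (o : Option (Fin s)) : dig o < s + 1 := by
  rcases o with _ | a
  · exact Nat.succ_pos _
  · exact Nat.succ_lt_succ a.2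

theorem dig_injective : Function.Injective (dig (s := s)) := by
  rintro (_ | a) (_ | b) h
  · rfl
  · simp [dig] at h
  · simp [dig] at h
  · rw [Fin.ext (Nat.succ_injective h)]

theorem exists_dig {d : ℕ} (h : d < s + 1) : ∃ o : Option (Fin s), dig o = d := by
  rcases d with _ | d
  · exact ⟨none, rfl⟩
  · exact ⟨some ⟨d, by omega⟩, rfl⟩

@[simp] theorem dig_eq_zero {o : Option (Fin s)} : dig o = 0 ↔ o = none := by
  rcases o with _ | a <;> simp [dig]

theorem getElem?_dig (o : Option (Fin s)) :
    (none :: (List.finRange s).map some)[dig o]? = some o := by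
  rcases o with _ | a <;> simp [dig]

theorem foldl_digits (s : ℕ) (l : List ℕ) (v : ℕ) :
    l.foldl (fun v d => v * (s + 1) + d) v = v * (s + 1) ^ l.length + digitsVal s l := by
  induction l generalizing v with
  | nil => simp [digitsVal]
  | cons d l ih =>
    have h : digitsVal s (d :: l) = d * (s + 1) ^ l.length + digitsVal s l := by
      rw [digitsVal, List.foldl_cons, zero_mul, zero_add, ih]
    rw [List.foldl_cons, ih, h, List.length_cons]
    ring

theorem digitsVal_cons (d : ℕ) (l : List ℕ) :
    digitsVal s (d :: l) = d * (s + 1) ^ l.length + digitsVal s l := by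
  rw [digitsVal, List.foldl_cons, zero_mul, zero_add, foldl_digits]

theorem digitsVal_eq_zero {l : List ℕ} : digitsVal s l = 0 ↔ ∀ d ∈ l, d = 0 := by
  induction l with
  | nil => simp [digitsVal]
  | cons d l ih => simp [digitsVal_cons, ih]

theorem getElem?_allTuples {a : ℕ} (t : Fin a → Option (Fin s)) :
    (allTuples (none :: (List.finRange s).map some) a)[
      digitsVal s (List.ofFn fun i => dig (t i))]? = some t := by
  induction a with
  | zero => simpa [allTuples, digitsVal] using Subsingleton.elim _ _
  | succ a ih =>
    have h := ih fun i => t i.succ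
    have hlt := (List.getElem?_eq_some_iff.1 h).1
    rw [length_allTuples, List.length_cons, List.length_map, List.length_finRange] at hlt
    rw [List.ofFn_succ, digitsVal_cons, List.length_ofFn, allTuples,
      getElem?_flatMap_of_length (n := (s + 1) ^ a) (by simp [length_allTuples]) _ hlt,
      getElem?_dig]
    simp only [Option.bind_some, List.getElem?_map, h, Option.map_some]
    rw [← Fin.cons_self_tail t]
    rfl

end Digits

/-! ### Runs of the automata -/

/-- The state reached from `z` after `j` steps, where `f i` is the `i`-th step. -/
def iter {σ : Type} (f : ℕ → σ → σ) (z : σ) : ℕ → σ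
  | 0 => z
  | j + 1 => f j (iter f z j)

theorem iter_congr {σ : Type} {f g : ℕ → σ → σ} {z : σ} {j : ℕ} (h : ∀ i < j, f i = g i) :
    iter f z j = iter g z j := by
  induction j with
  | zero => rfl
  | succ j ih => rw [iter, iter, ih fun i hi => h i (by omega), h j (by omega)]

/-- The state of the domain automaton after `j` letters of the word `b`. -/
def domState (x : ℕ → LayerCtx) (b : ℕ → ℕ) : ℕ → ℕ := iter (fun j => domStep (x j) (b j)) 0

/-- The state of the automaton of the formula `l` after `j` letters, where `e i` lists the `i`-th
letters of all variables. -/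
def formulaState (ar : List ℕ) (d : ℕ) (l : List ℕ) (x : ℕ → LayerCtx) (e : ℕ → List ℕ) : ℕ → ℕ :=
  iter (fun j y => stepCode d (x j, l, e j, y)) (initCode d (ar, l))

theorem ofNat_list_zero : ofNat (List ℕ) 0 = [] := by
  have h := ofNat_encode ([] : List ℕ)
  rwa [Encodable.encode_list_nil] at h

theorem ofNat_list_ne_nil {y : ℕ} : y ≠ 0 ↔ ofNat (List ℕ) y ≠ [] := by
  rw [not_iff_not]
  constructor
  · rintro rfl
    exact ofNat_list_zero
  · intro h
    rw [← encode_ofNat (α := List ℕ) y, h, Encodable.encode_list_nil]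

section Automata

variable {s w : ℕ} {V : RelVocab} {m : ℕ} {φ : V.lang.Formula (Fin m)} {k : ℕ}
  {T : LayerTuple (Fin s) w V k} {x : ℕ → LayerCtx}

/-- No letter follows a padding symbol, and the first letter is not a padding symbol. -/
def Proper (a : ℕ → Option (Fin s)) (j : ℕ) : Prop :=
  ∀ i < j, (i = 0 → a i ≠ none) ∧ (0 < i → a (i - 1) = none → a i = none)

theorem proper_iff {a : ℕ → Option (Fin s)} (hk : 0 < k) :
    Proper a k ↔ ∃ u : List (Fin s), u ≠ [] ∧ u.length ≤ k ∧ ∀ j < k, a j = u[j]? := by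
  constructor
  · intro h
    have hex : ∃ n, n = k ∨ a n = none := ⟨k, Or.inl rfl⟩
    classical
    let N := Nat.find hex
    have hN : N = k ∨ a N = none := Nat.find_spec hex
    have hmin : ∀ i < N, ¬ (i = k ∨ a i = none) := fun i hi => Nat.find_min hex hi
    have hNk : N ≤ k := Nat.find_min' hex (Or.inl rfl)
    have hsome : ∀ i : Fin N, (a i).isSome := fun i => by
      have := hmin i i.2
      rw [Option.isSome_iff_ne_none]
      tauto
    have hpad : ∀ i, N ≤ i → i < k → a i = none := by
      intro i hi
      induction i, hi using Nat.le_induction with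
      | base =>
        intro hk'
        exact hN.resolve_left (by omega)
      | succ i hi ih =>
        intro hk'
        exact (h (i + 1) hk').2 (by omega) (ih (by omega))
    refine ⟨List.ofFn fun i : Fin N => (a i).get (hsome i), ?_, by simpa using hNk, fun j hj => ?_⟩
    · intro h0
      have h0 : N = 0 := by simpa using congrArg List.length h0
      exact (h 0 hk).1 rfl (hpad 0 (by omega) hk)
    · rw [List.getElem?_ofFn]
      split_ifs with hjN
      · simp
      · exact hpad j (by omega) hj
  · rintro ⟨u, hu, -, h⟩ i hi
    refine ⟨?_, fun hpos hn => ?_⟩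
    · rintro rfl
      rw [h 0 hk]
      simpa using hu
    · rw [h _ hi, List.getElem?_eq_none_iff]
      rw [h _ (by omega), List.getElem?_eq_none_iff] at hn
      omega

theorem reach_congr {A : Type} {D : Fin k → Layer A w} {a a' : ℕ → Option A} {j : ℕ}
    (h : ∀ i < j, a i = a' i) : reach D a j = reach D a' j := by
  induction j with
  | zero => rfl
  | succ j ih =>
    ext q
    simp only [reach, ih fun i hi => h i (by omega), h j (by omega)]

theorem mem_domState (hT : T.IsStructural) (hx : ∀ j : Fin k, x j = (paramCode s w V m φ, T.code j))
    (a : ℕ → Option (Fin s)) {j : ℕ} (hj : j ≤ k) :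
    (0 < j → ((domState x (fun i => dig (a i)) j).unpair.1 = 0 ↔ a (j - 1) = none)) ∧
    (∀ q ∈ ofNat (List ℕ) (domState x (fun i => dig (a i)) j).unpair.2, q < w) ∧
    ∀ q : Fin w, q.val ∈ ofNat (List ℕ) (domState x (fun i => dig (a i)) j).unpair.2 ↔
      q ∈ reach T.dom a j ∧ Proper a j := by
  induction j with
  | zero => simp [domState, iter, reach]
  | succ j ih =>
    obtain ⟨ih1, -, ih3⟩ := ih (by omega)
    have hD := hT.isODD_dom
    have hjk : j < k := hj
    have hxj := hx ⟨j, hjk⟩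
    simp only at hxj
    generalize hy : domState x (fun i => dig (a i)) j = y at ih1 ih3
    have hstep : domState x (fun i => dig (a i)) (j + 1) = domStep (x j) (dig (a j)) y := by
      rw [← hy]; rfl
    rw [hstep, domStep, hxj]
    simp only [Nat.unpair_pair, ofNat_encode, pWidth_paramCode, pSize_paramCode]
    refine ⟨fun _ => by simp, ?_, ?_⟩
    · intro q hq
      split_ifs at hq
      · exact lt_of_mem_post hq
      · simp at hq
    · intro q
      obtain ⟨r, hr⟩ : ∃ r, T.code ⟨j, hjk⟩ = (T.dom ⟨j, hjk⟩).code (List.finRange s) ++ r := ⟨_, rfl⟩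
      have hflag : (T.code ⟨j, hjk⟩).getD 0 false = (T.dom ⟨j, hjk⟩).initialFlag := by
        rw [hr]; exact (code_flags _ _ _).1
      have hpost := mem_post (List.finRange s) (T.dom ⟨j, hjk⟩) r (getElem?_dig (a j))
        (S := ofNat (List ℕ) y.unpair.2) q
      rw [List.length_finRange, ← hr] at hpost
      have hP : Proper a (j + 1) ↔ Proper a j ∧ ((j = 0 → a j ≠ none) ∧
          (0 < j → a (j - 1) = none → a j = none)) := by
        constructor
        · exact fun h => ⟨fun i hi => h i (by omega), h j (by omega)⟩
        · rintro ⟨h, h'⟩ i hi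
          rcases Nat.lt_succ_iff_lt_or_eq.1 hi with hi | rfl
          · exact h i hi
          · exact h'
      have hc : (bif (T.code ⟨j, hjk⟩).getD 0 false then !decide (dig (a j) = 0) else
          decide (dig (a j) = 0) || !decide (y.unpair.1 = 0)) = true ↔
          ((j = 0 → a j ≠ none) ∧ (0 < j → a (j - 1) = none → a j = none)) := by
        rw [hflag]
        rcases Nat.eq_zero_or_pos j with rfl | hpos
        · rw [(hD.initialFlag_iff ⟨0, hjk⟩).2 rfl]
          simp
        · have h0 : (T.dom ⟨j, hjk⟩).initialFlag = false := by
            rw [← Bool.not_eq_true, hD.initialFlag_iff]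
            exact hpos.ne'
          rw [h0, cond_false, Bool.or_eq_true, decide_eq_true_iff, Bool.not_eq_true',
            decide_eq_false_iff_not, dig_eq_zero, ih1 hpos]
          exact ⟨fun h => ⟨fun h' => absurd h' hpos.ne', fun _ hn => h.resolve_right (not_not.2 hn)⟩,
            fun h => or_iff_not_imp_right.2 fun hn => h.2 hpos (not_not.1 hn)⟩
      have hR : q ∈ reach T.dom a (j + 1) ↔ (∃ q' : Fin w, (q' ∈ reach T.dom a j ∨
          q' ∈ (T.dom ⟨j, hjk⟩).initial) ∧ (q', a j, q) ∈ (T.dom ⟨j, hjk⟩).trans) ∧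
          ((T.dom ⟨j, hjk⟩).finalFlag = true → q ∈ (T.dom ⟨j, hjk⟩).final) :=
        ⟨fun h => h.2, fun h => ⟨hjk, h⟩⟩
      rw [hR, hP]
      by_cases hcc : ((j = 0 → a j ≠ none) ∧ (0 < j → a (j - 1) = none → a j = none))
      · rw [if_pos (hc.2 hcc), hpost]
        simp only [ih3]
        by_cases hPj : Proper a j
        · simp only [hPj, and_true, and_iff_left hcc]
        · have hpos : 0 < j := by
            rcases Nat.eq_zero_or_pos j with rfl | h
            · exact (hPj fun i hi => absurd hi (Nat.not_lt_zero i)).elim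
            · exact h
          have h0 : (T.dom ⟨j, hjk⟩).initialFlag = false := by
            rw [← Bool.not_eq_true, hD.initialFlag_iff]
            exact hpos.ne'
          simp only [hPj, and_false, (T.dom ⟨j, hjk⟩).initial_eq_empty h0, Finset.notMem_empty,
            or_self, false_and, exists_false]
      · rw [if_neg (mt hc.1 hcc)]
        simp [hcc]

/-- The domain automaton accepts the padded strings of the domain. -/
theorem domAcc_iff (hT : T.IsStructural) (hx : ∀ j : Fin k, x j = (paramCode s w V m φ, T.code j))
    (a : ℕ → Option (Fin s)) : domAcc (domState x (fun i => dig (a i)) k) = true ↔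
      ∃ u ∈ oddLang T.dom, ∀ j < k, a j = u[j]? := by
  obtain ⟨-, h2, h3⟩ := mem_domState hT hx a le_rfl
  have hne : domAcc (domState x (fun i => dig (a i)) k) = true ↔
      (reach T.dom a k).Nonempty ∧ Proper a k := by
    simp only [domAcc, Bool.not_eq_true', decide_eq_false_iff_not]
    rw [← ne_eq, ofNat_list_ne_nil]
    constructor
    · intro h
      obtain ⟨q, hq⟩ := List.exists_mem_of_ne_nil _ h
      have := (h3 ⟨q, h2 q hq⟩).1 hq
      exact ⟨⟨_, this.1⟩, this.2⟩
    · rintro ⟨⟨q, hq⟩, hP⟩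
      exact List.ne_nil_of_mem ((h3 q).2 ⟨hq, hP⟩)
  rw [hne, proper_iff hT.isODD_dom.length_pos]
  constructor
  · rintro ⟨hr, u, hu, hlen, hau⟩
    refine ⟨u, ⟨hu, hlen, ?_⟩, hau⟩
    rwa [← reach_nonempty_iff hT.isODD_dom, ← reach_congr hau]
  · rintro ⟨u, ⟨hu, hlen, hacc⟩, hau⟩
    refine ⟨?_, u, hu, hlen, hau⟩
    rwa [reach_congr hau, reach_nonempty_iff hT.isODD_dom]

theorem length_tensor_le {a : ℕ} {u : Fin a → List (Fin s)} (h : ∀ i, (u i).length ≤ k) :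
    (tensor u).length ≤ k := by
  simpa [tensor] using h

theorem tensor_ne_nil {a : ℕ} (ha : 0 < a) {u : Fin a → List (Fin s)} (h : ∀ i, u i ≠ []) :
    tensor u ≠ [] := by
  intro h0
  have h1 : (tensor u).length = 0 := by rw [h0]; rfl
  rw [tensor, List.length_ofFn] at h1
  have h2 := Finset.le_sup (f := fun i => (u i).length) (Finset.mem_univ (⟨0, ha⟩ : Fin a))
  rw [h1] at h2
  exact h ⟨0, ha⟩ (List.eq_nil_of_length_eq_zero (Nat.le_zero.1 h2))

theorem tensor_getElem? {a : ℕ} (u : Fin a → List (Fin s)) (j : ℕ) :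
    (tensor u)[j]? = if ∀ i, (u i)[j]? = none then none else some fun i => (u i)[j]? := by
  have h : j < (Finset.univ.sup fun i => (u i).length) ↔ ¬ ∀ i, (u i)[j]? = none := by
    simp [Finset.lt_sup_iff]
  rw [tensor, List.getElem?_ofFn]
  by_cases hj : ∀ i, (u i)[j]? = none
  · rw [dif_neg (by rw [h]; exact not_not.2 hj), if_pos hj]
  · rw [dif_pos (h.2 hj), if_neg hj]

theorem mem_relState (hx : ∀ j : Fin k, x j = (paramCode s w V m φ, T.code j)) (i : Fin V.numRel)
    {vs : List ℕ} {e : ℕ → List ℕ} {u : Fin (V.arity i) → List (Fin s)}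
    (he : ∀ j < k, (vs.map fun v => (e j).getD v 0) = List.ofFn fun i => dig (u i)[j]?)
    {j : ℕ} (hj : j ≤ k) :
    (∀ q ∈ ofNat (List ℕ) (iter (fun j => relStep (x j) i vs (e j)) 0 j), q < w) ∧
    ∀ q : Fin w, q.val ∈ ofNat (List ℕ) (iter (fun j => relStep (x j) i vs (e j)) 0 j) ↔
      q ∈ reach (T.rel i) (fun j => (tensor u)[j]?) j := by
  induction j with
  | zero => simp [iter, reach]
  | succ j ih =>
    obtain ⟨-, ih⟩ := ih (by omega)
    have hjk : j < k := hj
    have hxj := hx ⟨j, hjk⟩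
    simp only at hxj
    have har : (List.ofFn V.arity).getD i 0 = V.arity i := by simp
    rw [iter]
    generalize iter (fun j => relStep (x j) i vs (e j)) 0 j = y at ih
    obtain ⟨r, hr⟩ := drop_relOffset φ T ⟨j, hjk⟩ i
    rw [relStep, hxj]
    simp only [ofNat_encode, pWidth_paramCode, pSize_paramCode, pArities_paramCode, har, hr, he j hjk]
    refine ⟨fun q => lt_of_mem_post, fun q => ?_⟩
    have hc : (none :: (allTuples (none :: (List.finRange s).map some) (V.arity i)).map some)[
        (if digitsVal s (List.ofFn fun i => dig (u i)[j]?) = 0 then 0 else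
          digitsVal s (List.ofFn fun i => dig (u i)[j]?) + 1)]? = some (tensor u)[j]? := by
      have h0 : digitsVal s (List.ofFn fun i => dig (u i)[j]?) = 0 ↔ ∀ i, (u i)[j]? = none := by
        simp only [digitsVal_eq_zero, List.mem_ofFn, forall_exists_index, forall_apply_eq_imp_iff,
          dig_eq_zero]
      rw [tensor_getElem?]
      by_cases hu : ∀ i, (u i)[j]? = none
      · rw [if_pos (h0.2 hu), if_pos hu]
        rfl
      · rw [if_neg (mt h0.1 hu), if_neg hu, List.getElem?_cons_succ, List.getElem?_map,
          getElem?_allTuples]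
        rfl
    have hpost := mem_post (allTuples (none :: (List.finRange s).map some) (V.arity i))
      (T.rel i ⟨j, hjk⟩) r hc (S := ofNat (List ℕ) y) q
    rw [length_allTuples, List.length_cons, List.length_map, List.length_finRange] at hpost
    rw [hpost]
    simp only [ih]
    exact ⟨fun h => ⟨hjk, h⟩, fun h => h.2⟩

/-- The automaton of an atomic formula accepts the tuples of strings in the relation. -/
theorem relState_ne_zero_iff (hT : T.IsStructural)
    (hx : ∀ j : Fin k, x j = (paramCode s w V m φ, T.code j)) (i : Fin V.numRel)
    {vs : List ℕ} {e : ℕ → List ℕ} {u : Fin (V.arity i) → List (Fin s)}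
    (he : ∀ j < k, (vs.map fun v => (e j).getD v 0) = List.ofFn fun i => dig (u i)[j]?)
    (hu : ∀ i, u i ∈ oddLang T.dom) :
    iter (fun j => relStep (x j) i vs (e j)) 0 k ≠ 0 ↔ tensor u ∈ oddLang (T.rel i) := by
  obtain ⟨h2, h3⟩ := mem_relState hx i he le_rfl
  have h : iter (fun j => relStep (x j) i vs (e j)) 0 k ≠ 0 ↔
      (reach (T.rel i) (fun j => (tensor u)[j]?) k).Nonempty := by
    rw [ofNat_list_ne_nil]
    constructor
    · intro h
      obtain ⟨q, hq⟩ := List.exists_mem_of_ne_nil _ h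
      exact ⟨_, (h3 ⟨q, h2 q hq⟩).1 hq⟩
    · rintro ⟨q, hq⟩
      exact List.ne_nil_of_mem ((h3 q).2 hq)
  rw [h, reach_nonempty_iff (hT.isODD_rel i)]
  exact ⟨fun h => ⟨tensor_ne_nil (V.arity_pos i) fun i => (hu i).1,
    length_tensor_le fun i => (hu i).2.1, h⟩, fun h => h.2.2⟩

end Automata

/-! ### The automata of formulas -/

theorem skips_getD (ar l : List ℕ) (i : ℕ) : (skips ar l).getD i 0 = skip ar (l.drop i) := by
  induction l generalizing i with
  | nil => simp [skips, skip]
  | cons t l ih =>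
    rcases i with _ | i
    · simp [skip, skips]
    · have h := ih i
      simp only [skips, List.getD_cons_succ, List.drop_succ_cons]
      exact h

theorem skip_formulaCode {V : RelVocab} {m n : ℕ} (ψ : V.lang.BoundedFormula (Fin m) n)
    (r : List ℕ) : skip (List.ofFn V.arity) (formulaCode ψ ++ r) = (formulaCode ψ).length := by
  induction ψ generalizing r with
  | falsum => rfl
  | equal => rfl
  | rel R ts =>
    obtain ⟨i, rfl⟩ := R
    simp [formulaCode, skip, skips]
    omega
  | imp φ ψ ih₁ ih₂ =>
    have h : skip (List.ofFn V.arity) (formulaCode (φ.imp ψ) ++ r) =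
        1 + (skip (List.ofFn V.arity) (formulaCode φ ++ (formulaCode ψ ++ r)) +
          skip (List.ofFn V.arity) ((formulaCode φ ++ (formulaCode ψ ++ r)).drop
            (skip (List.ofFn V.arity) (formulaCode φ ++ (formulaCode ψ ++ r))))) := by
      rw [← skips_getD]
      simp [formulaCode, skip, skips]
    rw [h, ih₁, List.drop_left, ih₂]
    simp [formulaCode]
    omega
  | all φ ih =>
    have h : skip (List.ofFn V.arity) (formulaCode φ.all ++ r) =
        1 + skip (List.ofFn V.arity) (formulaCode φ ++ r) := by
      simp [formulaCode, skip, skips]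
    rw [h, ih]
    simp [formulaCode]
    omega

theorem rest_formulaCode {V : RelVocab} {m n : ℕ} (ψ : V.lang.BoundedFormula (Fin m) n)
    (r : List ℕ) : rest (List.ofFn V.arity) (formulaCode ψ ++ r) = r := by
  rw [rest, skip_formulaCode, List.drop_left]

section Fuel

variable (d : ℕ) (ar l e : List ℕ) (x : LayerCtx) (y : ℕ)

theorem initCode_all : initCode (d + 1) (ar, 4 :: l) =
    encode [Nat.pair 0 (initCode d (ar, l))] := rfl

theorem stepCode_imp : stepCode (d + 1) (x, 3 :: l, e, y) =
    Nat.pair (stepCode d (x, l, e, y.unpair.1))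
      (stepCode d (x, rest (pArities x.1) l, e, y.unpair.2)) := rfl

theorem stepCode_all : stepCode (d + 1) (x, 4 :: l, e, y) = encode (nub
    ((ofNat (List ℕ) y).flatMap fun z => (List.range (pSize x.1 + 1)).map fun b =>
      Nat.pair (domStep x b z.unpair.1) (stepCode d (x, l, e ++ [b], z.unpair.2)))) := by
  have h {σ : Type} (f : ℕ → ℕ → σ) : ((ofNat (List ℕ) y).flatMap fun z =>
      (List.range (pSize x.1 + 1)).map fun b => f z b) =
      ((ofNat (List ℕ) y).flatMap fun z =>
        (List.range (pSize x.1 + 1)).map fun b => (z, b)).map fun z => f z.1 z.2 := by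
    simp [List.map_flatMap, Function.comp_def]
  have h' : stepCode (d + 1) (x, 4 :: l, e, y) = encode (nub ((List.zip
      ((ofNat (List ℕ) y).flatMap fun z => (List.range (pSize x.1 + 1)).map fun b =>
        domStep x b z.unpair.1)
      (((ofNat (List ℕ) y).flatMap fun z => (List.range (pSize x.1 + 1)).map fun b =>
        (x, l, e ++ [b], z.unpair.2)).map (stepCode d))).map fun y => Nat.pair y.1 y.2)) := rfl
  rw [h', h fun z b => domStep x b z.unpair.1, h fun z b => (x, l, e ++ [b], z.unpair.2),
    h fun z b => Nat.pair (domStep x b z.unpair.1) (stepCode d (x, l, e ++ [b], z.unpair.2)),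
    List.map_map, List.zip_map', List.map_map]
  rfl

theorem accCode_imp : accCode (d + 1) (ar, 3 :: l, y) =
    (!accCode d (ar, l, y.unpair.1) || accCode d (ar, rest ar l, y.unpair.2)) := rfl

theorem accCode_all : accCode (d + 1) (ar, 4 :: l, y) = (ofNat (List ℕ) y).all fun z =>
    !domAcc z.unpair.1 || accCode d (ar, l, z.unpair.2) := by
  have h : accCode (d + 1) (ar, 4 :: l, y) = ((ofNat (List ℕ) y).zip
      (((ofNat (List ℕ) y).map fun z => (ar, l, z.unpair.2)).map (accCode d))).all fun y =>
        !domAcc y.1.unpair.1 || y.2 := rfl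
  rw [h, List.map_map]
  generalize ofNat (List ℕ) y = L
  induction L with
  | nil => rfl
  | cons z L ih => simp only [List.map_cons, List.zip_cons_cons, List.all_cons, ih]; rfl

end Fuel

section Automata

variable {s w : ℕ} {V : RelVocab} {m : ℕ} {φ : V.lang.Formula (Fin m)} {k : ℕ}
  {T : LayerTuple (Fin s) w V k} {x : ℕ → LayerCtx}

theorem formulaState_imp {d : ℕ} {ar l : List ℕ} {e : ℕ → List ℕ} {j : ℕ}
    (hx : ∀ i < j, pArities (x i).1 = ar) :
    formulaState ar (d + 1) (3 :: l) x e j =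
      Nat.pair (formulaState ar d l x e j) (formulaState ar d (rest ar l) x e j) := by
  induction j with
  | zero => rfl
  | succ j ih =>
    have h := stepCode_imp d l (e j) (x j) (formulaState ar (d + 1) (3 :: l) x e j)
    rw [ih fun i hi => hx i (by omega), Nat.unpair_pair, hx j (by omega)] at h
    rw [← ih fun i hi => hx i (by omega)] at h
    exact h

theorem mem_formulaState_all (hx : ∀ j : Fin k, x j = (paramCode s w V m φ, T.code j)) {d : ℕ}
    {ar l : List ℕ} {e : ℕ → List ℕ} {j : ℕ} (hj : j ≤ k) (y : ℕ) :
    y ∈ ofNat (List ℕ) (formulaState ar (d + 1) (4 :: l) x e j) ↔ ∃ a : ℕ → Option (Fin s),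
      y = Nat.pair (domState x (fun i => dig (a i)) j)
        (formulaState ar d l x (fun i => e i ++ [dig (a i)]) j) := by
  induction j generalizing y with
  | zero => simp [formulaState, iter, initCode_all, domState]
  | succ j ih =>
    have h : formulaState ar (d + 1) (4 :: l) x e (j + 1) =
        stepCode (d + 1) (x j, 4 :: l, e j, formulaState ar (d + 1) (4 :: l) x e j) := rfl
    have hxj := hx ⟨j, hj⟩
    simp only at hxj
    have hs : pSize (x j).1 = s := by rw [hxj]; rfl
    rw [h, stepCode_all, ofNat_encode, mem_nub, hs]
    simp only [List.mem_flatMap, List.mem_map, List.mem_range, ih (by omega)]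
    constructor
    · rintro ⟨z, ⟨a, rfl⟩, b, hb, rfl⟩
      obtain ⟨o, rfl⟩ := exists_dig hb
      refine ⟨fun i => if i = j then o else a i, ?_⟩
      have h₁ : domState x (fun i => dig (if i = j then o else a i)) j =
          domState x (fun i => dig (a i)) j :=
        iter_congr fun i hi => by dsimp only; rw [if_neg (by omega)]
      have h₂ : formulaState ar d l x (fun i => e i ++ [dig (if i = j then o else a i)]) j =
          formulaState ar d l x (fun i => e i ++ [dig (a i)]) j :=
        iter_congr fun i hi => by dsimp only; rw [if_neg (by omega)]
      rw [Nat.unpair_pair, ← h₁, ← h₂]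
      simp only [domState, formulaState, iter, if_true]
    · rintro ⟨a, rfl⟩
      exact ⟨_, ⟨a, rfl⟩, dig (a j), dig_lt _, by rw [Nat.unpair_pair]; rfl⟩

/-- The strings assigned to all variables, in the order of their numbers. -/
def env {n : ℕ} (v : Fin m → T.Domain) (xs : Fin n → T.Domain) : List (List (Fin s)) :=
  List.ofFn (fun i => (v i).val) ++ List.ofFn fun i => (xs i).val

theorem env_snoc {n : ℕ} (v : Fin m → T.Domain) (xs : Fin n → T.Domain) (u : T.Domain) :
    env v (Fin.snoc xs u : Fin (n + 1) → T.Domain) = env v xs ++ [u.val] := by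
  rw [env, env, List.ofFn_succ']
  simp

theorem env_termCode {n : ℕ} (v : Fin m → T.Domain) (xs : Fin n → T.Domain)
    (t : V.lang.Term (Fin m ⊕ Fin n)) :
    (env v xs).getD (termCode t) [] = (t.realize (Sum.elim v xs)).val := by
  rcases t with (i | i) | f
  · simp [env, termCode, List.getElem?_append]
  · simp [env, termCode]
  · exact Empty.elim f

theorem getD_letters {n : ℕ} (v : Fin m → T.Domain) (xs : Fin n → T.Domain)
    (t : V.lang.Term (Fin m ⊕ Fin n)) (j : ℕ) :
    ((env v xs).map fun u => dig u[j]?).getD (termCode t) 0 =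
      dig (t.realize (Sum.elim v xs)).val[j]? := by
  rw [← env_termCode]
  have h : (0 : ℕ) = dig (([] : List (Fin s))[j]?) := by simp [dig]
  rw [h, List.getD_map]

theorem formulaState_equal {d c₁ c₂ : ℕ} {ar r : List ℕ} {e : ℕ → List ℕ} {j : ℕ} :
    formulaState ar (d + 1) (1 :: c₁ :: c₂ :: r) x e j = 0 ↔
      ∀ i < j, (e i).getD c₁ 0 = (e i).getD c₂ 0 := by
  induction j with
  | zero => simp [formulaState, iter, initCode, fuelRec]
  | succ j ih =>
    have h : formulaState ar (d + 1) (1 :: c₁ :: c₂ :: r) x e (j + 1) =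
        eqStep c₁ c₂ (e j) (formulaState ar (d + 1) (1 :: c₁ :: c₂ :: r) x e j) := rfl
    rw [h, eqStep]
    constructor
    · intro h' i hi
      have h0 : formulaState ar (d + 1) (1 :: c₁ :: c₂ :: r) x e j = 0 := by
        by_contra h0
        simp [h0] at h'
      rcases Nat.lt_succ_iff_lt_or_eq.1 hi with hi | rfl
      · exact ih.1 h0 i hi
      · by_contra h1
        rw [h0, if_pos rfl, if_neg h1] at h'
        exact one_ne_zero h'
    · intro h'
      rw [if_pos (ih.2 fun i hi => h' i (by omega)), if_pos (h' j (by omega))]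

/-- The automaton of a formula accepts the assignments that satisfy it. -/
theorem accCode_iff (hT : T.IsStructural) (hx : ∀ j : Fin k, x j = (paramCode s w V m φ, T.code j))
    {n : ℕ} (ψ : V.lang.BoundedFormula (Fin m) n) (v : Fin m → T.Domain) (xs : Fin n → T.Domain)
    {d : ℕ} (hd : (formulaCode ψ).length ≤ d) (r : List ℕ) {e : ℕ → List ℕ}
    (he : ∀ j < k, e j = (env v xs).map fun u => dig u[j]?) :
    accCode d (List.ofFn V.arity, formulaCode ψ ++ r,
      formulaState (List.ofFn V.arity) d (formulaCode ψ ++ r) x e k) = true ↔ ψ.Realize v xs := by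
  have har : ∀ i < k, pArities (x i).1 = List.ofFn V.arity := fun i hi => by
    have h := hx ⟨i, hi⟩
    simp only at h
    rw [h, pArities_paramCode]
  induction ψ generalizing d r e with
  | falsum =>
    rcases d with _ | d
    · simp [formulaCode] at hd
    · simp [formulaCode, accCode, fuelRec, FirstOrder.Language.BoundedFormula.Realize]
  | equal t₁ t₂ =>
    rcases d with _ | d
    · simp [formulaCode] at hd
    have h : accCode (d + 1) (List.ofFn V.arity, formulaCode (.equal t₁ t₂) ++ r,
        formulaState (List.ofFn V.arity) (d + 1) (formulaCode (.equal t₁ t₂) ++ r) x e k) =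
        decide (formulaState (List.ofFn V.arity) (d + 1)
          (1 :: termCode t₁ :: termCode t₂ :: r) x e k = 0) := rfl
    rw [h, decide_eq_true_iff, formulaState_equal]
    simp only [FirstOrder.Language.BoundedFormula.Realize]
    constructor
    · intro h
      refine Subtype.ext (List.ext_getElem? fun j => ?_)
      by_cases hj : j < k
      · have := h j hj
        rw [he j hj, getD_letters, getD_letters] at this
        exact dig_injective this
      · rw [List.getElem?_eq_none, List.getElem?_eq_none]
        · exact (t₂.realize (Sum.elim v xs)).2.2.1.trans (by omega)
        · exact (t₁.realize (Sum.elim v xs)).2.2.1.trans (by omega)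
    · intro h i hi
      rw [he i hi, getD_letters, getD_letters, h]
  | rel R ts =>
    rcases d with _ | d
    · simp [formulaCode] at hd
    obtain ⟨i, rfl⟩ := R
    have h : accCode (d + 1) (List.ofFn V.arity, formulaCode (.rel ⟨i, rfl⟩ ts) ++ r,
        formulaState (List.ofFn V.arity) (d + 1) (formulaCode (.rel ⟨i, rfl⟩ ts) ++ r) x e k) =
        !decide (formulaState (List.ofFn V.arity) (d + 1)
          (2 :: i.val :: ((List.ofFn fun j => termCode (ts j)) ++ r)) x e k = 0) := rfl
    have h' : formulaState (List.ofFn V.arity) (d + 1)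
        (2 :: i.val :: ((List.ofFn fun j => termCode (ts j)) ++ r)) x e k =
        iter (fun j => relStep (x j) i (List.ofFn fun j => termCode (ts j)) (e j)) 0 k := by
      refine iter_congr fun j hj => funext fun y => ?_
      have h'' : stepCode (d + 1) (x j, 2 :: i.val :: ((List.ofFn fun j => termCode (ts j)) ++ r),
          e j, y) = relStep (x j) i (((List.ofFn fun j => termCode (ts j)) ++ r).take
            ((pArities (x j).1).getD i 0)) (e j) y := rfl
      rw [h'', har j hj]
      congr 1
      simp
    rw [h, h', Bool.not_eq_true', decide_eq_false_iff_not, ← ne_eq,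
      relState_ne_zero_iff hT hx i (u := fun j => ((ts j).realize (Sum.elim v xs)).val)
        (fun j hj => ?_) fun j => ((ts j).realize (Sum.elim v xs)).2]
    · rfl
    · rw [he j hj, List.map_ofFn]
      congr 1
      funext c
      exact getD_letters v xs (ts c) j
  | imp ψ₁ ψ₂ ih₁ ih₂ =>
    rcases d with _ | d
    · simp [formulaCode] at hd
    have hl : formulaCode (ψ₁.imp ψ₂) ++ r = 3 :: (formulaCode ψ₁ ++ (formulaCode ψ₂ ++ r)) := by
      simp [formulaCode]
    simp only [formulaCode, List.length_cons, List.length_append] at hd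
    rw [hl, accCode_imp, formulaState_imp har, Nat.unpair_pair, rest_formulaCode, Bool.or_eq_true,
      Bool.not_eq_true', ← Bool.not_eq_true]
    have h₁ : _ ↔ _ := ih₁ xs (d := d) (by omega) (formulaCode ψ₂ ++ r) he
    have h₂ : _ ↔ _ := ih₂ xs (d := d) (by omega) r he
    rw [h₁, h₂,
      FirstOrder.Language.BoundedFormula.realize_imp]
    tauto
  | all ψ ih =>
    rcases d with _ | d
    · simp [formulaCode] at hd
    have hl : formulaCode ψ.all ++ r = 4 :: (formulaCode ψ ++ r) := by simp [formulaCode]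
    simp only [formulaCode, List.length_cons] at hd
    rw [hl, accCode_all, List.all_eq_true, FirstOrder.Language.BoundedFormula.realize_all]
    simp only [mem_formulaState_all hx le_rfl, forall_exists_index, forall_eq_apply_imp_iff,
      Nat.unpair_pair, Bool.or_eq_true, Bool.not_eq_true']
    have key : ∀ (a : ℕ → Option (Fin s)) (u : T.Domain), (∀ j < k, a j = u.val[j]?) →
        (accCode d (List.ofFn V.arity, formulaCode ψ ++ r, formulaState (List.ofFn V.arity) d
          (formulaCode ψ ++ r) x (fun i => e i ++ [dig (a i)]) k) = true ↔
            ψ.Realize v (Fin.snoc xs u)) := by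
      intro a u hau
      refine ih _ (by omega) r fun j hj => ?_
      rw [he j hj, env_snoc, hau j hj]
      simp
    constructor
    · intro h u
      have hacc := (domAcc_iff hT hx fun j => u.val[j]?).2 ⟨u.val, u.2, fun _ _ => rfl⟩
      refine (key _ u fun _ _ => rfl).1 ((h _).resolve_left ?_)
      rw [hacc]
      exact Bool.noConfusion
    · intro h a
      rcases hacc : domAcc (domState x (fun i => dig (a i)) k)
      · exact Or.inl rfl
      · obtain ⟨u, hu, hau⟩ := (domAcc_iff hT hx a).1 hacc
        exact Or.inr ((key a ⟨u, hu⟩ hau).2 (h ⟨u, hu⟩))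

end Automata

/-! ### Counting accepted words -/

theorem mem_allLists {n m : ℕ} {l : List ℕ} :
    l ∈ allLists n m ↔ l.length = m ∧ ∀ b ∈ l, b < n := by
  induction m generalizing l with
  | zero => simp +contextual [allLists]
  | succ m ih =>
    simp only [allLists, List.mem_flatMap, List.mem_range, List.mem_map, ih]
    rcases l with _ | ⟨b, l⟩
    · simp
    · simp
      tauto

theorem nodup_allLists (n m : ℕ) : (allLists n m).Nodup := by
  induction m with
  | zero => simp [allLists]
  | succ m ih =>
    refine List.nodup_flatMap.2 ⟨fun b _ => ih.map (List.cons_injective), ?_⟩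
    refine List.nodup_range.imp fun {b b'} h => ?_
    simp only [Function.onFun, List.disjoint_left, List.mem_map]
    rintro _ ⟨l, -, rfl⟩ ⟨l', -, h'⟩
    exact h (List.cons.inj h').1.symm

/-- All words with `j` letters from the list `A`. -/
def words {α : Type} (A : List α) : ℕ → List (List α)
  | 0 => [[]]
  | j + 1 => (words A j).flatMap fun ws => A.map fun e => ws ++ [e]

theorem mem_words {α : Type} {A : List α} {j : ℕ} {ws : List α} :
    ws ∈ words A j ↔ ws.length = j ∧ ∀ e ∈ ws, e ∈ A := by
  induction j generalizing ws with
  | zero => simp +contextual [words]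
  | succ j ih =>
    simp only [words, List.mem_flatMap, List.mem_map, ih]
    constructor
    · rintro ⟨ws, ⟨h, h'⟩, e, he, rfl⟩
      refine ⟨by simp [h], fun e' h'' => ?_⟩
      rcases List.mem_append.1 h'' with h'' | h''
      · exact h' _ h''
      · rw [List.mem_singleton.1 h'']
        exact he
    · rintro ⟨h, h'⟩
      have hne : ws ≠ [] := by rintro rfl; simp at h
      refine ⟨ws.dropLast, ⟨by simp [h], fun e he => h' e (List.dropLast_subset _ he)⟩,
        ws.getLast hne, h' _ (List.getLast_mem hne), List.dropLast_append_getLast hne⟩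

theorem nodup_words {α : Type} {A : List α} (hA : A.Nodup) (j : ℕ) : (words A j).Nodup := by
  induction j with
  | zero => simp [words]
  | succ j ih =>
    refine List.nodup_flatMap.2 ⟨fun ws _ => hA.map fun e e' h => ?_, ih.imp fun {ws ws'} h => ?_⟩
    · simpa using h
    · simp only [Function.onFun, List.disjoint_left, List.mem_map]
      rintro _ ⟨l, -, rfl⟩ ⟨l', -, h'⟩
      exact h (List.append_inj_left' h' rfl).symm

/-- The state reached by the counted automaton after `j` letters. -/
def topState (p : List ℕ) (x : ℕ → LayerCtx) (e : ℕ → List ℕ) : ℕ → ℕ :=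
  iter (fun j => topStep (x j) (e j)) (topInit p)

/-- The states reached by the counted automaton by all words of length `j`. -/
def stateList (p : List ℕ) (x : ℕ → LayerCtx) : ℕ → List ℕ
  | 0 => [topInit p]
  | j + 1 => (stateList p x j).flatMap (succs (x j))

theorem stateList_eq {p : List ℕ} {x : ℕ → LayerCtx} {A : List (List ℕ)} {j : ℕ}
    (hA : ∀ i < j, allLists (pSize (x i).1 + 1) (pVars (x i).1) = A) :
    stateList p x j = (words A j).map fun ws => topState p x (fun i => ws.getD i []) j := by
  induction j with
  | zero => rfl
  | succ j ih =>
    rw [stateList, ih fun i hi => hA i (by omega), words, List.flatMap_map, List.map_flatMap]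
    refine List.flatMap_congr fun ws hws => ?_
    rw [succs, hA j (by omega), List.map_map]
    refine List.map_congr_left fun e _ => ?_
    have hlen := (mem_words.1 hws).1
    have h1 : (ws ++ [e]).getD j [] = e := by simp [hlen]
    have h2 : topState p x (fun i => (ws ++ [e]).getD i []) j =
        topState p x (fun i => ws.getD i []) j := by
      refine iter_congr fun i hi => ?_
      simp [List.getElem?_append, hlen, hi]
    have h3 : topState p x (fun i => (ws ++ [e]).getD i []) (j + 1) =
        topStep (x j) ((ws ++ [e]).getD j []) (topState p x (fun i => (ws ++ [e]).getD i []) j) := rfl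
    rw [Function.comp_apply, h3, h2, h1]

section Automata

variable {s w : ℕ} {V : RelVocab} {m : ℕ} {φ : V.lang.Formula (Fin m)} {k : ℕ}
  {T : LayerTuple (Fin s) w V k} {x : ℕ → LayerCtx}

theorem topState_eq (hx : ∀ j : Fin k, x j = (paramCode s w V m φ, T.code j)) {e : ℕ → List ℕ}
    {j : ℕ} (hj : j ≤ k) : topState (paramCode s w V m φ) x e j =
      Nat.pair (encode ((List.range m).map fun i => domState x (fun j => (e j).getD i 0) j))
        (formulaState (List.ofFn V.arity) (formulaCode φ).length (formulaCode φ) x e j) := by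
  induction j with
  | zero =>
    rw [topState, iter, topInit, pVars_paramCode, pFormula_paramCode, pArities_paramCode]
    congr 2
    rw [List.eq_replicate_iff.2 ⟨List.length_map .. |>.trans List.length_range, ?_⟩]
    simp [domState, iter]
  | succ j ih =>
    have h : topState (paramCode s w V m φ) x e (j + 1) =
        topStep (x j) (e j) (topState (paramCode s w V m φ) x e j) := rfl
    have hxj := hx ⟨j, hj⟩
    simp only at hxj
    rw [h, ih (by omega), topStep, Nat.unpair_pair]
    have h1 : pVars (x j).1 = m := by rw [hxj]; simp
    have h2 : pFormula (x j).1 = formulaCode φ := by rw [hxj]; simp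
    rw [h1, h2, ofNat_encode]
    congr 2
    refine List.map_congr_left fun i hi => ?_
    rw [List.mem_range] at hi
    simp only [domState, iter]
    congr 1
    simp [hi]

theorem topAcc_topState_iff (hx : ∀ j : Fin k, x j = (paramCode s w V m φ, T.code j))
    {e : ℕ → List ℕ} : topAcc (paramCode s w V m φ) (topState (paramCode s w V m φ) x e k) = true ↔
      (∀ i < m, domAcc (domState x (fun j => (e j).getD i 0) k) = true) ∧
      accCode (formulaCode φ).length (List.ofFn V.arity, formulaCode φ,
        formulaState (List.ofFn V.arity) (formulaCode φ).length (formulaCode φ) x e k) = true := by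
  rw [topState_eq hx le_rfl, topAcc, pVars_paramCode, pFormula_paramCode, pArities_paramCode,
    Nat.unpair_pair, Bool.and_eq_true, List.all_eq_true, ofNat_encode]
  refine and_congr_left fun _ => forall_congr' fun i => ?_
  rw [List.mem_range]
  refine imp_congr_right fun hi => ?_
  simp [hi]

theorem topAcc_iff_realize (hT : T.IsStructural)
    (hx : ∀ j : Fin k, x j = (paramCode s w V m φ, T.code j)) {v : Fin m → T.Domain}
    {e : ℕ → List ℕ} (he : ∀ j < k, e j = List.ofFn fun i => dig (v i).val[j]?) :
    topAcc (paramCode s w V m φ) (topState (paramCode s w V m φ) x e k) = true ↔ φ.Realize v := by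
  have h := accCode_iff hT hx φ v default le_rfl [] (e := e) fun j hj => by
    rw [he j hj]
    simp [env, Function.comp_def]
  rw [List.append_nil] at h
  rw [topAcc_topState_iff hx, h, FirstOrder.Language.Formula.Realize, and_iff_right]
  intro i hi
  have h2 : domState x (fun j => (e j).getD i 0) k =
      domState x (fun j => dig (v ⟨i, hi⟩).val[j]?) k :=
    iter_congr fun j hj => by simp [he j hj, hi]
  rw [h2]
  exact (domAcc_iff hT hx _).2 ⟨_, (v ⟨i, hi⟩).2, fun _ _ => rfl⟩

theorem exists_of_topAcc (hT : T.IsStructural)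
    (hx : ∀ j : Fin k, x j = (paramCode s w V m φ, T.code j)) {e : ℕ → List ℕ}
    (he : ∀ j < k, e j ∈ allLists (s + 1) m)
    (h : topAcc (paramCode s w V m φ) (topState (paramCode s w V m φ) x e k) = true) :
    ∃ v : Fin m → T.Domain, ∀ j < k, e j = List.ofFn fun i => dig (v i).val[j]? := by
  have h1 := ((topAcc_topState_iff hx).1 h).1
  have h2 : ∀ i : Fin m, ∃ a : ℕ → Option (Fin s), ∀ j < k, dig (a j) = (e j).getD i 0 := by
    intro i
    have : ∀ j, ∃ o : Option (Fin s), j < k → dig o = (e j).getD i 0 := by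
      intro j
      by_cases hj : j < k
      · obtain ⟨hlen, hlt⟩ := mem_allLists.1 (he j hj)
        have hi : i.val < (e j).length := by rw [hlen]; exact i.2
        obtain ⟨o, ho⟩ := exists_dig (s := s) (hlt _ (List.getElem_mem hi))
        exact ⟨o, fun _ => by simp [ho, hi]⟩
      · exact ⟨none, fun h => absurd h hj⟩
    choose a ha using this
    exact ⟨a, ha⟩
  choose a ha using h2
  have h3 : ∀ i : Fin m, ∃ u ∈ oddLang T.dom, ∀ j < k, a i j = u[j]? := by
    intro i
    rw [← domAcc_iff hT hx, ← h1 i i.2]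
    congr 1
    exact iter_congr fun j hj => by
      dsimp only
      rw [ha i j hj]
  choose u hu hau using h3
  refine ⟨fun i => ⟨u i, hu i⟩, fun j hj => ?_⟩
  refine List.ext_getElem (by simp [(mem_allLists.1 (he j hj)).1]) fun i hi hi' => ?_
  have him : i < m := by simpa using hi'
  have := ha ⟨i, him⟩ j hj
  rw [hau ⟨i, him⟩ j hj] at this
  simp [this, hi]

/-- The number of satisfying assignments is the number of accepted words. -/
theorem countP_stateList (hT : T.IsStructural)
    (hx : ∀ j : Fin k, x j = (paramCode s w V m φ, T.code j)) :
    (stateList (paramCode s w V m φ) x k).countP (topAcc (paramCode s w V m φ)) = T.countSat φ := by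
  have hA : ∀ i < k, allLists (pSize (x i).1 + 1) (pVars (x i).1) = allLists (s + 1) m := by
    intro i hi
    have h := hx ⟨i, hi⟩
    simp only at h
    rw [h, pSize_paramCode, pVars_paramCode]
  rw [stateList_eq hA, List.countP_map, List.countP_eq_length_filter]
  set L := (words (allLists (s + 1) m) k).filter (topAcc (paramCode s w V m φ) ∘ fun ws =>
    topState (paramCode s w V m φ) x (fun i => ws.getD i []) k) with hL
  have hnd : L.Nodup := (nodup_words (nodup_allLists _ _) k).filter _
  have hmem (ws : List (List ℕ)) : ws ∈ L ↔ (ws.length = k ∧ ∀ e ∈ ws, e ∈ allLists (s + 1) m) ∧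
      topAcc (paramCode s w V m φ)
        (topState (paramCode s w V m φ) x (fun i => ws.getD i []) k) = true := by
    rw [hL, List.mem_filter, mem_words]
    rfl
  let W (v : Fin m → T.Domain) : List (List ℕ) :=
    List.ofFn fun j : Fin k => List.ofFn fun i => dig (v i).val[j.val]?
  have hW (v : Fin m → T.Domain) : ∀ j < k,
      (W v).getD j [] = List.ofFn fun i => dig (v i).val[j]? := fun j hj => by simp [W, hj]
  have hf (v : {v : Fin m → T.Domain // φ.Realize v}) : W v.val ∈ L.toFinset := by
    rw [List.mem_toFinset, hmem, topAcc_iff_realize hT hx (hW v.val)]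
    refine ⟨⟨by simp [W], fun e he => ?_⟩, v.2⟩
    obtain ⟨j, rfl⟩ := List.mem_ofFn.1 he
    refine mem_allLists.2 ⟨by simp, fun b hb => ?_⟩
    obtain ⟨i, rfl⟩ := List.mem_ofFn.1 hb
    exact dig_lt _
  have hbij : Function.Bijective fun v : {v : Fin m → T.Domain // φ.Realize v} =>
      (⟨W v.val, hf v⟩ : {ws // ws ∈ L.toFinset}) := by
    constructor
    · intro v v' h
      refine Subtype.ext (funext fun i => Subtype.ext (List.ext_getElem? fun j => ?_))
      by_cases hj : j < k
      · have h1 : (W v.val).getD j [] = (W v'.val).getD j [] := by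
          have h' : W v.val = W v'.val := congrArg Subtype.val h
          rw [h']
        rw [hW _ j hj, hW _ j hj] at h1
        exact dig_injective (congrFun (List.ofFn_injective h1) i)
      · rw [List.getElem?_eq_none, List.getElem?_eq_none]
        · exact (v'.val i).2.2.1.trans (by omega)
        · exact (v.val i).2.2.1.trans (by omega)
    · rintro ⟨ws, hws⟩
      obtain ⟨⟨hlen, hlets⟩, hacc⟩ := (hmem ws).1 (List.mem_toFinset.1 hws)
      obtain ⟨v, hv⟩ := exists_of_topAcc hT hx (fun j hj => by
        have hj' : j < ws.length := by omega
        simpa [hj'] using hlets _ (List.getElem_mem hj')) hacc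
      refine ⟨⟨v, (topAcc_iff_realize hT hx hv).1 hacc⟩, Subtype.ext ?_⟩
      refine List.ext_getElem (by simp [W, hlen]) fun j hj hj' => ?_
      dsimp only at hj'
      have := hv j (by omega)
      simp only [hj', List.getD_eq_getElem] at this
      simp [W, this]
  rw [LayerTuple.countSat, Nat.card_eq_of_bijective _ hbij, Nat.card_eq_fintype_card,
    Fintype.card_coe, List.toFinset_card_of_nodup hnd]

end Automata

/-! ### The program of the counting machine -/

/-- The states that occur an odd number of times in `T`. -/
def odds (T : List ℕ) : List ℕ := (nub T).filter fun z => decide (T.count z % 2 = 1)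

/-- Every state with half of its number of occurrences in `T`, rounded down. -/
def halves (T : List ℕ) : List ℕ := (nub T).flatMap fun z => List.replicate (T.count z / 2) z

/-- The list of numbers whose unary notations are concatenated. -/
def unaryDecode (l : List Bool) : List ℕ :=
  (l.foldl (fun (a : List ℕ × ℕ) b => if b = true then (a.1, a.2 + 1) else (a.1 ++ [a.2], 0))
    ([], 0)).1

/-- A control state: the mode, the parameters, the bits read so far, and the carry. The modes are:
reading the parameters (`0`), reading a layer (`1`), replacing the states by their successors (`2`),
moving the rows back (`3`), replacing the states by their contributions to the result (`4`), and
writing the result before (`5`) and after (`6`) its first digit. -/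
abbrev Ctl := ℕ × List ℕ × List Bool × List ℕ

/-- The instruction without pushes and output that reads from the given source. -/
abbrev Cmd.pop (src : Bool × Bool) : Cmd := ((false, false), (false, false), src)

/-- The instruction that pushes a value on the first work stack. -/
abbrev Cmd.pushA (src : Bool × Bool) : Cmd := ((true, false), (false, false), src)

/-- The instruction that pushes a value on the second work stack. -/
abbrev Cmd.pushB (src : Bool × Bool) : Cmd := ((false, true), (false, false), src)

/-- The instruction that outputs a bit. -/
abbrev Cmd.write (b : Bool) (src : Bool × Bool) : Cmd := ((false, false), (true, b), src)

/-- Reading the parameters. The response is `2` or `3` for a bit, and `1` for a separator. -/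
def actParams (r : ℕ) (c : Ctl) : Cmd × ℕ × Ctl :=
  if r = 0 then (Cmd.pop (true, true), 0, c)
  else if r = 1 then (Cmd.pushA (true, true), encode [topInit (unaryDecode c.2.2.1)] + 1,
    1, unaryDecode c.2.2.1, [], [])
  else (Cmd.pop (true, true), 0, 0, [], c.2.2.1 ++ [decide (r = 3)], [])

/-- Reading a layer. The response is `0` at the end of the input. -/
def actLayer (r : ℕ) (c : Ctl) : Cmd × ℕ × Ctl :=
  if r = 0 then (Cmd.pop (true, false), 0, 4, c.2.1, c.2.2.1, [])
  else if r = 1 then (Cmd.pop (true, false), 0, 2, c.2.1, c.2.2.1, [])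
  else (Cmd.pop (true, true), 0, 1, c.2.1,
    if c.2.2.1.length < layerLen c.2.1 then c.2.2.1 ++ [decide (r = 3)] else c.2.2.1, [])

/-- The contributions of a state in the modes `2` and `4`. -/
def images (c : Ctl) (z : ℕ) : List ℕ :=
  if c.1 = 2 then succs (c.2.1, c.2.2.1) z else if topAcc c.2.1 z = true then [0] else []

/-- The carry together with the contributions of the states in the row with code `r - 1`. -/
def summands (r : ℕ) (c : Ctl) : List ℕ :=
  c.2.2.2 ++ if r = 0 then [] else (ofNat (List ℕ) (r - 1)).flatMap (images c)

/-- Replacing the states in a row by their contributions. -/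
def actPass (r : ℕ) (c : Ctl) : Cmd × ℕ × Ctl :=
  if r = 0 ∧ c.2.2.2 = [] then (Cmd.pop (false, true), 0, c.1 + 1, c.2)
  else (Cmd.pushB (true, false), encode (odds (summands r c)) + 1,
    c.1, c.2.1, c.2.2.1, halves (summands r c))

/-- Moving a row back to the first stack. -/
def actBack (r : ℕ) (c : Ctl) : Cmd × ℕ × Ctl :=
  if r = 0 then (Cmd.pop (true, true), 0, 1, c.2.1, [], [])
  else (Cmd.pushA (false, true), r, c)

/-- Writing a digit of the result. In mode `5` leading zeros are skipped. -/
def actWrite (r : ℕ) (c : Ctl) : Cmd × ℕ × Ctl :=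
  if r = 0 then (Cmd.pop (false, false), 0, c)
  else if r = 1 ∧ c.1 = 5 then (Cmd.pop (false, true), 0, c)
  else (Cmd.write (!decide (r = 1)) (false, true), 0, 6, c.2)

/-- The reaction of the counting machine to a response. -/
def act (r : ℕ) (c : Ctl) : Cmd × ℕ × Ctl :=
  if c.1 = 0 then actParams r c else if c.1 = 1 then actLayer r c
  else if c.1 = 2 then actPass r c else if c.1 = 3 then actBack r c
  else if c.1 = 4 then actPass r c else actWrite r c

/-- The control state with a given number. -/
def ctlOf (q : ℕ) : Ctl := (decode (α := Ctl) q).getD (0, [], [], [])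

/-- The program of the counting machine. -/
def counter : Program := fun r q =>
  ((act r (ctlOf q)).1, (act r (ctlOf q)).2.1, encode (act r (ctlOf q)).2.2)

@[simp] theorem ctlOf_encode (c : Ctl) : ctlOf (encode c) = c := by simp [ctlOf]

theorem encode_start : encode ((0, [], [], []) : Ctl) = 0 := by
  simp [Encodable.encode_prod_val]
  rfl

section Primrec

variable {α : Type} [Primcodable α]

theorem primrec_count {f : α → List ℕ} {g : α → ℕ} (hf : Primrec f) (hg : Primrec g) :
    Primrec fun a => (f a).count (g a) := by
  refine (Primrec.list_length.comp (primrec_filter hf (p := fun a b => decide (b = g a))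
    (primrec_decide_eq .snd (hg.comp .fst)))).of_eq fun a => ?_
  rw [List.count_eq_countP, List.countP_eq_length_filter]
  congr 1

theorem primrec_odds {f : α → List ℕ} (hf : Primrec f) : Primrec fun a => odds (f a) :=
  primrec_filter (primrec_nub hf)
    (primrec_decide_eq (Primrec.nat_mod.comp (primrec_count (hf.comp .fst) .snd) (.const 2))
      (.const 1))

theorem primrec_replicate {f g : α → ℕ} (hf : Primrec f) (hg : Primrec g) :
    Primrec fun a => List.replicate (f a) (g a) :=
  (Primrec.list_map (Primrec.list_range.comp hf) (hg.comp .fst).to₂).of_eq fun a => by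
    simp [List.map_const']

theorem primrec_halves {f : α → List ℕ} (hf : Primrec f) : Primrec fun a => halves (f a) :=
  Primrec.list_flatMap (primrec_nub hf) (primrec_replicate (Primrec.nat_div.comp
    (primrec_count (hf.comp .fst) .snd) (.const 2)) .snd).to₂

theorem primrec_unaryDecode : Primrec unaryDecode := by
  refine Primrec.fst.comp (Primrec.list_foldl (f := fun l : List Bool => l)
    (h := fun _ (a : (List ℕ × ℕ) × Bool) =>
      if a.2 = true then (a.1.1, a.1.2 + 1) else (a.1.1 ++ [a.1.2], 0)) .id (.const ([], 0)) ?_)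
  have h1 : Primrec fun a : List Bool × (List ℕ × ℕ) × Bool => a.2.1.1 :=
    Primrec.fst.comp (Primrec.fst.comp .snd)
  have h2 : Primrec fun a : List Bool × (List ℕ × ℕ) × Bool => a.2.1.2 :=
    Primrec.snd.comp (Primrec.fst.comp .snd)
  exact Primrec.ite (Primrec.eq.comp (Primrec.snd.comp .snd) (.const true))
    (h1.pair (Primrec.succ.comp h2)) ((Primrec.list_append.comp h1
      (Primrec.list_cons.comp h2 (.const []))).pair (.const 0))

variable {r : α → ℕ} {c : α → Ctl}

theorem primrec_actParams (hr : Primrec r) (hc : Primrec c) :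
    Primrec fun a => actParams (r a) (c a) := by
  have hb : Primrec fun a => (c a).2.2.1 := Primrec.fst.comp (Primrec.snd.comp (Primrec.snd.comp hc))
  have hu : Primrec fun a => unaryDecode (c a).2.2.1 := primrec_unaryDecode.comp hb
  have hv : Primrec fun a => encode [topInit (unaryDecode (c a).2.2.1)] + 1 :=
    Primrec.succ.comp (Primrec.encode.comp
      (Primrec.list_cons.comp (primrec_topInit.comp hu) (.const [])))
  unfold actParams
  exact primrec_ite_eq hr (.const 0) (.pair (.const _) (.pair (.const _) hc))
    (primrec_ite_eq hr (.const 1) (.pair (.const _) (.pair hv (.pair (.const _)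
      (.pair hu (.const _)))))
      (.pair (.const _) (.pair (.const _) (.pair (.const _) (.pair (.const _) (.pair
        (Primrec.list_append.comp hb (Primrec.list_cons.comp (primrec_decide_eq hr (.const 3))
          (.const []))) (.const _)))))))

theorem primrec_actLayer (hr : Primrec r) (hc : Primrec c) :
    Primrec fun a => actLayer (r a) (c a) := by
  have hp : Primrec fun a => (c a).2.1 := Primrec.fst.comp (Primrec.snd.comp hc)
  have hb : Primrec fun a => (c a).2.2.1 := Primrec.fst.comp (Primrec.snd.comp (Primrec.snd.comp hc))
  have hl : Primrec fun a => if (c a).2.2.1.length < layerLen (c a).2.1 then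
      (c a).2.2.1 ++ [decide (r a = 3)] else (c a).2.2.1 :=
    Primrec.ite (Primrec.nat_lt.comp (Primrec.list_length.comp hb) (primrec_layerLen.comp hp))
      (Primrec.list_append.comp hb (Primrec.list_cons.comp (primrec_decide_eq hr (.const 3))
        (.const []))) hb
  unfold actLayer
  exact primrec_ite_eq hr (.const 0)
    (.pair (.const _) (.pair (.const _) (.pair (.const _) (.pair hp (.pair hb (.const _))))))
    (primrec_ite_eq hr (.const 1)
      (.pair (.const _) (.pair (.const _) (.pair (.const _) (.pair hp (.pair hb (.const _))))))
      (.pair (.const _) (.pair (.const _) (.pair (.const _) (.pair hp (.pair hl (.const _)))))))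

theorem primrec_summands (hr : Primrec r) (hc : Primrec c) :
    Primrec fun a => summands (r a) (c a) := by
  have hp : Primrec fun a => (c a).2.1 := Primrec.fst.comp (Primrec.snd.comp hc)
  have hb : Primrec fun a => (c a).2.2.1 := Primrec.fst.comp (Primrec.snd.comp (Primrec.snd.comp hc))
  have hC : Primrec fun a => (c a).2.2.2 := Primrec.snd.comp (Primrec.snd.comp (Primrec.snd.comp hc))
  have hi : Primrec fun x : α × ℕ => images (c x.1) x.2 := by
    have hs : Primrec fun x : α × ℕ => succs ((c x.1).2.1, (c x.1).2.2.1) x.2 :=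
      primrec_succs.comp ((hp.comp .fst).pair (hb.comp .fst)) .snd
    have ht : Primrec fun x : α × ℕ => topAcc (c x.1).2.1 x.2 :=
      primrec_topAcc.comp (hp.comp .fst) .snd
    exact primrec_ite_eq (Primrec.fst.comp (hc.comp .fst)) (.const 2) hs
      (Primrec.ite (Primrec.eq.comp ht (.const true)) (.const [0]) (.const []))
  unfold summands
  exact Primrec.list_append.comp hC (primrec_ite_eq hr (.const 0) (.const [])
    (Primrec.list_flatMap ((Primrec.ofNat _).comp (Primrec.nat_sub.comp hr (.const 1))) hi.to₂))

theorem primrec_actPass (hr : Primrec r) (hc : Primrec c) :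
    Primrec fun a => actPass (r a) (c a) := by
  have hm : Primrec fun a => (c a).1 := Primrec.fst.comp hc
  have ht : Primrec fun a => (c a).2 := Primrec.snd.comp hc
  have hp : Primrec fun a => (c a).2.1 := Primrec.fst.comp ht
  have hb : Primrec fun a => (c a).2.2.1 := Primrec.fst.comp (Primrec.snd.comp ht)
  have hC : Primrec fun a => (c a).2.2.2 := Primrec.snd.comp (Primrec.snd.comp ht)
  have hs := primrec_summands hr hc
  unfold actPass
  exact Primrec.ite (PrimrecPred.and (Primrec.eq.comp hr (.const 0))
      (Primrec.eq.comp hC (.const [])))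
    (.pair (.const _) (.pair (.const _) (.pair (Primrec.succ.comp hm) ht)))
    (.pair (.const _) (.pair (Primrec.succ.comp (Primrec.encode.comp (primrec_odds hs)))
      (.pair hm (.pair hp (.pair hb (primrec_halves hs))))))

theorem primrec_actBack (hr : Primrec r) (hc : Primrec c) :
    Primrec fun a => actBack (r a) (c a) := by
  have hp : Primrec fun a => (c a).2.1 := Primrec.fst.comp (Primrec.snd.comp hc)
  unfold actBack
  exact primrec_ite_eq hr (.const 0)
    (.pair (.const _) (.pair (.const _) (.pair (.const _) (.pair hp (.const _)))))
    (.pair (.const _) (.pair hr hc))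

theorem primrec_actWrite (hr : Primrec r) (hc : Primrec c) :
    Primrec fun a => actWrite (r a) (c a) := by
  have hd : Primrec fun a => (!decide (r a = 1)) := Primrec.not.comp (primrec_decide_eq hr (.const 1))
  unfold actWrite
  exact primrec_ite_eq hr (.const 0) (.pair (.const _) (.pair (.const _) hc))
    (Primrec.ite (PrimrecPred.and (Primrec.eq.comp hr (.const 1))
      (Primrec.eq.comp (Primrec.fst.comp hc) (.const 5)))
      (.pair (.const _) (.pair (.const _) hc))
      (.pair (.pair (.const _) (.pair (.pair (.const _) hd) (.const _)))
        (.pair (.const _) (.pair (.const _) (Primrec.snd.comp hc)))))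

theorem primrec_act (hr : Primrec r) (hc : Primrec c) : Primrec fun a => act (r a) (c a) := by
  have hm : Primrec fun a => (c a).1 := Primrec.fst.comp hc
  unfold act
  exact primrec_ite_eq hm (.const 0) (primrec_actParams hr hc)
    (primrec_ite_eq hm (.const 1) (primrec_actLayer hr hc)
    (primrec_ite_eq hm (.const 2) (primrec_actPass hr hc)
    (primrec_ite_eq hm (.const 3) (primrec_actBack hr hc)
    (primrec_ite_eq hm (.const 4) (primrec_actPass hr hc) (primrec_actWrite hr hc)))))

theorem primrec_counter : Primrec₂ counter := by
  have hc : Primrec fun x : ℕ × ℕ => ctlOf x.2 :=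
    Primrec.option_getD.comp (Primrec.decode.comp .snd) (.const _)
  have ha := primrec_act (r := fun x : ℕ × ℕ => x.1) .fst hc
  exact Primrec.pair (Primrec.fst.comp ha) (.pair (Primrec.fst.comp (Primrec.snd.comp ha))
    (Primrec.encode.comp (Primrec.snd.comp (Primrec.snd.comp ha))))

end Primrec

/-! ### Rows of states as binary numbers -/

theorem sum_map_nub (T : List ℕ) (g : ℕ → ℕ) :
    ((nub T).map fun z => T.count z * g z).sum = (T.map g).sum := by
  classical
  rw [Finset.sum_list_map_count T g, ← List.sum_toFinset _ (nodup_nub T)]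
  refine Finset.sum_congr (by ext; simp) fun z _ => by rw [smul_eq_mul]

theorem sum_odds_add_sum_halves (T : List ℕ) (g : ℕ → ℕ) :
    ((odds T).map g).sum + 2 * ((halves T).map g).sum = (T.map g).sum := by
  rw [← sum_map_nub T g, odds, halves]
  induction nub T with
  | nil => rfl
  | cons z l ih =>
    rw [List.map_cons, List.sum_cons, ← ih, List.filter_cons, List.flatMap_cons, List.map_append,
      List.sum_append]
    have h := Nat.div_add_mod (T.count z) 2
    have h' : (List.map g (List.replicate (T.count z / 2) z)).sum = T.count z / 2 * g z := by simp
    rw [h']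
    rcases Nat.mod_two_eq_zero_or_one (T.count z) with h0 | h0
    · simp only [h0, zero_ne_one, decide_false, Bool.false_eq_true, if_false]
      generalize T.count z / 2 = y at h
      rw [← h, h0]
      ring
    · simp only [h0, decide_true, if_true, List.map_cons, List.sum_cons]
      generalize T.count z / 2 = y at h
      rw [← h, h0]
      ring

theorem sum_map_flatMap (l : List ℕ) (f : ℕ → List ℕ) (g : ℕ → ℕ) :
    ((l.flatMap f).map g).sum = (l.map fun z => ((f z).map g).sum).sum := by
  induction l with
  | nil => rfl
  | cons z l ih => simp [ih]

theorem length_halves_le (T : List ℕ) : 2 * (halves T).length ≤ T.length := by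
  have h := sum_odds_add_sum_halves T fun _ => 1
  simp only [List.map_const', List.sum_replicate, smul_eq_mul, mul_one] at h
  omega

theorem nodup_odds (T : List ℕ) : (odds T).Nodup := (nodup_nub T).filter _

theorem mem_of_mem_odds {T : List ℕ} {z : ℕ} (h : z ∈ odds T) : z ∈ T :=
  mem_nub.1 (List.mem_filter.1 h).1

theorem mem_of_mem_halves {T : List ℕ} {z : ℕ} (h : z ∈ halves T) : z ∈ T := by
  obtain ⟨y, hy, h⟩ := List.mem_flatMap.1 h
  rw [List.eq_of_mem_replicate h]
  exact mem_nub.1 hy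

theorem length_odds_le_one {T : List ℕ} (h : ∀ z ∈ T, z = 0) : (odds T).length ≤ 1 := by
  have h' : odds T ⊆ [0] := fun z hz => by simpa using h z (mem_of_mem_odds hz)
  exact ((nodup_odds T).subperm h').length_le

/-- The `i`-th row consists of the states `z` for which the `i`-th binary digit of the number of
`z` is one. The value of the rows is the sum of the numbers `g z` over all states `z`, each taken as
many times as its number says. -/
def value (g : ℕ → ℕ) : List (List ℕ) → ℕ
  | [] => 0
  | row :: rows => (row.map g).sum + 2 * value g rows

theorem value_append (g : ℕ → ℕ) (R R' : List (List ℕ)) :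
    value g (R ++ R') = value g R + 2 ^ R.length * value g R' := by
  induction R with
  | nil => simp [value]
  | cons row R ih =>
    rw [List.cons_append, value, value, ih, List.length_cons]
    ring

/-- Rows as numbers on a work stack. They are not zero, which is the response of an empty stack. -/
def codes (R : List (List ℕ)) : List ℕ := R.map fun row => encode row + 1

/-! ### Runs of the counting machine -/

/-- The counting machine leads from `c` to `c'` in `n` steps. -/
abbrev Steps (n : ℕ) (c c' : Conf) : Prop := Run counter (fun _ _ => True) n c c'

/-- The configuration after a read from the input `inp`. -/
def afterRead (q : Ctl) (inp : List (Option Bool)) (A B : List ℕ) (o : List Bool) : Conf :=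
  ⟨symCode inp.head?, encode q, inp.tail, A, B, o⟩

/-- The configuration after a read from the first stack `A`. -/
def afterPopA (q : Ctl) (inp : List (Option Bool)) (A B : List ℕ) (o : List Bool) : Conf :=
  ⟨A.headD 0, encode q, inp, A.tail, B, o⟩

/-- The configuration after a read from the second stack `B`. -/
def afterPopB (q : Ctl) (inp : List (Option Bool)) (A B : List ℕ) (o : List Bool) : Conf :=
  ⟨B.headD 0, encode q, inp, A, B.tail, o⟩

theorem run_one {P : ℕ → ℕ → Prop} {r : ℕ} {q q' : Ctl} {inp : List (Option Bool)}
    {A B : List ℕ} {o : List Bool} {x : Cmd} {v : ℕ} (hP : P r (encode q))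
    (h : act r q = (x, v, q')) (hx : x.2.2 ≠ (false, false)) :
    Run counter P 1 ⟨r, encode q, inp, A, B, o⟩ (Conf.pop ⟨r, encode q', inp,
      if x.1.1 then v :: A else A, if !x.1.1 && x.1.2 then v :: B else B,
      if x.2.1.1 then x.2.1.2 :: o else o⟩ x.2.2) := by
  have hF : counter r (encode q) = (x, v, encode q') := by rw [counter, ctlOf_encode, h]
  refine .head hP ?_ ?_
  · rw [Conf.Halting, hF]
    exact hx
  · rw [Conf.next, hF, Conf.push]
    exact .refl _

theorem steps_one {r : ℕ} {q q' : Ctl} {inp : List (Option Bool)} {A B : List ℕ} {o : List Bool}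
    {x : Cmd} {v : ℕ} (h : act r q = (x, v, q')) (hx : x.2.2 ≠ (false, false)) :
    Steps 1 ⟨r, encode q, inp, A, B, o⟩ (Conf.pop ⟨r, encode q', inp,
      if x.1.1 then v :: A else A, if !x.1.1 && x.1.2 then v :: B else B,
      if x.2.1.1 then x.2.1.2 :: o else o⟩ x.2.2) := run_one trivial h hx

theorem symCode_lt (s : Option (Option Bool)) : symCode s < 4 := by
  rcases s with _ | _ | _ | _ <;> decide

section Phases

variable {p : List ℕ} {inp : List (Option Bool)} {A B : List ℕ} {o : List Bool}

theorem run_params_bits {P : ℕ → ℕ → Prop} (l b : List Bool)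
    (hP : ∀ r < 4, ∀ i ≤ (b ++ l).length, P r (encode ((0, [], (b ++ l).take i, []) : Ctl))) :
    Run counter P l.length (afterRead (0, [], b, []) (l.map some ++ inp) A B o)
      (afterRead (0, [], b ++ l, []) inp A B o) := by
  induction l generalizing b with
  | nil => simpa using Run.refl _
  | cons x l ih =>
    have h : act (symCode (some (some x))) (0, [], b, []) =
        (Cmd.pop (true, true), 0, 0, [], b ++ [x], []) := by cases x <;> rfl
    have h' := ih (b ++ [x]) (by simpa using hP)
    rw [List.append_assoc] at h'
    rw [List.length_cons, Nat.add_comm]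
    have h0 := hP _ (symCode_lt (some (some x))) b.length (by simp)
    rw [List.take_left] at h0
    exact (run_one h0 h (by simp)).trans h'

theorem unaryDecode_flatMap (l : List ℕ) : unaryDecode (l.flatMap unary) = l := by
  have h1 (n i : ℕ) (a : List ℕ) : (List.replicate n true).foldl (fun (a : List ℕ × ℕ) b =>
      if b = true then (a.1, a.2 + 1) else (a.1 ++ [a.2], 0)) (a, i) = (a, i + n) := by
    induction n generalizing i with
    | zero => rfl
    | succ n ih =>
      rw [List.replicate_succ, List.foldl_cons, if_pos rfl, ih]
      simp only [Prod.mk.injEq, true_and]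
      omega
  have h2 (a : List ℕ) : (l.flatMap unary).foldl (fun (a : List ℕ × ℕ) b =>
      if b = true then (a.1, a.2 + 1) else (a.1 ++ [a.2], 0)) (a, 0) = (a ++ l, 0) := by
    induction l generalizing a with
    | nil => simp
    | cons n l ih =>
      rw [List.flatMap_cons, List.foldl_append, unary, List.foldl_append, h1, List.foldl_cons,
        List.foldl_nil, if_neg (by simp), ih]
      simp
  rw [unaryDecode, h2]
  rfl

theorem run_params {P : ℕ → ℕ → Prop} (hP : ∀ r < 4, ∀ i ≤ (p.flatMap unary).length,
      P r (encode ((0, [], (p.flatMap unary).take i, []) : Ctl))) :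
    Run counter P ((p.flatMap unary).length + 2)
      ⟨0, 0, (p.flatMap unary).map some ++ none :: inp, A, B, o⟩
      (afterRead (1, p, [], []) inp (codes [[topInit p]] ++ A) B o) := by
  have h0 : act 0 (0, [], [], []) = (Cmd.pop (true, true), 0, 0, [], [], []) := rfl
  have h1 : act (symCode (some none)) (0, [], p.flatMap unary, []) =
      (Cmd.pushA (true, true), encode [topInit p] + 1, 1, p, [], []) := by
    have : act (symCode (some none)) (0, [], p.flatMap unary, []) =
      (Cmd.pushA (true, true), encode [topInit (unaryDecode (p.flatMap unary))] + 1,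
        1, unaryDecode (p.flatMap unary), [], []) := rfl
    rw [this, unaryDecode_flatMap]
  have s0 : Run counter P 1 ⟨0, 0, (p.flatMap unary).map some ++ none :: inp, A, B, o⟩
      (afterRead (0, [], [], []) ((p.flatMap unary).map some ++ none :: inp) A B o) := by
    have := run_one (P := P) (inp := (p.flatMap unary).map some ++ none :: inp) (A := A) (B := B)
      (o := o) (hP 0 (by norm_num) 0 (Nat.zero_le _)) h0 (by simp)
    rw [encode_start] at this
    rwa [afterRead, encode_start]
  have s1 := run_params_bits (P := P) (inp := none :: inp) (A := A) (B := B) (o := o)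
    (p.flatMap unary) [] hP
  have hlast := hP _ (symCode_lt (some none)) _ le_rfl
  rw [List.take_length] at hlast
  have s2 : Run counter P 1 (afterRead (0, [], p.flatMap unary, []) (none :: inp) A B o)
      (afterRead (1, p, [], []) inp (codes [[topInit p]] ++ A) B o) :=
    run_one hlast h1 (by simp)
  have := (s0.trans s1).trans s2
  rwa [show 1 + (p.flatMap unary).length + 1 = (p.flatMap unary).length + 2 by omega] at this

theorem steps_layer_bits (l b : List Bool) (h : (b ++ l).length ≤ layerLen p) :
    Steps l.length (afterRead (1, p, b, []) (l.map some ++ inp) A B o)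
      (afterRead (1, p, b ++ l, []) inp A B o) := by
  induction l generalizing b with
  | nil => simpa using Run.refl _
  | cons x l ih =>
    rw [List.length_append, List.length_cons] at h
    have h0 : b.length < layerLen p := by omega
    have h1 : act (symCode (some (some x))) (1, p, b, []) =
        (Cmd.pop (true, true), 0, 1, p, b ++ [x], []) := by
      cases x <;> simp [act, actLayer, symCode, h0]
    have h' := ih (b ++ [x]) (by simp; omega)
    rw [List.append_assoc] at h'
    rw [List.length_cons, Nat.add_comm]
    exact (steps_one h1 (by simp)).trans h'

theorem act_pass {μ r : ℕ} {c : List ℕ × List Bool × List ℕ} (hμ : μ = 2 ∨ μ = 4) :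
    act r (μ, c) = actPass r (μ, c) := by
  rcases hμ with rfl | rfl <;> rfl

theorem steps_pass_rows {μ : ℕ} (hμ : μ = 2 ∨ μ = 4) (b : List Bool) (R : List (List ℕ))
    (C B : List ℕ) : ∃ O C', O.length = R.length ∧
      Steps R.length (afterPopA (μ, p, b, C) inp (codes R) B o)
        (afterPopA (μ, p, b, C') inp [] (codes O.reverse ++ B) o) ∧
      (∀ g, value g O + 2 ^ O.length * (C'.map g).sum =
        (C.map g).sum + value (fun z => ((images (μ, p, b, C) z).map g).sum) R) ∧
      (μ = 4 → (∀ z ∈ C, z = 0) → (∀ row ∈ O, row.length ≤ 1) ∧ ∀ z ∈ C', z = 0) := by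
  induction R generalizing C B with
  | nil => exact ⟨[], C, rfl, .refl _, fun g => by simp [value], fun _ h => by simpa using h⟩
  | cons row R ih =>
    set T := C ++ row.flatMap (images (μ, p, b, C)) with hT
    obtain ⟨O, C', hO, hS, hV, hQ⟩ := ih (halves T) (codes [odds T] ++ B)
    have hsum : summands (encode row + 1) (μ, p, b, C) = T := by
      simp [summands, hT]
    have hact : act (encode row + 1) (μ, p, b, C) =
        (Cmd.pushB (true, false), encode (odds T) + 1, μ, p, b, halves T) := by
      rw [act_pass hμ, actPass, if_neg (by simp), hsum]
    refine ⟨odds T :: O, C', by simp [hO], ?_, fun g => ?_, fun h4 hC => ?_⟩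
    · have s := steps_one (inp := inp) (A := codes R) (B := B) (o := o) hact (by simp)
      have e : codes (odds T :: O).reverse ++ B = codes O.reverse ++ (codes [odds T] ++ B) := by
        simp [codes]
      rw [e, List.length_cons, Nat.add_comm]
      exact Run.trans s hS
    · have h1 := hV g
      have h2 := sum_odds_add_sum_halves T g
      have h3 : (T.map g).sum = (C.map g).sum +
          (row.map fun z => ((images (μ, p, b, C) z).map g).sum).sum := by
        rw [hT, List.map_append, List.sum_append, sum_map_flatMap]
      have h4 : images (μ, p, b, halves T) = images (μ, p, b, C) := rfl
      rw [h4] at h1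
      rw [value, value, List.length_cons, pow_succ]
      linarith
    · have hT0 : ∀ z ∈ T, z = 0 := by
        intro z hz
        rcases List.mem_append.1 hz with hz | hz
        · exact hC z hz
        · obtain ⟨y, -, hy⟩ := List.mem_flatMap.1 hz
          subst h4
          rw [images, if_neg (by norm_num)] at hy
          split_ifs at hy
          · simpa using hy
          · simp at hy
      obtain ⟨h5, h6⟩ := hQ h4 fun z hz => hT0 z (mem_of_mem_halves hz)
      exact ⟨List.forall_mem_cons.2 ⟨length_odds_le_one hT0, h5⟩, h6⟩

theorem steps_pass_carry {μ : ℕ} (hμ : μ = 2 ∨ μ = 4) (b : List Bool) (n : ℕ) (C B : List ℕ)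
    (hn : C.length ≤ n) : ∃ O, O.length ≤ n ∧
      Steps (O.length + 1) (afterPopA (μ, p, b, C) inp [] B o)
        (afterPopB (μ + 1, p, b, []) inp [] (codes O.reverse ++ B) o) ∧
      (∀ g, value g O = (C.map g).sum) ∧
      ((∀ z ∈ C, z = 0) → ∀ row ∈ O, row.length ≤ 1) := by
  induction n generalizing C B with
  | zero =>
    obtain rfl : C = [] := List.eq_nil_of_length_eq_zero (by omega)
    refine ⟨[], le_rfl, ?_, fun g => rfl, by simp⟩
    have hact : act 0 (μ, p, b, []) = (Cmd.pop (false, true), 0, μ + 1, p, b, []) := by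
      rw [act_pass hμ]; rfl
    exact steps_one hact (by simp)
  | succ n ih =>
    by_cases hC : C = []
    · obtain ⟨O, h1, h2⟩ := ih C B (by simp [hC])
      exact ⟨O, by omega, h2⟩
    · have hpos := List.length_pos_iff.2 hC
      have hhalf := length_halves_le C
      obtain ⟨O, hO, hS, hV, hQ⟩ := ih (halves C) (codes [odds C] ++ B) (by omega)
      have hact : act 0 (μ, p, b, C) =
          (Cmd.pushB (true, false), encode (odds C) + 1, μ, p, b, halves C) := by
        have hsum : summands 0 (μ, p, b, C) = C := by simp [summands]
        rw [act_pass hμ, actPass, if_neg (by simp [hC]), hsum]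
      refine ⟨odds C :: O, by simpa using hO, ?_, fun g => ?_, fun h => ?_⟩
      · have s := steps_one (inp := inp) (A := []) (B := B) (o := o) hact (by simp)
        have e : codes (odds C :: O).reverse ++ B = codes O.reverse ++ (codes [odds C] ++ B) := by
          simp [codes]
        rw [e, List.length_cons, Nat.add_comm]
        exact Run.trans s hS
      · rw [value, hV, sum_odds_add_sum_halves]
      · exact List.forall_mem_cons.2 ⟨length_odds_le_one h, hQ fun z hz => h z (mem_of_mem_halves hz)⟩

theorem steps_back (b : List Bool) (R : List (List ℕ)) (A : List ℕ) :
    Steps (R.length + 1) (afterPopB (3, p, b, []) inp A (codes R) o)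
      (afterRead (1, p, [], []) inp (codes R.reverse ++ A) [] o) := by
  induction R generalizing A with
  | nil =>
    have hact : act 0 (3, p, b, []) = (Cmd.pop (true, true), 0, 1, p, [], []) := rfl
    exact steps_one hact (by simp)
  | cons row R ih =>
    have hact : act (encode row + 1) (3, p, b, []) =
        (Cmd.pushA (false, true), encode row + 1, 3, p, b, []) := rfl
    have s := steps_one (inp := inp) (A := A) (B := codes R) (o := o) hact (by simp)
    have e : codes (row :: R).reverse ++ A = codes R.reverse ++ (codes [row] ++ A) := by
      simp [codes]
    rw [e, List.length_cons, Nat.add_comm (R.length + 1) 1]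
    exact Run.trans s (ih _)

theorem encodeNat_of_pos {n : ℕ} (hn : n ≠ 0) : Computability.encodeNat n =
    decide (n % 2 = 1) :: Computability.encodeNat (n / 2) := by
  unfold Computability.encodeNat
  rcases hp : (n : Num) with _ | q
  · have := congrArg (fun x : Num => (x : ℕ)) hp
    simp only [Num.to_of_nat] at this
    exact absurd this hn
  · have hnp : n = (q : ℕ) := by
      have := congrArg (fun x : Num => (x : ℕ)) hp
      rwa [Num.to_of_nat] at this
    have key (q : PosNum) : (((q : ℕ) : ℕ) : Num) = Num.pos q := Num.of_to_nat (Num.pos q)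
    subst hnp
    cases q with
    | one => rfl
    | bit0 q =>
      have h1 : ((PosNum.bit0 q : PosNum) : ℕ) = 2 * (q : ℕ) := by
        rw [PosNum.cast_bit0]; ring
      rw [h1, Nat.mul_div_cancel_left _ (by norm_num), key]
      simp [Computability.encodeNum, Computability.encodePosNum]
    | bit1 q =>
      have h1 : ((PosNum.bit1 q : PosNum) : ℕ) = 2 * (q : ℕ) + 1 := by
        rw [PosNum.cast_bit1]; ring
      rw [h1, show (2 * (q : ℕ) + 1) / 2 = (q : ℕ) by omega, key]
      simp [Computability.encodeNum, Computability.encodePosNum, Nat.add_mod]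

/-- The digits of the result are written from the most significant one on. The number `N` is the
one written so far, which is zero if and only if the mode is still `5`. -/
theorem steps_write (b : List Bool) (R : List (List ℕ)) (hR : ∀ row ∈ R, row.length ≤ 1) (N : ℕ) :
    ∃ μ, 5 ≤ μ ∧ Steps R.length
      (afterPopB (if N = 0 then 5 else 6, p, b, []) inp A (codes R) (Computability.encodeNat N))
      (afterPopB (μ, p, b, []) inp A []
        (Computability.encodeNat (N * 2 ^ R.length + value (fun _ => 1) R.reverse))) := by
  induction R generalizing N with
  | nil =>
    refine ⟨if N = 0 then 5 else 6, by split_ifs <;> norm_num, ?_⟩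
    simpa [value, codes] using Run.refl _
  | cons row R ih =>
    obtain ⟨hrow, hR⟩ := List.forall_mem_cons.1 hR
    obtain ⟨μ, hμ, hS⟩ := ih hR (2 * N + row.length)
    refine ⟨μ, hμ, ?_⟩
    have e : N * 2 ^ (row :: R).length + value (fun _ => 1) (row :: R).reverse =
        (2 * N + row.length) * 2 ^ R.length + value (fun _ => 1) R.reverse := by
      rw [List.reverse_cons, value_append, List.length_reverse, List.length_cons]
      simp [value]
      ring
    have s : Steps 1 (afterPopB (if N = 0 then 5 else 6, p, b, []) inp A (codes (row :: R))
        (Computability.encodeNat N)) (afterPopB (if 2 * N + row.length = 0 then 5 else 6, p, b, [])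
          inp A (codes R) (Computability.encodeNat (2 * N + row.length))) := by
      rcases row with _ | ⟨z, row⟩
      · by_cases hN : N = 0
        · subst hN
          have hact : act (encode ([] : List ℕ) + 1) (5, p, b, []) =
            (Cmd.pop (false, true), 0, 5, p, b, []) := rfl
          exact steps_one hact (by simp)
        · have hact : act (encode ([] : List ℕ) + 1) (6, p, b, []) =
            (Cmd.write false (false, true), 0, 6, p, b, []) := rfl
          have e1 : Computability.encodeNat (2 * N + ([] : List ℕ).length) =
              false :: Computability.encodeNat N := by
            rw [List.length_nil, Nat.add_zero, encodeNat_of_pos (by omega)]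
            simp
          rw [e1, if_neg hN, if_neg (by simp [hN])]
          exact steps_one hact (by simp)
      · obtain rfl : row = [] := List.eq_nil_of_length_eq_zero (by simpa using hrow)
        have hne : encode [z] ≠ 0 := by simp
        have hact (μ : ℕ) (hμ : μ = 5 ∨ μ = 6) : act (encode [z] + 1) (μ, p, b, []) =
            (Cmd.write true (false, true), 0, 6, p, b, []) := by
          rcases hμ with rfl | rfl <;> simp [act, actWrite]
        have e1 : Computability.encodeNat (2 * N + [z].length) =
            true :: Computability.encodeNat N := by
          rw [List.length_singleton, encodeNat_of_pos (by omega)]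
          simp [show (2 * N + 1) / 2 = N by omega]
        have e2 : (if 2 * N + [z].length = 0 then 5 else 6) = 6 := if_neg (by simp)
        rw [e1, e2]
        exact steps_one (hact (if N = 0 then 5 else 6) (by split_ifs <;> simp)) (by simp)
    rw [e, List.length_cons, Nat.add_comm]
    exact s.trans hS

end Phases

/-! ### The result of the counting machine -/

theorem Run.of_invariant {F : Program} {P : ℕ → ℕ → Prop} {I : Conf → Prop}
    (hI : ∀ c, I c → ¬ c.Halting F → I (c.next F)) (hP : ∀ c, I c → P c.resp c.ctrl) {n : ℕ}
    {c c' : Conf} (h : Run F (fun _ _ => True) n c c') (hc : I c) : Run F P n c c' ∧ I c' := by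
  induction h with
  | refl c => exact ⟨.refl c, hc⟩
  | head _ hh _ ih =>
    obtain ⟨h1, h2⟩ := ih (hI _ hc hh)
    exact ⟨.head (hP _ hc) hh h1, h2⟩

/-- The input that consists of the layers `bs`. -/
def layersInput (bs : List (List Bool)) : List (Option Bool) :=
  bs.flatMap fun b => b.map some ++ [none]

/-- The states reached by the counted automaton from those in `S` by all words. -/
def statesAfter (p : List ℕ) (bs : List (List Bool)) (S : List ℕ) : List ℕ :=
  bs.foldl (fun S b => S.flatMap (succs (p, b))) S

/-- The value of `g` summed over all states that are reached from `z`. -/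
def pullback (p : List ℕ) (bs : List (List Bool)) (g : ℕ → ℕ) : ℕ → ℕ :=
  bs.foldr (fun b h z => ((succs (p, b) z).map h).sum) g

theorem sum_statesAfter (p : List ℕ) (bs : List (List Bool)) (g : ℕ → ℕ) (S : List ℕ) :
    ((statesAfter p bs S).map g).sum = (S.map (pullback p bs g)).sum := by
  induction bs generalizing S with
  | nil => rfl
  | cons b bs ih =>
    have h : statesAfter p (b :: bs) S = statesAfter p bs (S.flatMap (succs (p, b))) := rfl
    rw [h, ih, sum_map_flatMap]
    rfl

theorem ctrl_afterPopA (q : Ctl) (inp : List (Option Bool)) (A B : List ℕ) (o : List Bool) :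
    (afterPopA q inp A B o).ctrl = encode q := rfl

section Result

variable {I : Conf → Prop} {K : ℕ} {p : List ℕ}

theorem steps_layer (hI : ∀ c, I c → ¬ c.Halting counter → I (c.next counter))
    (hK : ∀ c, I c → (ctlOf c.ctrl).2.2.2.length ≤ K) {b : List Bool}
    (hb : b.length ≤ layerLen p) (inp : List (Option Bool)) (R : List (List ℕ))
    (h0 : I (afterRead (1, p, [], []) (b.map some ++ none :: inp) (codes R) [] [])) :
    ∃ n R', n ≤ layerLen p + 3 + 2 * R.length + 2 * K ∧ R'.length ≤ R.length + K ∧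
      Steps n (afterRead (1, p, [], []) (b.map some ++ none :: inp) (codes R) [] [])
        (afterRead (1, p, [], []) inp (codes R') [] []) ∧
      ∀ g, value g R' = value (fun z => ((succs (p, b) z).map g).sum) R := by
  have s1 := steps_layer_bits (inp := none :: inp) (A := codes R) (B := []) (o := []) b []
    (p := p) (by simpa using hb)
  have hact : act (symCode (some none)) (1, p, b, []) = (Cmd.pop (true, false), 0, 2, p, b, []) :=
    rfl
  have s2 : Steps 1 (afterRead (1, p, b, []) (none :: inp) (codes R) [] [])
      (afterPopA (2, p, b, []) inp (codes R) [] []) := steps_one hact (by simp)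
  obtain ⟨O₁, C, hO₁, s3, hV₁, -⟩ := steps_pass_rows (p := p) (inp := inp) (o := []) (μ := 2)
    (Or.inl rfl) b R [] []
  have s := (s1.trans s2).trans s3
  have hC : C.length ≤ K := by
    have h := hK _ (Run.of_invariant (P := fun _ _ => True) hI (fun _ _ => trivial) s h0).2
    rwa [ctrl_afterPopA, ctlOf_encode] at h
  obtain ⟨O₂, hO₂, s4, hV₂, -⟩ := steps_pass_carry (p := p) (inp := inp) (o := []) (μ := 2)
    (Or.inl rfl) b K C (codes O₁.reverse ++ []) hC
  have e : codes O₂.reverse ++ (codes O₁.reverse ++ []) = codes (O₁ ++ O₂).reverse := by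
    simp [codes]
  rw [e] at s4
  have s5 := steps_back (p := p) (inp := inp) (o := []) b (O₁ ++ O₂).reverse []
  rw [List.reverse_reverse, List.append_nil, List.length_reverse] at s5
  refine ⟨_, O₁ ++ O₂, ?_, ?_, (s.trans s4).trans s5, fun g => ?_⟩
  · rw [List.length_append]
    omega
  · rw [List.length_append]
    omega
  · rw [value_append, hV₂, hV₁]
    simp [images]

theorem steps_layers (hI : ∀ c, I c → ¬ c.Halting counter → I (c.next counter))
    (hK : ∀ c, I c → (ctlOf c.ctrl).2.2.2.length ≤ K) {bs : List (List Bool)}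
    (hbs : ∀ b ∈ bs, b.length ≤ layerLen p) (R : List (List ℕ))
    (h0 : I (afterRead (1, p, [], []) (layersInput bs) (codes R) [] [])) :
    ∃ n R', n ≤ bs.length * (layerLen p + 3 + 2 * R.length + 2 * K + 2 * (bs.length * K)) ∧
      R'.length ≤ R.length + bs.length * K ∧
      Steps n (afterRead (1, p, [], []) (layersInput bs) (codes R) [] [])
        (afterRead (1, p, [], []) [] (codes R') [] []) ∧
      ∀ g, value g R' = value (pullback p bs g) R := by
  induction bs generalizing R with
  | nil => exact ⟨0, R, by simp, by simp, .refl _, fun g => rfl⟩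
  | cons b bs ih =>
    obtain ⟨hb, hbs⟩ := List.forall_mem_cons.1 hbs
    have e : layersInput (b :: bs) = b.map some ++ none :: layersInput bs := by simp [layersInput]
    rw [e] at h0 ⊢
    obtain ⟨n₁, R₁, hn₁, hR₁, s₁, hV₁⟩ := steps_layer hI hK hb (layersInput bs) R h0
    obtain ⟨n₂, R₂, hn₂, hR₂, s₂, hV₂⟩ := ih hbs R₁
      (Run.of_invariant (P := fun _ _ => True) hI (fun _ _ => trivial) s₁ h0).2
    refine ⟨n₁ + n₂, R₂, ?_, ?_, s₁.trans s₂, fun g => ?_⟩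
    · have h : layerLen p + 3 + 2 * R₁.length + 2 * K + 2 * (bs.length * K) ≤
          layerLen p + 3 + 2 * R.length + 2 * K + 2 * ((bs.length + 1) * K) := by
        rw [Nat.succ_mul bs.length K]
        omega
      have h' := Nat.mul_le_mul_left bs.length h
      rw [List.length_cons, Nat.succ_mul bs.length (_ + _)]
      omega
    · rw [List.length_cons, Nat.succ_mul bs.length K]
      omega
    · rw [hV₂, hV₁]
      rfl

theorem sum_topAcc (S : List ℕ) (q : Ctl) (hq : q.1 = 4) :
    (S.map fun z => ((images q z).map fun _ => 1).sum).sum = S.countP (topAcc q.2.1) := by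
  induction S with
  | nil => rfl
  | cons z S ih =>
    rw [List.map_cons, List.sum_cons, ih, List.countP_cons, images, if_neg (by omega), add_comm]
    split_ifs <;> rfl

/-- After the parameters have been read, the machine writes the number of accepted words. -/
theorem steps_result (hI : ∀ c, I c → ¬ c.Halting counter → I (c.next counter))
    (hK : ∀ c, I c → (ctlOf c.ctrl).2.2.2.length ≤ K) {bs : List (List Bool)}
    (hbs : ∀ b ∈ bs, b.length ≤ layerLen p) (hne : bs ≠ [])
    (h0 : I (afterRead (1, p, [], []) (layersInput bs) (codes [[topInit p]]) [] [])) :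
    ∃ n μ, n ≤ (layerLen p + 9 + 8 * K) * bs.length ^ 2 ∧ 5 ≤ μ ∧
      Steps n (afterRead (1, p, [], []) (layersInput bs) (codes [[topInit p]]) [] [])
        (afterPopB (μ, p, [], []) [] [] [] (Computability.encodeNat
          ((statesAfter p bs [topInit p]).countP (topAcc p)))) := by
  obtain ⟨n, R, hn, hR, s₁, hV⟩ := steps_layers hI hK hbs _ h0
  have hact : act 0 (1, p, [], []) = (Cmd.pop (true, false), 0, 4, p, [], []) := rfl
  have s₂ : Steps 1 (afterRead (1, p, [], []) [] (codes R) [] [])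
      (afterPopA (4, p, [], []) [] (codes R) [] []) := steps_one hact (by simp)
  obtain ⟨O₁, C, hO₁, s₃, hV₁, hQ₁⟩ := steps_pass_rows (p := p) (inp := []) (o := []) (μ := 4)
    (Or.inr rfl) [] R [] []
  have s := (s₁.trans s₂).trans s₃
  have hC : C.length ≤ K := by
    have h := hK _ (Run.of_invariant (P := fun _ _ => True) hI (fun _ _ => trivial) s h0).2
    rwa [ctrl_afterPopA, ctlOf_encode] at h
  obtain ⟨hQ₁, hQ₁'⟩ := hQ₁ rfl (by simp)
  obtain ⟨O₂, hO₂, s₄, hV₂, hQ₂⟩ := steps_pass_carry (p := p) (inp := []) (o := []) (μ := 4)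
    (Or.inr rfl) [] K C (codes O₁.reverse ++ []) hC
  have e : codes O₂.reverse ++ (codes O₁.reverse ++ []) = codes (O₁ ++ O₂).reverse := by
    simp [codes]
  rw [e] at s₄
  obtain ⟨μ, hμ, s₅⟩ := steps_write (p := p) (inp := []) (A := []) [] (O₁ ++ O₂).reverse
    (fun row hrow => by
      rw [List.mem_reverse] at hrow
      rcases List.mem_append.1 hrow with h | h
      · exact hQ₁ row h
      · exact hQ₂ hQ₁' row h) 0
  have hval : 0 * 2 ^ (O₁ ++ O₂).reverse.length +
      value (fun _ => 1) (O₁ ++ O₂).reverse.reverse =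
        (statesAfter p bs [topInit p]).countP (topAcc p) := by
    rw [zero_mul, zero_add, List.reverse_reverse, value_append, hV₂, hV₁, hV]
    have h1 : value (pullback p bs fun z =>
        ((images (4, p, [], []) z).map fun _ => 1).sum) [[topInit p]] =
        ([topInit p].map (pullback p bs fun z =>
          ((images (4, p, [], []) z).map fun _ => 1).sum)).sum := by simp [value]
    rw [h1, ← sum_statesAfter, sum_topAcc _ _ rfl]
    simp
  rw [hval, List.length_reverse] at s₅
  refine ⟨_, μ, ?_, hμ, (s.trans s₄).trans s₅⟩
  have hk : 1 ≤ bs.length := List.length_pos_iff.2 hne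
  rw [List.length_append]
  simp only [List.length_singleton] at hn hR
  generalize bs.length = k at *
  have h1 : n + 1 + R.length + (O₂.length + 1) + (O₁.length + O₂.length) ≤
      k * (layerLen p + 3 + 2 * 1 + 2 * K + 2 * (k * K)) + 4 + 2 * (k * K) + 2 * K := by omega
  refine h1.trans ?_
  have h2 : k ≤ k ^ 2 := by nlinarith
  have h3 : (1 : ℕ) ≤ k ^ 2 := by nlinarith
  have h4 := Nat.mul_le_mul_right (layerLen p + 5 + 4 * K) h2
  have h5 := Nat.mul_le_mul_right (4 + 2 * K) h3
  have h6 : k * (layerLen p + 3 + 2 * 1 + 2 * K + 2 * (k * K)) + 4 + 2 * (k * K) + 2 * K =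
    k * (layerLen p + 5 + 4 * K) + 2 * K * k ^ 2 + 1 * (4 + 2 * K) := by ring
  rw [h6]
  refine (Nat.add_le_add (Nat.add_le_add_right h4 _) h5).trans (le_of_eq ?_)
  ring

end Result

/-! ### Finitely many states for given parameters -/

theorem finite_lists {S : Set ℕ} (hS : S.Finite) (n : ℕ) :
    {l : List ℕ | l.length ≤ n ∧ ∀ z ∈ l, z ∈ S}.Finite := by
  have : Finite S := hS
  refine ((List.finite_length_le S n).image (List.map Subtype.val)).subset ?_
  rintro l ⟨hl, h⟩
  lift l to List S using h
  exact ⟨l, by simpa using hl, rfl⟩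

theorem finite_nodup_lists {S : Set ℕ} (hS : S.Finite) :
    {l : List ℕ | l.Nodup ∧ ∀ z ∈ l, z ∈ S}.Finite := by
  refine (finite_lists hS hS.toFinset.card).subset fun l hl => ⟨?_, hl.2⟩
  rw [← List.toFinset_card_of_nodup hl.1]
  exact Finset.card_le_card fun z hz => by simpa using hl.2 z (by simpa using hz)

theorem finite_pairs {S S' : Set ℕ} (hS : S.Finite) (hS' : S'.Finite) :
    {z : ℕ | ∃ a ∈ S, ∃ b ∈ S', z = Nat.pair a b}.Finite := by
  refine ((hS.prod hS').image fun x => Nat.pair x.1 x.2).subset ?_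
  rintro _ ⟨a, ha, b, hb, rfl⟩
  exact ⟨(a, b), ⟨ha, hb⟩, rfl⟩

theorem finite_encode_post (w : ℕ) : {z : ℕ | ∃ b n c S, z = encode (post b w n c S)}.Finite := by
  refine ((finite_nodup_lists (Set.finite_lt_nat w)).image encode).subset ?_
  rintro _ ⟨b, n, c, S, rfl⟩
  exact ⟨_, ⟨List.nodup_range.filter _, fun z hz => lt_of_mem_post hz⟩, rfl⟩

section Finiteness

variable (p : List ℕ)

theorem finite_domStep : {z : ℕ | ∃ b d y, z = domStep (p, b) d y}.Finite := by
  refine (finite_pairs (Set.toFinite {0, 1})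
    ((finite_encode_post (pWidth p)).union (Set.finite_singleton 0))).subset ?_
  rintro _ ⟨b, d, y, rfl⟩
  refine ⟨if d = 0 then 0 else 1, by split_ifs <;> simp, _, ?_, rfl⟩
  split_ifs
  · exact Or.inl ⟨_, _, _, _, rfl⟩
  · exact Or.inr (by simp)

theorem finite_stepCode (d : ℕ) (l : List ℕ) :
    {z : ℕ | ∃ b e y, z = stepCode d ((p, b), l, e, y)}.Finite := by
  induction d generalizing l with
  | zero =>
    refine (Set.finite_singleton 0).subset ?_
    rintro _ ⟨b, e, y, rfl⟩
    rfl
  | succ d ih =>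
    rcases l with _ | ⟨t, l⟩
    · refine (Set.finite_singleton 0).subset ?_
      rintro _ ⟨b, e, y, rfl⟩
      rfl
    by_cases h3 : t = 3
    · subst h3
      refine (finite_pairs (ih l) (ih (rest (pArities p) l))).subset ?_
      rintro _ ⟨b, e, y, rfl⟩
      exact ⟨_, ⟨b, e, _, rfl⟩, _, ⟨b, e, _, rfl⟩, stepCode_imp ..⟩
    by_cases h4 : t = 4
    · subst h4
      refine ((finite_nodup_lists (finite_pairs (finite_domStep p) (ih l))).image encode).subset ?_
      rintro _ ⟨b, e, y, rfl⟩
      refine ⟨_, ⟨nodup_nub _, fun z hz => ?_⟩, (stepCode_all ..).symm⟩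
      rw [mem_nub, List.mem_flatMap] at hz
      obtain ⟨x, -, hz⟩ := hz
      obtain ⟨c, -, rfl⟩ := List.mem_map.1 hz
      exact ⟨_, ⟨b, _, _, rfl⟩, _, ⟨b, _, _, rfl⟩, rfl⟩
    refine ((Set.toFinite {0, 1}).union (finite_encode_post (pWidth p))).subset ?_
    rintro _ ⟨b, e, y, rfl⟩
    by_cases h1 : t = 1
    · subst h1
      have h : stepCode (d + 1) ((p, b), 1 :: l, e, y) =
          eqStep ((1 :: l).getD 1 0) ((1 :: l).getD 2 0) e y := rfl
      rw [h, eqStep]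
      exact Or.inl (by split_ifs <;> simp)
    by_cases h2 : t = 2
    · subst h2
      exact Or.inr ⟨_, _, _, _, rfl⟩
    · exact Or.inl (Or.inl (by simp [stepCode, fuelRec, h1, h2, h3, h4]))

/-- The numbers that may occur as states of the counted automaton. -/
def stateSet : Set ℕ := {topInit p, 0} ∪ {z | ∃ b e y, z = topStep (p, b) e y}

theorem finite_stateSet : (stateSet p).Finite := by
  refine (Set.toFinite _).union ((finite_pairs
    ((finite_lists (finite_domStep p) (pVars p)).image encode)
    (finite_stepCode p (pFormula p).length (pFormula p))).subset ?_)
  rintro _ ⟨b, e, y, rfl⟩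
  refine ⟨_, ⟨_, ⟨?_, fun z hz => ?_⟩, rfl⟩, _, ⟨b, e, _, rfl⟩, rfl⟩
  · simp
  · obtain ⟨i, -, rfl⟩ := List.mem_map.1 hz
    exact ⟨_, _, _, rfl⟩

theorem images_subset {μ : ℕ} {b : List Bool} {C : List ℕ} {z y : ℕ}
    (h : y ∈ images (μ, p, b, C) z) : y ∈ stateSet p := by
  rw [images] at h
  split_ifs at h
  · obtain ⟨e, -, rfl⟩ := List.mem_map.1 h
    exact Or.inr ⟨_, _, _, rfl⟩
  · exact Or.inl (Or.inr (by simpa using h))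
  · simp at h

theorem length_images_le (μ : ℕ) (b : List Bool) (C : List ℕ) (z : ℕ) :
    (images (μ, p, b, C) z).length ≤ (allLists (pSize p + 1) (pVars p)).length + 1 := by
  rw [images]
  split_ifs
  · simp [succs]
  · simp
  · simp

/-- For given parameters, finitely many control states and responses occur after the parameters
have been read: the states are numbers in a finite set, rows have no repetitions, and the carry is
not longer than the list of contributions of a row, since it is halved. -/
theorem exists_closed : ∃ Q R : Finset ℕ, encode ((1, p, [], []) : Ctl) ∈ Q ∧
    (∀ r < 4, r ∈ R) ∧ encode [topInit p] + 1 ∈ R ∧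
    ∀ q ∈ Q, ∀ r ∈ R, (counter r q).2.1 ∈ R ∧ (counter r q).2.2 ∈ Q := by
  let R : Set ℕ := {r | r < 4} ∪
    (fun l : List ℕ => encode l + 1) '' {l | l.Nodup ∧ ∀ z ∈ l, z ∈ stateSet p}
  have hR : R.Finite :=
    (Set.finite_lt_nat 4).union ((finite_nodup_lists (finite_stateSet p)).image _)
  obtain ⟨N, hN⟩ := (hR.image fun r => (ofNat (List ℕ) (r - 1)).length).bddAbove
  let M := N * ((allLists (pSize p + 1) (pVars p)).length + 1)
  have hM {μ r : ℕ} {b : List Bool} {C : List ℕ} (hr : r ∈ R) (hC : C.length ≤ M) :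
      (summands r (μ, p, b, C)).length ≤ 2 * M := by
    have h1 : (ofNat (List ℕ) (r - 1)).length ≤ N := hN ⟨r, hr, rfl⟩
    have h2 : ((ofNat (List ℕ) (r - 1)).flatMap (images (μ, p, b, C))).length ≤ M := by
      rw [List.length_flatMap]
      refine (List.sum_le_card_nsmul _ ((allLists (pSize p + 1) (pVars p)).length + 1) ?_).trans ?_
      · intro x hx
        obtain ⟨z, -, rfl⟩ := List.mem_map.1 hx
        exact length_images_le p μ b C z
      · rw [List.length_map, smul_eq_mul]
        exact Nat.mul_le_mul_right _ h1
    rw [summands, List.length_append]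
    dsimp only
    split_ifs
    · simp only [List.length_nil]
      omega
    · omega
  have hsub {μ r : ℕ} {b : List Bool} {C : List ℕ} (hC : ∀ z ∈ C, z ∈ stateSet p) :
      ∀ z ∈ summands r (μ, p, b, C), z ∈ stateSet p := by
    intro z hz
    rcases List.mem_append.1 hz with hz | hz
    · exact hC z hz
    · split_ifs at hz
      · simp at hz
      · obtain ⟨y, -, hy⟩ := List.mem_flatMap.1 hz
        exact images_subset p hy
  let G : Set Ctl := {c | (1 ≤ c.1 ∧ c.1 ≤ 6) ∧ c.2.1 = p ∧ c.2.2.1.length ≤ layerLen p ∧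
    c.2.2.2.length ≤ M ∧ ∀ z ∈ c.2.2.2, z ∈ stateSet p}
  have hG : G.Finite := by
    refine ((Set.finite_le_nat 6).prod ((Set.finite_singleton p).prod
      ((List.finite_length_le Bool (layerLen p)).prod
        (finite_lists (finite_stateSet p) M)))).subset ?_
    rintro ⟨μ, p', b, C⟩ ⟨h1, h2, h3, h4⟩
    exact ⟨h1.2, h2, h3, h4⟩
  refine ⟨(hG.image encode).toFinset, hR.toFinset, ?_, ?_, ?_, ?_⟩
  · rw [Set.Finite.mem_toFinset]
    exact ⟨_, ⟨⟨le_rfl, by norm_num⟩, rfl, Nat.zero_le _, Nat.zero_le _, by simp⟩, rfl⟩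
  · intro r hr
    rw [Set.Finite.mem_toFinset]
    exact Or.inl hr
  · rw [Set.Finite.mem_toFinset]
    exact Or.inr ⟨[topInit p], ⟨by simp, by simp [stateSet]⟩, rfl⟩
  · simp only [Set.Finite.mem_toFinset]
    rintro _ ⟨⟨μ, p', b, C⟩, ⟨⟨hμ1, hμ6⟩, rfl, hb, hC, hCZ⟩, rfl⟩ r hr
    dsimp only at hμ1 hμ6 hb hC hCZ
    have h0R : 0 ∈ R := Or.inl (by norm_num)
    suffices h : (act r (μ, p', b, C)).2.1 ∈ R ∧ (act r (μ, p', b, C)).2.2 ∈ G by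
      rw [counter, ctlOf_encode]
      exact ⟨h.1, ⟨_, h.2, rfl⟩⟩
    have hpass (hμ : μ = 2 ∨ μ = 4) :
        (actPass r (μ, p', b, C)).2.1 ∈ R ∧ (actPass r (μ, p', b, C)).2.2 ∈ G := by
      rw [actPass]
      split_ifs
      · exact ⟨h0R, ⟨by dsimp only; omega, by dsimp only; omega⟩, rfl, hb, hC, hCZ⟩
      · refine ⟨Or.inr ⟨_, ⟨nodup_odds _, fun z hz => hsub hCZ z (mem_of_mem_odds hz)⟩, rfl⟩,
          ⟨hμ1, hμ6⟩, rfl, hb, ?_, fun z hz => hsub hCZ z (mem_of_mem_halves hz)⟩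
        have h1 := length_halves_le (summands r (μ, p', b, C))
        have h2 : (summands r (μ, p', b, C)).length ≤ 2 * M := hM hr hC
        dsimp only
        omega
    rw [act]
    dsimp only
    rw [if_neg (by omega)]
    split_ifs with h1 h2 h3 h4
    · rw [actLayer]
      split_ifs
      · exact ⟨h0R, ⟨by norm_num, by norm_num⟩, rfl, hb, Nat.zero_le _, by simp⟩
      · exact ⟨h0R, ⟨by norm_num, by norm_num⟩, rfl, hb, Nat.zero_le _, by simp⟩
      · refine ⟨h0R, ⟨by norm_num, by norm_num⟩, rfl, ?_, Nat.zero_le _, by simp⟩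
        dsimp only at *
        simp
        omega
      · exact ⟨h0R, ⟨by norm_num, by norm_num⟩, rfl, hb, Nat.zero_le _, by simp⟩
    · exact hpass (Or.inl h2)
    · rw [actBack]
      split_ifs
      · exact ⟨h0R, ⟨by norm_num, by norm_num⟩, rfl, Nat.zero_le _, Nat.zero_le _, by simp⟩
      · exact ⟨hr, ⟨hμ1, hμ6⟩, rfl, hb, hC, hCZ⟩
    · exact hpass (Or.inr h4)
    · rw [actWrite]
      split_ifs
      · exact ⟨h0R, ⟨hμ1, hμ6⟩, rfl, hb, hC, hCZ⟩
      · exact ⟨h0R, ⟨hμ1, hμ6⟩, rfl, hb, hC, hCZ⟩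
      · exact ⟨h0R, ⟨by norm_num, by norm_num⟩, rfl, hb, hC, hCZ⟩

end Finiteness

open Turing.ToPartrec (Code)

/-! ### The time bound -/

theorem exists_callWithin {c : Code} {F : Program}
    (hc : ∀ r q, c.eval [r, q] = pure (instrList (F r q))) (r q : ℕ) :
    ∃ t, CallWithin c F t r q := by
  refine exists_stepsWithin_of_reaches (StateTransition.mem_eval.1 ?_).1
  have := Turing.PartrecToTM2.tr_eval c [r, q]
  rw [hc] at this
  rw [this]
  exact Part.mem_map _ (Part.mem_some _)

/-- The pairs of a response and a control state that may occur while the parameters are read. -/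
def paramPairs (p : List ℕ) : List (ℕ × ℕ) :=
  (List.range ((p.flatMap unary).length + 1)).flatMap fun i => (List.range 4).map fun r =>
    (r, encode ((0, [], (p.flatMap unary).take i, []) : Ctl))

/-- A list of control states, a list of responses, a time bound for the evaluation of the program,
and a bound on the numbers that occur. -/
abbrev Bounds := (List ℕ × List ℕ) × ℕ × ℕ

/-- For the response and the control state in `y`, the program is evaluated within the given time,
and the numbers do not exceed the given bound. The function `pr` decides whether an evaluation takes
a given time. -/
def admissible (pr : ℕ × ℕ × ℕ → Bool) (x : Bounds) (y : ℕ × ℕ) : Bool :=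
  pr (x.2.1, y.1, y.2) && (decide (y.1 ≤ x.2.2) && (decide ((counter y.1 y.2).2.1 ≤ x.2.2) &&
    (decide ((counter y.1 y.2).2.2 ≤ x.2.2) && decide ((ctlOf y.2).2.2.2.length ≤ x.2.2))))

/-- The lists in `x` are closed under the program, and the bounds in `x` are valid for them and for
the phase in which the parameters are read. -/
def valid (pr : ℕ × ℕ × ℕ → Bool) (p : List ℕ) (x : Bounds) : Bool :=
  (paramPairs p).all (admissible pr x) && (decide (encode ((1, p, [], []) : Ctl) ∈ x.1.1) &&
    ([0, 1, 2, 3, encode [topInit p] + 1].all (fun r => decide (r ∈ x.1.2)) &&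
    x.1.1.all fun q => x.1.2.all fun r => admissible pr x (r, q) &&
      (decide ((counter r q).2.1 ∈ x.1.2) && decide ((counter r q).2.2 ∈ x.1.1))))

section Primrec

variable {pr : ℕ × ℕ × ℕ → Bool}

theorem primrec_flatMap_unary : Primrec fun p : List ℕ => p.flatMap unary := by
  have h : Primrec fun n : ℕ => List.replicate n true :=
    (Primrec.list_map Primrec.list_range (Primrec.const true).to₂).of_eq fun x => by
      simp [List.map_const']
  have hu : Primrec unary := Primrec.list_append.comp h (.const [false])
  exact Primrec.list_flatMap .id (hu.comp .snd).to₂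

theorem primrec_paramPairs : Primrec paramPairs := by
  have hu : Primrec fun x : (List ℕ × ℕ) × ℕ => x.1.1.flatMap unary :=
    primrec_flatMap_unary.comp (Primrec.fst.comp .fst)
  have he : Primrec fun x : (List ℕ × ℕ) × ℕ =>
      (((0, [], (x.1.1.flatMap unary).take x.1.2, []) : Ctl)) :=
    Primrec.pair (.const _) (.pair (.const _) (.pair
      (Primrec.list_take.comp (Primrec.snd.comp .fst) hu) (.const _)))
  exact Primrec.list_flatMap (Primrec.list_range.comp (Primrec.succ.comp
    (Primrec.list_length.comp primrec_flatMap_unary)))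
    (Primrec.list_map (.const _) (Primrec.snd.pair (Primrec.encode.comp he)).to₂)

theorem primrec_admissible (hpr : Primrec pr) : Primrec₂ (admissible pr) := by
  have hr : Primrec fun a : Bounds × ℕ × ℕ => a.2.1 := Primrec.fst.comp .snd
  have hq : Primrec fun a : Bounds × ℕ × ℕ => a.2.2 := Primrec.snd.comp .snd
  have ht : Primrec fun a : Bounds × ℕ × ℕ => a.1.2.1 := Primrec.fst.comp (Primrec.snd.comp .fst)
  have hK : Primrec fun a : Bounds × ℕ × ℕ => a.1.2.2 := Primrec.snd.comp (Primrec.snd.comp .fst)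
  have hF : Primrec fun a : Bounds × ℕ × ℕ => (counter a.2.1 a.2.2).2 :=
    Primrec.snd.comp (primrec_counter.comp hr hq)
  have hl : Primrec fun a : Bounds × ℕ × ℕ => (ctlOf a.2.2).2.2.2.length :=
    Primrec.list_length.comp (Primrec.snd.comp (Primrec.snd.comp (Primrec.snd.comp
      (Primrec.option_getD.comp (Primrec.decode.comp hq) (.const _)))))
  have hle {f : Bounds × ℕ × ℕ → ℕ} (hf : Primrec f) :
      Primrec fun a : Bounds × ℕ × ℕ => decide (f a ≤ a.1.2.2) :=
    PrimrecPred.decide (Primrec.nat_le.comp hf hK)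
  exact Primrec.and.comp (hpr.comp (ht.pair (hr.pair hq))) (Primrec.and.comp (hle hr)
    (Primrec.and.comp (hle (Primrec.fst.comp hF)) (Primrec.and.comp (hle (Primrec.snd.comp hF))
      (hle hl))))

theorem primrec_valid (hpr : Primrec pr) : Primrec₂ (valid pr) := by
  have hp : Primrec fun a : List ℕ × Bounds => a.1 := .fst
  have hQ : Primrec fun a : List ℕ × Bounds => a.2.1.1 := Primrec.fst.comp (Primrec.fst.comp .snd)
  have hR : Primrec fun a : List ℕ × Bounds => a.2.1.2 := Primrec.snd.comp (Primrec.fst.comp .snd)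
  have h1 : Primrec fun a : List ℕ × Bounds => (paramPairs a.1).all (admissible pr a.2) :=
    primrec_all (primrec_paramPairs.comp hp)
      ((primrec_admissible hpr).comp (Primrec.snd.comp .fst) .snd).to₂
  have h2 : Primrec fun a : List ℕ × Bounds =>
      decide (encode ((1, a.1, [], []) : Ctl) ∈ a.2.1.1) :=
    primrec_mem (Primrec.encode.comp (Primrec.pair (.const _) (hp.pair (.const _)))) hQ
  have h3 : Primrec fun a : List ℕ × Bounds =>
      [0, 1, 2, 3, encode [topInit a.1] + 1].all fun r => decide (r ∈ a.2.1.2) := by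
    refine primrec_all ?_ (primrec_mem .snd (hR.comp .fst)).to₂
    have he : Primrec fun a : List ℕ × Bounds => encode [topInit a.1] + 1 :=
      Primrec.succ.comp (Primrec.encode.comp
        (Primrec.list_cons.comp (primrec_topInit.comp hp) (.const [])))
    exact Primrec.list_cons.comp (.const 0) (Primrec.list_cons.comp (.const 1)
      (Primrec.list_cons.comp (.const 2) (Primrec.list_cons.comp (.const 3)
        (Primrec.list_cons.comp he (.const [])))))
  have h4 : Primrec fun a : List ℕ × Bounds => a.2.1.1.all fun q => a.2.1.2.all fun r =>
      admissible pr a.2 (r, q) && (decide ((counter r q).2.1 ∈ a.2.1.2) &&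
        decide ((counter r q).2.2 ∈ a.2.1.1)) := by
    have h5 : Primrec fun a : (List ℕ × Bounds) × ℕ => a.1.2.1.2.all fun r =>
        admissible pr a.1.2 (r, a.2) && (decide ((counter r a.2).2.1 ∈ a.1.2.1.2) &&
          decide ((counter r a.2).2.2 ∈ a.1.2.1.1)) := by
      refine primrec_all (hR.comp .fst) ?_
      have hr : Primrec fun a : ((List ℕ × Bounds) × ℕ) × ℕ => a.2 := .snd
      have hq : Primrec fun a : ((List ℕ × Bounds) × ℕ) × ℕ => a.1.2 := Primrec.snd.comp .fst
      have ha : Primrec fun a : ((List ℕ × Bounds) × ℕ) × ℕ => a.1.1 := Primrec.fst.comp .fst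
      have hF : Primrec fun a : ((List ℕ × Bounds) × ℕ) × ℕ => (counter a.2 a.1.2).2 :=
        Primrec.snd.comp (primrec_counter.comp hr hq)
      exact Primrec.and.comp ((primrec_admissible hpr).comp (Primrec.snd.comp ha) (hr.pair hq))
        (Primrec.and.comp (primrec_mem (Primrec.fst.comp hF) (hR.comp ha))
          (primrec_mem (Primrec.snd.comp hF) (hQ.comp ha)))
    exact primrec_all hQ h5.to₂
  exact Primrec.and.comp h1 (Primrec.and.comp h2 (Primrec.and.comp h3 h4))

end Primrec

theorem exists_valid {c : Code} (hc : ∀ r q, c.eval [r, q] = pure (instrList (counter r q)))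
    {pr : ℕ × ℕ × ℕ → Bool} (hpr : ∀ t r q, pr (t, r, q) = true ↔ CallWithin c counter t r q)
    (p : List ℕ) : ∃ x, valid pr p x = true := by
  obtain ⟨Q, R, h1, h2, h3, h4⟩ := exists_closed p
  let S : Finset (ℕ × ℕ) := (paramPairs p).toFinset ∪ R ×ˢ Q
  choose t ht using exists_callWithin hc
  have hbound (f : ℕ × ℕ → ℕ) : ∃ n, ∀ y ∈ S, f y ≤ n := ⟨S.sup f, fun y hy => Finset.le_sup hy⟩
  obtain ⟨tb, htb⟩ := hbound fun y => t y.1 y.2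
  obtain ⟨Kb, hKb⟩ := hbound fun y => y.1 + (counter y.1 y.2).2.1 + (counter y.1 y.2).2.2 +
    (ctlOf y.2).2.2.2.length
  have hadm : ∀ y ∈ S, admissible pr ((Q.toList, R.toList), tb, Kb) y = true := by
    intro y hy
    have h5 := htb y hy
    have h6 := hKb y hy
    simp only [admissible, Bool.and_eq_true, decide_eq_true_iff, hpr]
    refine ⟨StepsWithin.mono (ht _ _) h5, ?_, ?_, ?_, ?_⟩ <;> omega
  refine ⟨((Q.toList, R.toList), tb, Kb), ?_⟩
  simp only [valid, Bool.and_eq_true, List.all_eq_true, decide_eq_true_iff, Finset.mem_toList]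
  refine ⟨fun y hy => hadm y (by simp [S, hy]), h1, ?_, fun q hq r hr =>
    ⟨hadm _ (Finset.mem_union_right _ (Finset.mem_product.2 ⟨hr, hq⟩)), h4 q hq r hr⟩⟩
  intro r hr
  simp only [List.mem_cons, List.not_mem_nil, or_false] at hr
  rcases hr with rfl | rfl | rfl | rfl | rfl
  · exact h2 _ (by norm_num)
  · exact h2 _ (by norm_num)
  · exact h2 _ (by norm_num)
  · exact h2 _ (by norm_num)
  · exact h3

/-- A computable function finds valid bounds by unbounded search. -/
theorem exists_computable_bounds {v : List ℕ → Bounds → Bool} (hv : Primrec₂ v)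
    (h : ∀ p, ∃ x, v p x = true) :
    ∃ g : List ℕ → Bounds, Computable g ∧ ∀ p, v p (g p) = true := by
  have h' : ∀ p, ∃ n, v p (ofNat Bounds n) = true := fun p => by
    obtain ⟨x, hx⟩ := h p
    exact ⟨encode x, by rwa [ofNat_encode]⟩
  have hp : Partrec₂ fun (p : List ℕ) (n : ℕ) => (Part.some (v p (ofNat Bounds n)) : Part Bool) :=
    (hv.comp .fst ((Primrec.ofNat Bounds).comp .snd)).to_comp.partrec
  refine ⟨fun p => ofNat Bounds (Nat.find (h' p)), ?_, fun p => Nat.find_spec (h' p)⟩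
  refine (Primrec.ofNat Bounds).to_comp.comp
    ((Partrec.rfind hp).of_eq_tot fun p => Nat.mem_rfind.2 ⟨?_, fun {m} hm => ?_⟩)
  · rw [Nat.find_spec (h' p)]
    exact Part.mem_some _
  · have := Nat.find_min (h' p) hm
    rw [Bool.not_eq_true] at this
    rw [this]
    exact Part.mem_some _

/-! ### The counting machine within its time bound -/

/-- The response, the control state, and the numbers on the work stacks belong to the lists. -/
def Within (x : Bounds) (c : Conf) : Prop :=
  c.resp ∈ x.1.2 ∧ c.ctrl ∈ x.1.1 ∧ (∀ v ∈ c.stackA, v ∈ x.1.2) ∧ ∀ v ∈ c.stackB, v ∈ x.1.2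

theorem Within.pop {x : Bounds} (h0 : ∀ r < 4, r ∈ x.1.2) {c : Conf} (h : Within x c)
    (src : Bool × Bool) : Within x (c.pop src) := by
  have hhead (l : List ℕ) (hl : ∀ v ∈ l, v ∈ x.1.2) : l.headD 0 ∈ x.1.2 := by
    rcases l with _ | ⟨v, l⟩
    · exact h0 0 (by norm_num)
    · exact hl v (by simp)
  obtain ⟨h1, h2, h3, h4⟩ := h
  rcases src with ⟨_ | _, _ | _⟩
  · exact ⟨h1, h2, h3, h4⟩
  · exact ⟨hhead _ h4, h2, h3, fun v hv => h4 v (List.mem_of_mem_tail hv)⟩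
  · exact ⟨hhead _ h3, h2, fun v hv => h3 v (List.mem_of_mem_tail hv), h4⟩
  · exact ⟨h0 _ (symCode_lt _), h2, h3, h4⟩

theorem Within.next {F : Program} {x : Bounds} (h0 : ∀ r < 4, r ∈ x.1.2)
    (hx : ∀ q ∈ x.1.1, ∀ r ∈ x.1.2, (F r q).2.1 ∈ x.1.2 ∧ (F r q).2.2 ∈ x.1.1)
    {c : Conf} (h : Within x c) : Within x (c.next F) := by
  obtain ⟨h1, h2, h3, h4⟩ := h
  obtain ⟨h5, h6⟩ := hx _ h2 _ h1
  have hpush : Within x (c.push (F c.resp c.ctrl)) := by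
    refine ⟨h1, h6, ?_, ?_⟩
    · simp only [Conf.push]
      split_ifs
      · exact List.forall_mem_cons.2 ⟨h5, h3⟩
      · exact h3
    · simp only [Conf.push]
      split_ifs
      · exact List.forall_mem_cons.2 ⟨h5, h4⟩
      · exact h4
  exact hpush.pop h0 _

theorem stateList_eq_statesAfter {p : List ℕ} {x : ℕ → LayerCtx} (hx : ∀ j, (x j).1 = p) (k : ℕ) :
    stateList p x k = statesAfter p ((List.range k).map fun j => (x j).2) [topInit p] := by
  induction k with
  | zero => rfl
  | succ k ih =>
    rw [stateList, ih, List.range_succ, List.map_append, statesAfter, statesAfter,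
      List.foldl_append, ← hx k]
    rfl

/-- The bound on the running time divided by the square of the length of the tuple. -/
def timeBound (p : List ℕ) (x : Bounds) : ℕ :=
  ((p.flatMap unary).length + layerLen p + 13 + 8 * x.2.2) * (x.2.1 + 2 * x.2.2 + 4)

theorem primrec_timeBound : Primrec₂ timeBound := by
  have hK : Primrec fun a : List ℕ × Bounds => a.2.2.2 := Primrec.snd.comp (Primrec.snd.comp .snd)
  have ht : Primrec fun a : List ℕ × Bounds => a.2.2.1 := Primrec.fst.comp (Primrec.snd.comp .snd)
  exact Primrec.nat_mul.comp (Primrec.nat_add.comp (Primrec.nat_add.comp (Primrec.nat_add.comp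
    (Primrec.list_length.comp (primrec_flatMap_unary.comp .fst)) (primrec_layerLen.comp .fst))
    (.const 13)) (Primrec.nat_mul.comp (.const 8) hK)) (Primrec.nat_add.comp (Primrec.nat_add.comp
      ht (Primrec.nat_mul.comp (.const 2) hK)) (.const 4))

theorem halting_final {μ : ℕ} (hμ : 5 ≤ μ) {p : List ℕ} (o : List Bool) :
    (afterPopB (μ, p, [], []) [] [] [] o).Halting counter ∧
    ((afterPopB (μ, p, [], []) [] [] [] o).push
      (counter 0 (encode ((μ, p, [], []) : Ctl)))).stackA = [] ∧
    ((afterPopB (μ, p, [], []) [] [] [] o).push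
      (counter 0 (encode ((μ, p, [], []) : Ctl)))).stackB = [] ∧
    ((afterPopB (μ, p, [], []) [] [] [] o).push
      (counter 0 (encode ((μ, p, [], []) : Ctl)))).out = o := by
  have h : act 0 (μ, p, [], []) = (Cmd.pop (false, false), 0, μ, p, [], []) := by
    rw [act, if_neg, if_neg, if_neg, if_neg, if_neg, actWrite, if_pos rfl] <;> dsimp only <;> omega
  have hF : counter 0 (encode ((μ, p, [], []) : Ctl)) =
      (Cmd.pop (false, false), 0, encode ((μ, p, [], []) : Ctl)) := by
    rw [counter, ctlOf_encode, h]
  have hc : afterPopB (μ, p, [], []) [] [] [] o =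
    ⟨0, encode ((μ, p, [], []) : Ctl), [], [], [], o⟩ := rfl
  rw [hc, hF]
  exact ⟨by rw [Conf.Halting, hF], rfl, rfl, rfl⟩

theorem outputsWithin_counter {c : Code} {pr : ℕ × ℕ × ℕ → Bool}
    (hpr : ∀ t r q, pr (t, r, q) = true ↔ CallWithin c counter t r q) {s w : ℕ} {V : RelVocab}
    {m : ℕ} (φ : V.lang.Formula (Fin m)) {k : ℕ} {T : LayerTuple (Fin s) w V k}
    (hT : T.IsStructural) {x : Bounds} (hx : valid pr (paramCode s w V m φ) x = true) :
    OutputsWithin (simComputer c) (inputWord φ T) (Computability.encodeNat (T.countSat φ))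
      (timeBound (paramCode s w V m φ) x * k ^ 2) := by
  generalize hp : paramCode s w V m φ = p at hx ⊢
  simp only [valid, Bool.and_eq_true, List.all_eq_true, decide_eq_true_iff] at hx
  obtain ⟨hpairs, hstart, hresp, hclosed⟩ := hx
  have hlt : ∀ r < 4, r ∈ x.1.2 := fun r hr => hresp r (by interval_cases r <;> simp)
  have hI (c : Conf) (h : Within x c) : Within x (c.next counter) :=
    h.next hlt fun q hq r hr => (hclosed q hq r hr).2
  have hP (c : Conf) (h : Within x c) : admissible pr x (c.resp, c.ctrl) = true :=
    (hclosed _ h.2.1 _ h.1).1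
  have hK (c : Conf) (h : Within x c) : (ctlOf c.ctrl).2.2.2.length ≤ x.2.2 := by
    have := hP c h
    simp only [admissible, Bool.and_eq_true, decide_eq_true_iff] at this
    exact this.2.2.2.2
  let y : ℕ → LayerCtx := fun j => (p, if h : j < k then T.code ⟨j, h⟩ else [])
  have hy (j : Fin k) : y j = (paramCode s w V m φ, T.code j) := by simp [y, hp]
  let bs := (List.finRange k).map T.code
  have hbs : bs = (List.range k).map fun j => (y j).2 :=
    List.ext_getElem (by simp [bs]) fun i h h' => by
      have hi : i < k := by simpa using h'
      simp [bs, y, hi]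
  have hlen : ∀ b ∈ bs, b.length ≤ layerLen p := by
    intro b hb
    obtain ⟨j, -, rfl⟩ := List.mem_map.1 hb
    rw [← hp, length_tupleCode φ]
  have hk : 0 < k := hT.isODD_dom.length_pos
  have hne : bs ≠ [] := by
    rw [← List.length_pos_iff]
    simpa [bs] using hk
  have hinput : inputWord φ T = (p.flatMap unary).map some ++ none :: layersInput bs := by
    rw [inputWord, hp, layersInput, List.flatMap_map]
  have h0 : Within x (afterRead (1, p, [], []) (layersInput bs) (codes [[topInit p]]) [] []) :=
    ⟨hlt _ (symCode_lt _), hstart, by simpa [codes, afterRead] using hresp _ (by simp),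
      by simp [afterRead]⟩
  have s₁ := run_params (p := p) (inp := layersInput bs) (A := []) (B := []) (o := [])
    (P := fun r q => admissible pr x (r, q) = true) fun r hr i hi => hpairs _ (by
      simp only [paramPairs, List.mem_flatMap, List.mem_map, List.mem_range]
      exact ⟨i, by omega, r, hr, rfl⟩)
  obtain ⟨n, μ, hn, hμ, s₂⟩ := steps_result (p := p) (fun c h _ => hI c h) hK hlen hne h0
  obtain ⟨s₂, h1⟩ := Run.of_invariant (P := fun r q => admissible pr x (r, q) = true)
    (fun c h _ => hI c h) hP s₂ h0
  have hcount : (statesAfter p bs [topInit p]).countP (topAcc p) = T.countSat φ := by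
    rw [hbs, ← stateList_eq_statesAfter (x := y) (fun j => rfl), ← countP_stateList hT hy, hp]
  rw [hcount] at s₂ h1
  rw [hinput]
  obtain ⟨hhalt, hA, hB, ho⟩ :=
    halting_final hμ (p := p) (Computability.encodeNat (T.countSat φ))
  have s := s₁.trans s₂
  have hout := outputsWithin_of_run (c := c) (t := x.2.1) (K := x.2.2) (fun r q h => by
      simp only [admissible, Bool.and_eq_true, decide_eq_true_iff, hpr] at h
      exact ⟨h.1, h.2.1, h.2.2.1, h.2.2.2.1⟩) s (hP _ h1) hhalt rfl hA hB ho
  obtain ⟨⟨h, h'⟩⟩ := hout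
  refine ⟨⟨h, h'.trans ?_⟩⟩
  have hbl : bs.length = k := by simp [bs]
  rw [hbl] at hn
  have hk2 : 1 ≤ k ^ 2 := Nat.one_le_pow _ _ hk
  have h2 : (p.flatMap unary).length + 2 + n + 2 ≤
      ((p.flatMap unary).length + layerLen p + 13 + 8 * x.2.2) * k ^ 2 := by
    have h3 := Nat.mul_le_mul_left ((p.flatMap unary).length + 4) hk2
    calc (p.flatMap unary).length + 2 + n + 2
        = ((p.flatMap unary).length + 4) * 1 + n := by ring
      _ ≤ ((p.flatMap unary).length + 4) * k ^ 2 + (layerLen p + 9 + 8 * x.2.2) * k ^ 2 :=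
        Nat.add_le_add h3 hn
      _ = _ := by ring
  calc _ ≤ _ := Nat.mul_le_mul_right _ h2
    _ = _ := by rw [timeBound]; ring

end OddCount

theorem theorem5 :
    ∃ (M : Turing.TM2ComputableAux (Option Bool) Bool) (f : List ℕ → ℕ),
      (∀ κ, Finite (M.tm.Γ κ)) ∧ Computable f ∧
      ∀ (s w : ℕ) (V : RelVocab) (m : ℕ) (φ : V.lang.Formula (Fin m)), 0 < s → 0 < w →
        ∀ (k : ℕ) (T : LayerTuple (Fin s) w V k), T.IsStructural →
          OutputsWithin M (inputWord φ T) (Computability.encodeNat (T.countSat φ))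
            (f (paramCode s w V m φ) * k ^ 2) := by
  obtain ⟨c, hc⟩ := OddCount.exists_code_of_primrec OddCount.primrec_counter
  obtain ⟨pr, hpr, hpr'⟩ := OddCount.exists_primrecPred_callWithin hc
  obtain ⟨g, hg, hv⟩ := OddCount.exists_computable_bounds (OddCount.primrec_valid hpr)
    (OddCount.exists_valid hc hpr')
  exact ⟨OddCount.simComputer c, fun p => OddCount.timeBound p (g p), OddCount.finite_sym,
    OddCount.primrec_timeBound.to_comp.comp .id hg, fun s w V m φ _ _ k T hT =>
      OddCount.outputsWithin_counter hpr' φ hT (hv _)⟩
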